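/- There is a probability measure $\gamma_H$ on $\mathbb{R}$ with the following properties. (i) Let $\{X_k : k=0,1,2,\dots\}$ be any sequence of i.i.d. real-valued random variables on a probability space with $\operatorname{Var}(X_1)=1$. For $n\ge 1$ let $\mathbf{H}_n=[X_{i+j-1}]_{1\le i,j\le n}$ be the random $n\times n$ Hankel matrix, and let $\hat\mu(\mathbf{H}_n/\sqrt n)=\frac1n\sum_{j=1}^n\delta_{\lambda_j}$, where $\lambda_1,\dots,\lambda_n$ are the eigenvalues of $\mathbf{H}_n/\sqrt n$, counted with multiplicity. Then with probability $1$, $\hat\mu(\mathbf{H}_n/\sqrt n)$ converges weakly to $\gamma_H$ as $n\to\infty$. (In particular $\gamma_H$ is nonrandom and does not depend on the distribution of $X_1$.) (ii) $\gamma_H$ is symmetric, that is, invariant under $x\mapsto -x$. (iii) The support of $\gamma_H$ is unbounded. (iv) $\gamma_H$ is not unimodal, where a symmetric distribution $\nu$ is called unimodal if the function $x\mapsto\nu((-\infty,x])$ is convex for $x<0$. (v) All moments of $\gamma_H$ are finite, and its moments $m_k=\int x^k\,\gamma_H(dx)$ satisfy $m_4=2$, $m_6=11/2$ and $m_8=281/15$.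 -/

import Mathlib

open MeasureTheory ProbabilityTheory Filter Topology
open scoped ENNReal

noncomputable section

/-- The `n × n` Hankel matrix `[x_{i+j-1}]_{1 ≤ i, j ≤ n}`. The indices of `Fin n` start at `0`,
so the entry at `(i, j) : Fin n × Fin n` is `x_{(i+1)+(j+1)-1} = x_{i+j+1}`. -/
def hankelMatrix (x : ℕ → ℝ) (n : ℕ) : Matrix (Fin n) (Fin n) ℝ :=
  Matrix.of fun i j => x (i.val + j.val + 1)

theorem hankelMatrix_isHermitian (x : ℕ → ℝ) (n : ℕ) : (hankelMatrix x n).IsHermitian := by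
  ext i j
  simp [hankelMatrix, add_comm]

/-- The Hankel matrix scaled by `1 / √n`. -/
def scaledHankelMatrix (x : ℕ → ℝ) (n : ℕ) : Matrix (Fin n) (Fin n) ℝ :=
  (Real.sqrt n)⁻¹ • hankelMatrix x n

theorem scaledHankelMatrix_isHermitian (x : ℕ → ℝ) (n : ℕ) :
    (scaledHankelMatrix x n).IsHermitian := by
  ext i j
  simp [scaledHankelMatrix, hankelMatrix, add_comm]

/-- The empirical spectral measure `(1/n) ∑ⱼ δ_{λⱼ}` of a real symmetric `n × n` matrix with
eigenvalues `λ₁, …, λₙ`, counted with multiplicity. -/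
def empiricalSpectralMeasure {n : ℕ} {A : Matrix (Fin n) (Fin n) ℝ} (hA : A.IsHermitian) :
    Measure ℝ :=
  (n : ℝ≥0∞)⁻¹ • ∑ j : Fin n, Measure.dirac (hA.eigenvalues j)

instance empiricalSpectralMeasure_isProbabilityMeasure {n : ℕ} [NeZero n]
    {A : Matrix (Fin n) (Fin n) ℝ} (hA : A.IsHermitian) :
    IsProbabilityMeasure (empiricalSpectralMeasure hA) := by
  constructor
  simp [empiricalSpectralMeasure, ENNReal.inv_mul_cancel, NeZero.ne n]

/-- The empirical spectral measure of `H_n / √n`, for `n ≥ 1`, as a probability measure. -/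
def hankelSpectralMeasure (x : ℕ → ℝ) (n : ℕ) [NeZero n] : ProbabilityMeasure ℝ :=
  ⟨empiricalSpectralMeasure (scaledHankelMatrix_isHermitian x n), inferInstance⟩

/-- A measure on the line is symmetric if it is invariant under `x ↦ -x`. -/
def IsSymmetricMeasure (ν : Measure ℝ) : Prop :=
  ν.map (fun x => -x) = ν

/-- Unimodality of a symmetric distribution: the distribution function `x ↦ ν((-∞, x])` is convex
for `x < 0`. -/
def IsUnimodalSymmetric (ν : Measure ℝ) : Prop :=
  IsSymmetricMeasure ν ∧ ConvexOn ℝ (Set.Iio 0) (fun x => ν.real (Set.Iic x))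

end

/-! For bounded, centred, normalized entries the method of moments applies. The trace of `H_n ^ K`
is a sum over closed walks of products of letters, and such a product has nonzero mean only if no
letter occurs exactly once. Counting free parameters then leaves the walks whose letters coincide in
pairs. On a cycle of even length `2k` the alternating sum of the letters vanishes, so a pairing that
joins two letters of the same parity turns this identity into a real constraint and loses a
dimension. The surviving pairings are the permutations `σ` of `k` objects. The walks matched by `σ`
are the lattice points of a dilated convex polytope in dimension `k + 1`, and the even moments tend
to the sum of the volumes of these polytopes. On an odd cycle the letters determine the walk and
nothing survives.

The same counting bounds the variance of a normalized trace by a multiple of `1/n`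
(`exists_trace_hankelMatrix_asymptotics`), which is summable along squares. For sizes between two
squares the matrix is compared with a zero-padded smaller Hankel matrix
(`tendsto_hankelCharFun_of_sq`).

The polytopes have volume at most `2 ^ (k + 1)`, so the limit moment of order `2k` is at most `k! *
2 ^ (k + 1)`. This growth is slow enough for a Taylor expansion of characteristic functions to turn
convergence of moments into weak convergence (`tendsto_of_tendsto_hankelMoment`). Tightness, applied
to one realization with Gaussian entries, produces the limit law. Vanishing odd moments and
determinacy give symmetry.

General entries are reduced to bounded ones through the normalized trace of `exp(itH_n/√n)`.
Subtracting the mean is a rank-one perturbation of negligible effect, and truncation is a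
perturbation whose Frobenius norm is governed by the strong law of large numbers
(`ae_tendsto_hankelSpectralMeasure`).

For unbounded support, the quadratic forms of a Gaussian Hankel matrix in the Fourier modes are
Gaussian with variance bounded below, and by Jensen their even moments are dominated by the trace.
So the limit moments dominate those of a Gaussian of variance `1/4`
(`gaussian_moment_le_hankelMoment`).

A unimodal symmetric law decreases away from `0`, so integration by parts makes the integral of `Q'`
over the positive half line nonnegative whenever `Q ≥ 0` there and `Q 0 = 0`. The choice `Q y = y *
(y ^ 4 - 8 * y ^ 2 + 14) ^ 2` contradicts the moments up to order eight.

Those moments come from two symmetries of the volumes: rotating the cyclic word preserves them, and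
so does deleting an adjacent matched pair. Only the cyclic matchings on three and four objects
remain, and their walks are counted exactly. -/

/-! ### Perturbation bounds for the trace of `exp(itA)` -/

open Matrix in
/-- Orthogonal diagonalization of a real symmetric matrix. -/
theorem Matrix.IsHermitian.exists_orthogonal_diagonalization {n : Type*} [Fintype n]
    [DecidableEq n] {A : Matrix n n ℝ} (hA : A.IsHermitian) :
    ∃ U : Matrix n n ℝ, U * Uᵀ = 1 ∧ Uᵀ * U = 1 ∧ A = U * diagonal hA.eigenvalues * Uᵀ := by
  refine ⟨(hA.eigenvectorUnitary : Matrix n n ℝ), ?_, ?_, ?_⟩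
  · have := Unitary.coe_mul_star_self hA.eigenvectorUnitary
    rwa [Unitary.coe_star, star_eq_conjTranspose, conjTranspose_eq_transpose_of_trivial] at this
  · have := Unitary.coe_star_mul_self hA.eigenvectorUnitary
    rwa [star_eq_conjTranspose, conjTranspose_eq_transpose_of_trivial] at this
  · have := hA.spectral_theorem
    rw [Unitary.conjStarAlgAut_apply, star_eq_conjTranspose,
      conjTranspose_eq_transpose_of_trivial] at this
    exact this

open Matrix in
theorem Matrix.trace_transpose_mul_self_eq_sum {n : Type*} [Fintype n] (M : Matrix n n ℝ) :
    (Mᵀ * M).trace = ∑ i, ∑ j, M i j ^ 2 := by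
  rw [Finset.sum_comm]
  simp [trace, mul_apply, pow_two]

open Matrix in
/-- Any two real symmetric matrices are linked by an orthogonal matrix `Q` relating their
eigenbases. -/
theorem Matrix.IsHermitian.exists_orthogonal_intertwining {n : Type*} [Fintype n]
    [DecidableEq n] {A B : Matrix n n ℝ} (hA : A.IsHermitian) (hB : B.IsHermitian) :
    ∃ Q U V : Matrix n n ℝ, U * Uᵀ = 1 ∧ V * Vᵀ = 1 ∧ Q * Qᵀ = 1 ∧ Qᵀ * Q = 1 ∧
      ∀ i j, (Uᵀ * (A - B) * V) i j = (hA.eigenvalues i - hB.eigenvalues j) * Q i j := by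
  obtain ⟨U, hU1, hU2, hU3⟩ := hA.exists_orthogonal_diagonalization
  obtain ⟨V, hV1, hV2, hV3⟩ := hB.exists_orthogonal_diagonalization
  refine ⟨Uᵀ * V, U, V, hU1, hV1, ?_, ?_, fun i j => ?_⟩
  · rw [transpose_mul, transpose_transpose, Matrix.mul_assoc, ← Matrix.mul_assoc V, hV1,
      Matrix.one_mul, hU2]
  · rw [transpose_mul, transpose_transpose, Matrix.mul_assoc, ← Matrix.mul_assoc U, hU1,
      Matrix.one_mul, hV2]
  · have h : Uᵀ * (A - B) * V =
        diagonal hA.eigenvalues * (Uᵀ * V) - (Uᵀ * V) * diagonal hB.eigenvalues := by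
      have h1 : Uᵀ * A = diagonal hA.eigenvalues * Uᵀ := by
        conv_lhs => rw [hU3]
        rw [← Matrix.mul_assoc, ← Matrix.mul_assoc, hU2, Matrix.one_mul]
      have h2 : B * V = V * diagonal hB.eigenvalues := by
        conv_lhs => rw [hV3]
        rw [Matrix.mul_assoc, hV2, Matrix.mul_one]
      rw [Matrix.mul_sub, Matrix.sub_mul, h1, Matrix.mul_assoc Uᵀ B V, h2]
      simp only [Matrix.mul_assoc]
    rw [h, sub_apply, diagonal_mul, mul_diagonal]
    ring

open Matrix in
theorem Matrix.sum_sq_orthogonal_mul_mul {n : Type*} [Fintype n] [DecidableEq n]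
    {U V C : Matrix n n ℝ} (hU : U * Uᵀ = 1) (hV : V * Vᵀ = 1) :
    ∑ i, ∑ j, (Uᵀ * C * V) i j ^ 2 = ∑ i, ∑ j, C i j ^ 2 := by
  rw [← trace_transpose_mul_self_eq_sum, ← trace_transpose_mul_self_eq_sum]
  have : (Uᵀ * C * V)ᵀ * (Uᵀ * C * V) = Vᵀ * (Cᵀ * C * V) := by
    simp only [transpose_mul, transpose_transpose, Matrix.mul_assoc]
    rw [← Matrix.mul_assoc U, hU, Matrix.one_mul]
  rw [this, trace_mul_comm, Matrix.mul_assoc, hV, Matrix.mul_one]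

open Matrix in
theorem Matrix.sum_sq_row_of_orthogonal {n : Type*} [Fintype n] [DecidableEq n]
    {Q : Matrix n n ℝ} (hQ : Q * Qᵀ = 1) (i : n) : ∑ j, Q i j ^ 2 = 1 := by
  have := congrFun (congrFun hQ i) i
  simpa [mul_apply, pow_two] using this

open Matrix in
theorem Matrix.sum_sq_col_of_orthogonal {n : Type*} [Fintype n] [DecidableEq n]
    {Q : Matrix n n ℝ} (hQ : Qᵀ * Q = 1) (j : n) : ∑ i, Q i j ^ 2 = 1 := by
  have := congrFun (congrFun hQ j) j
  simpa [mul_apply, pow_two] using this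

theorem norm_exp_mul_I_sub_le (t x y : ℝ) :
    ‖Complex.exp (t * x * Complex.I) - Complex.exp (t * y * Complex.I)‖ ≤ |t| * |x - y| := by
  have h : Complex.exp (t * x * Complex.I) - Complex.exp (t * y * Complex.I) =
      Complex.exp ((t * y : ℝ) * Complex.I) *
        (Complex.exp (Complex.I * (t * (x - y) : ℝ)) - 1) := by
    rw [mul_sub, ← Complex.exp_add]
    push_cast
    ring_nf
  rw [h, norm_mul, Complex.norm_exp_ofReal_mul_I, one_mul]
  refine Real.norm_exp_I_mul_ofReal_sub_one_le.trans ?_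
  rw [Real.norm_eq_abs, abs_mul]

/-- Perturbation bound in the Frobenius norm for the trace of `exp (i t A)`. -/
theorem Matrix.IsHermitian.norm_sum_exp_sub_le_frobenius {n : Type*} [Fintype n]
    [DecidableEq n] {A B : Matrix n n ℝ} (hA : A.IsHermitian) (hB : B.IsHermitian) (t : ℝ) :
    ‖∑ i, Complex.exp (t * hA.eigenvalues i * Complex.I) -
      ∑ i, Complex.exp (t * hB.eigenvalues i * Complex.I)‖ ≤
      |t| * (√(Fintype.card n) * √(∑ i, ∑ j, (A - B) i j ^ 2)) := by
  obtain ⟨Q, U, V, hU, hV, hQ, hQ', hC⟩ := hA.exists_orthogonal_intertwining hB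
  -- The squares of the entries of `Q` form a doubly stochastic matrix, so both traces become sums
  -- over pairs `(i, j)` with the same weights, as in the Hoffman–Wielandt inequality.
  have h1 : ∑ i, Complex.exp (t * hA.eigenvalues i * Complex.I) =
      ∑ i, ∑ j, (Q i j ^ 2 : ℝ) * Complex.exp (t * hA.eigenvalues i * Complex.I) := by
    refine Finset.sum_congr rfl fun i _ => ?_
    rw [← Finset.sum_mul, ← Complex.ofReal_sum, sum_sq_row_of_orthogonal hQ]
    simp
  have h2 : ∑ j, Complex.exp (t * hB.eigenvalues j * Complex.I) =
      ∑ i, ∑ j, (Q i j ^ 2 : ℝ) * Complex.exp (t * hB.eigenvalues j * Complex.I) := by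
    rw [Finset.sum_comm]
    refine Finset.sum_congr rfl fun i _ => ?_
    rw [← Finset.sum_mul, ← Complex.ofReal_sum, sum_sq_col_of_orthogonal hQ']
    simp
  have h3 : ∑ i, ∑ j, Q i j ^ 2 = (Fintype.card n : ℝ) := by
    simp [sum_sq_row_of_orthogonal hQ]
  rw [h1, h2, ← Finset.sum_sub_distrib]
  simp_rw [← Finset.sum_sub_distrib, ← mul_sub]
  rw [← sum_sq_orthogonal_mul_mul (C := A - B) hU hV, ← h3]
  simp_rw [hC]
  rw [← Fintype.sum_prod_type' (f := fun i j => Q i j ^ 2),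
    ← Fintype.sum_prod_type' (f := fun i j =>
      ((hA.eigenvalues i - hB.eigenvalues j) * Q i j) ^ 2),
    ← Fintype.sum_prod_type' (f := fun i j => ((Q i j ^ 2 : ℝ) : ℂ) *
      (Complex.exp (t * hA.eigenvalues i * Complex.I) -
        Complex.exp (t * hB.eigenvalues j * Complex.I)))]
  refine (norm_sum_le _ _).trans ?_
  calc _ ≤ ∑ x : n × n, |t| * (|Q x.1 x.2| *
        |(hA.eigenvalues x.1 - hB.eigenvalues x.2) * Q x.1 x.2|) := by
        refine Finset.sum_le_sum fun x _ => ?_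
        rw [norm_mul, Complex.norm_real, Real.norm_eq_abs, abs_pow, abs_mul]
        calc _ ≤ |Q x.1 x.2| ^ 2 * (|t| * |hA.eigenvalues x.1 - hB.eigenvalues x.2|) := by
              gcongr
              exact norm_exp_mul_I_sub_le _ _ _
          _ = _ := by ring
    _ ≤ _ := by
        rw [← Finset.mul_sum]
        gcongr
        have := Real.sum_mul_le_sqrt_mul_sqrt (Finset.univ : Finset (n × n))
          (fun x => |Q x.1 x.2|)
          (fun x => |(hA.eigenvalues x.1 - hB.eigenvalues x.2) * Q x.1 x.2|)
        simpa only [sq_abs] using this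

open Matrix in
theorem Matrix.sum_norm_sq_map_orthogonal_mulVec {n : Type*} [Fintype n] [DecidableEq n]
    {Q : Matrix n n ℝ} (hQ : Qᵀ * Q = 1) (β : n → ℂ) :
    ∑ i, ‖∑ j, (Q i j : ℂ) * β j‖ ^ 2 = ∑ j, ‖β j‖ ^ 2 := by
  have key : ∀ β : n → ℝ, ∑ i, (∑ j, Q i j * β j) ^ 2 = ∑ j, β j ^ 2 := by
    intro β
    have h : (Q *ᵥ β) ⬝ᵥ (Q *ᵥ β) = β ⬝ᵥ β := by
      rw [dotProduct_mulVec, vecMul_mulVec, hQ, vecMul_one]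
    simpa [dotProduct, mulVec, pow_two] using h
  have hre := key fun j => (β j).re
  have him := key fun j => (β j).im
  simp_rw [← Complex.normSq_eq_norm_sq, Complex.normSq_apply, Finset.sum_add_distrib]
  simpa [pow_two] using congrArg₂ (· + ·) hre him

open Matrix in
/-- Rank-one perturbation bound for the trace of `exp (i t A)`. -/
theorem Matrix.IsHermitian.norm_sum_exp_sub_le_rankOne {n : Type*} [Fintype n]
    [DecidableEq n] {A B : Matrix n n ℝ} (hA : A.IsHermitian) (hB : B.IsHermitian) (t c : ℝ)
    (v : n → ℝ) (hAB : ∀ i j, (A - B) i j = c * (v i * v j)) :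
    ‖∑ i, Complex.exp (t * hA.eigenvalues i * Complex.I) -
      ∑ i, Complex.exp (t * hB.eigenvalues i * Complex.I)‖ ≤
      |t| * (|c| * ∑ i, v i ^ 2) := by
  obtain ⟨Q, U, V, hU, hV, hQ, hQ', hC⟩ := hA.exists_orthogonal_intertwining hB
  set lam := hA.eigenvalues
  set mu := hB.eigenvalues
  have hrank : ∀ i j, (lam i - mu j) * Q i j = c * ((Uᵀ *ᵥ v) i * (Vᵀ *ᵥ v) j) := by
    intro i j
    rw [← hC]
    have hAB' : A - B = c • vecMulVec v v := by
      ext i j; rw [hAB]; simp [vecMulVec_apply]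
    rw [hAB', Matrix.mul_smul, Matrix.smul_mul, smul_apply, mul_vecMulVec, vecMulVec_mul,
      vecMulVec_apply, smul_eq_mul, mulVec_transpose V]
  have hnorm : ∀ W : Matrix n n ℝ, W * Wᵀ = 1 → ∑ i, (Wᵀ *ᵥ v) i ^ 2 = ∑ i, v i ^ 2 := by
    intro W hW
    have h : (Wᵀ *ᵥ v) ⬝ᵥ (Wᵀ *ᵥ v) = v ⬝ᵥ v := by
      rw [dotProduct_mulVec, vecMul_mulVec, transpose_transpose, hW, vecMul_one]
    simpa [dotProduct, pow_two] using h
  -- Duhamel's interpolation: `F s` is the trace of `exp(isA) exp(i(t-s)B)` written in the two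
  -- eigenbases. Its derivative contains `A - B` once, and the rank-one form reduces it to a single
  -- inner product, bounded by Cauchy–Schwarz.
  let F : ℝ → ℂ := fun s => ∑ i, ∑ j, ((Q i j ^ 2 : ℝ) : ℂ) *
    (Complex.exp (s * lam i * Complex.I) * Complex.exp ((t - s) * mu j * Complex.I))
  let F' : ℝ → ℂ := fun s => ∑ i, ∑ j, ((Q i j ^ 2 : ℝ) : ℂ) *
    (Complex.exp (s * lam i * Complex.I) * (lam i * Complex.I) *
      Complex.exp ((t - s) * mu j * Complex.I) + Complex.exp (s * lam i * Complex.I) *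
      (Complex.exp ((t - s) * mu j * Complex.I) * (-(mu j * Complex.I))))
  have hF : ∀ s, HasDerivAt F (F' s) s := by
    intro s
    refine HasDerivAt.fun_sum fun i _ => HasDerivAt.fun_sum fun j _ => ?_
    refine HasDerivAt.const_mul _ (HasDerivAt.mul ?_ ?_)
    · have h0 : HasDerivAt (fun s : ℝ => (s : ℂ) * lam i * Complex.I) (lam i * Complex.I) s := by
        have := ((hasDerivAt_id s).ofReal_comp.mul_const (lam i : ℂ)).mul_const Complex.I
        simpa using this
      exact h0.cexp
    · have h0 : HasDerivAt (fun s : ℝ => ((t : ℂ) - s) * mu j * Complex.I)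
          (-(mu j * Complex.I)) s := by
        have := (((hasDerivAt_id s).ofReal_comp.const_sub (t : ℂ)).mul_const
          (mu j : ℂ)).mul_const Complex.I
        simpa using this
      exact h0.cexp
  have hF'eq : ∀ s, F' s = (c * Complex.I) * ∑ i,
      (((Uᵀ *ᵥ v) i : ℂ) * Complex.exp (s * lam i * Complex.I)) *
      ∑ j, (Q i j : ℂ) * (((Vᵀ *ᵥ v) j : ℂ) * Complex.exp ((t - s) * mu j * Complex.I)) := by
    intro s
    simp only [F', Finset.mul_sum]
    refine Finset.sum_congr rfl fun i _ => Finset.sum_congr rfl fun j _ => ?_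
    have h := congrArg (fun x : ℝ => (x : ℂ)) (hrank i j)
    push_cast at h ⊢
    linear_combination (Complex.I * Q i j * Complex.exp (s * lam i * Complex.I) *
      Complex.exp ((t - s) * mu j * Complex.I)) * h
  have hbound : ∀ s, ‖F' s‖ ≤ |c| * ∑ i, v i ^ 2 := by
    intro s
    rw [hF'eq, norm_mul, norm_mul, Complex.norm_I, mul_one, Complex.norm_real, Real.norm_eq_abs]
    gcongr
    have e1 : ∀ i, ‖((Uᵀ *ᵥ v) i : ℂ) * Complex.exp (s * lam i * Complex.I)‖ ^ 2 =
        (Uᵀ *ᵥ v) i ^ 2 := by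
      intro i
      have : (s * lam i : ℂ) = ((s * lam i : ℝ) : ℂ) := by push_cast; rfl
      rw [norm_mul, this, Complex.norm_exp_ofReal_mul_I, mul_one, Complex.norm_real,
        Real.norm_eq_abs, sq_abs]
    have e2 : ∀ j, ‖((Vᵀ *ᵥ v) j : ℂ) * Complex.exp ((t - s) * mu j * Complex.I)‖ ^ 2 =
        (Vᵀ *ᵥ v) j ^ 2 := by
      intro i
      have : ((t - s) * mu i : ℂ) = (((t - s) * mu i : ℝ) : ℂ) := by push_cast; rfl
      rw [norm_mul, this, Complex.norm_exp_ofReal_mul_I, mul_one, Complex.norm_real,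
        Real.norm_eq_abs, sq_abs]
    have e3 := sum_norm_sq_map_orthogonal_mulVec hQ'
      (fun j => ((Vᵀ *ᵥ v) j : ℂ) * Complex.exp ((t - s) * mu j * Complex.I))
    simp_rw [e2] at e3
    rw [hnorm V hV] at e3
    have e4 := hnorm U hU
    simp_rw [← e1] at e4
    refine (norm_sum_le _ _).trans ?_
    simp_rw [norm_mul (_ * _) _]
    refine (Real.sum_mul_le_sqrt_mul_sqrt _ _ _).trans ?_
    rw [e3, e4]
    exact (Real.mul_self_sqrt (Finset.sum_nonneg fun i _ => sq_nonneg _)).le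
  have hmv := Convex.norm_image_sub_le_of_norm_hasDerivWithin_le (f := F) (f' := F')
    (C := |c| * ∑ i, v i ^ 2) (s := Set.univ) (x := 0) (y := t)
    (fun s _ => (hF s).hasDerivWithinAt) (fun s _ => hbound s) convex_univ trivial trivial
  have hF0 : F 0 = ∑ i, Complex.exp (t * mu i * Complex.I) := by
    simp only [F]
    rw [Finset.sum_comm]
    refine Finset.sum_congr rfl fun i _ => ?_
    simp only [Complex.ofReal_zero, zero_mul, Complex.exp_zero, one_mul, sub_zero]
    rw [← Finset.sum_mul, ← Complex.ofReal_sum, sum_sq_col_of_orthogonal hQ']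
    simp
  have hFt : F t = ∑ i, Complex.exp (t * lam i * Complex.I) := by
    simp only [F]
    refine Finset.sum_congr rfl fun i _ => ?_
    simp only [sub_self, zero_mul, Complex.exp_zero, mul_one]
    rw [← Finset.sum_mul, ← Complex.ofReal_sum, sum_sq_row_of_orthogonal hQ]
    simp
  rw [hF0, hFt] at hmv
  refine hmv.trans (le_of_eq ?_)
  rw [sub_zero, Real.norm_eq_abs]
  ring

/-! ### Traces of powers, zero padding and empirical spectral measures -/

open Matrix in
theorem Matrix.IsHermitian.sum_eigenvalues_pow {n : Type*} [Fintype n] [DecidableEq n]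
    {A : Matrix n n ℝ} (hA : A.IsHermitian) (k : ℕ) :
    ∑ i, hA.eigenvalues i ^ k = (A ^ k).trace := by
  obtain ⟨U, -, hU, h⟩ := hA.exists_orthogonal_diagonalization
  have hpow : ∀ k, A ^ k * U = U * diagonal (fun i => hA.eigenvalues i ^ k) := by
    intro k
    induction k with
    | zero => simp
    | succ k ih =>
      have h2 : A * U = U * diagonal hA.eigenvalues := by
        conv_lhs => rw [h]
        rw [Matrix.mul_assoc, hU, Matrix.mul_one]
      rw [pow_succ, Matrix.mul_assoc, h2, ← Matrix.mul_assoc, ih, Matrix.mul_assoc,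
        diagonal_mul_diagonal]
      simp [pow_succ]
  have h3 : (A ^ k).trace = (Uᵀ * (A ^ k * U)).trace := by
    have hU' := mul_eq_one_comm.mp hU
    rw [trace_mul_comm, Matrix.mul_assoc, hU', Matrix.mul_one]
  rw [h3, hpow, ← Matrix.mul_assoc, hU, Matrix.one_mul, trace_diagonal]

open Matrix Polynomial in
/-- Bordering a symmetric matrix by zeros adds zero eigenvalues. -/
theorem Matrix.IsHermitian.sum_eigenvalues_zero_padding {m n : ℕ} {A : Matrix (Fin m) (Fin m) ℝ}
    (hA : A.IsHermitian) {B : Matrix (Fin (m + n)) (Fin (m + n)) ℝ} (hB : B.IsHermitian)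
    (h : B = Matrix.reindex finSumFinEquiv finSumFinEquiv
      (Matrix.fromBlocks A 0 0 (0 : Matrix (Fin n) (Fin n) ℝ)))
    (f : ℝ → ℂ) :
    ∑ i, f (hB.eigenvalues i) = ∑ i, f (hA.eigenvalues i) + n * f 0 := by
  have hchar : B.charpoly = A.charpoly * X ^ n := by
    rw [h, charpoly_reindex, charpoly_fromBlocks_zero₂₁]
    simp
  have h1 := hB.roots_charpoly_eq_eigenvalues
  rw [hchar, roots_mul (mul_ne_zero A.charpoly_monic.ne_zero (pow_ne_zero _ X_ne_zero)),
    hA.roots_charpoly_eq_eigenvalues, roots_X_pow] at h1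
  have h2 := congrArg (fun s => (s.map f).sum) h1
  simp only [Multiset.map_add, Multiset.sum_add, Multiset.map_map, Multiset.nsmul_singleton,
    Multiset.map_replicate, Multiset.sum_replicate] at h2
  simpa [Finset.sum_eq_multiset_sum] using h2.symm

theorem integral_empiricalSpectralMeasure {n : ℕ} {A : Matrix (Fin n) (Fin n) ℝ}
    (hA : A.IsHermitian) {E : Type*} [NormedAddCommGroup E] [NormedSpace ℝ E] [CompleteSpace E]
    (f : ℝ → E) :
    ∫ x, f x ∂(empiricalSpectralMeasure hA) = (n : ℝ)⁻¹ • ∑ i, f (hA.eigenvalues i) := by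
  rw [empiricalSpectralMeasure, integral_smul_measure, integral_finsetSum_measure]
  · simp
  · intro i _
    exact integrable_dirac (by simp)

theorem integrable_empiricalSpectralMeasure {n : ℕ} [NeZero n] {A : Matrix (Fin n) (Fin n) ℝ}
    (hA : A.IsHermitian) (f : ℝ → ℝ) : Integrable f (empiricalSpectralMeasure hA) := by
  rw [empiricalSpectralMeasure]
  refine Integrable.smul_measure ?_ (by simp [NeZero.ne n])
  rw [integrable_finsetSum_measure]
  intro i _
  exact integrable_dirac (by simp)

theorem charFun_hankelSpectralMeasure (x : ℕ → ℝ) (n : ℕ) [NeZero n] (t : ℝ) :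
    charFun (hankelSpectralMeasure x n : Measure ℝ) t = (n : ℂ)⁻¹ * ∑ i,
      Complex.exp (t * (scaledHankelMatrix_isHermitian x n).eigenvalues i * Complex.I) := by
  rw [charFun_apply_real]
  change ∫ y, _ ∂(empiricalSpectralMeasure (scaledHankelMatrix_isHermitian x n)) = _
  rw [integral_empiricalSpectralMeasure]
  simp

theorem integral_pow_hankelSpectralMeasure (x : ℕ → ℝ) (n : ℕ) [NeZero n] (k : ℕ) :
    ∫ y, y ^ k ∂(hankelSpectralMeasure x n : Measure ℝ) =
      (n : ℝ)⁻¹ * ((√n)⁻¹ ^ k * (hankelMatrix x n ^ k).trace) := by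
  change ∫ y, _ ∂(empiricalSpectralMeasure (scaledHankelMatrix_isHermitian x n)) = _
  rw [integral_empiricalSpectralMeasure, smul_eq_mul, Matrix.IsHermitian.sum_eigenvalues_pow,
    scaledHankelMatrix, smul_pow, Matrix.trace_smul, smul_eq_mul]

theorem integrable_hankelSpectralMeasure (x : ℕ → ℝ) (n : ℕ) [NeZero n] (f : ℝ → ℝ) :
    Integrable f (hankelSpectralMeasure x n : Measure ℝ) :=
  integrable_empiricalSpectralMeasure (scaledHankelMatrix_isHermitian x n) f

/-! ### Counting integer families with few distinct values -/

/-- A finite set whose elements are determined by `R.card` numbers below `M` has at most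
`M ^ R.card` elements. -/
theorem Finset.card_le_pow_of_determined {α ι : Type*} (I : Finset α) (d : α → ι → ℕ)
    (R : Finset ι) (M : ℕ) (hd : ∀ a ∈ I, ∀ j ∈ R, d a j < M)
    (hinj : ∀ a ∈ I, ∀ b ∈ I, (∀ j ∈ R, d a j = d b j) → a = b) : I.card ≤ M ^ R.card := by
  classical
  have h := Finset.card_le_card_of_injOn (s := I)
    (t := Fintype.piFinset fun _ : R => Finset.range M)
    (fun a j => d a j) (by
      intro a ha
      simp only [Fintype.coe_piFinset, Finset.coe_range, Set.mem_pi]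
      intro j _
      exact hd a ha j j.2) (by
      intro a ha b hb hab
      exact hinj a ha b hb fun j hj => congrFun hab ⟨j, hj⟩)
  simpa using h

/-- A choice of representative index in every fibre of `g`. -/
noncomputable def fiberRep {ι : Type*} (g : ι → ℕ) (j : ι) : ι :=
  Set.rangeSplitting g ⟨g j, Set.mem_range_self j⟩

theorem apply_fiberRep {ι : Type*} (g : ι → ℕ) (j : ι) : g (fiberRep g j) = g j :=
  Set.apply_rangeSplitting g _

theorem fiberRep_eq_iff {ι : Type*} (g : ι → ℕ) (j j' : ι) :
    fiberRep g j = fiberRep g j' ↔ g j = g j' := by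
  constructor
  · intro h
    rw [← apply_fiberRep g j, h, apply_fiberRep g]
  · intro h
    simp only [fiberRep, h]

theorem card_image_fiberRep_le {ι : Type*} [Fintype ι] [DecidableEq ι] (g : ι → ℕ) :
    (Finset.univ.image (fiberRep g)).card ≤ (Finset.univ.image g).card := by
  refine Finset.card_le_card_of_injOn g ?_ ?_
  · intro j _
    simp
  · intro j hj j' hj' h
    simp only [Finset.coe_image, Finset.coe_univ, Set.image_univ, Set.mem_range] at hj hj'
    obtain ⟨i, rfl⟩ := hj
    obtain ⟨i', rfl⟩ := hj'
    rw [apply_fiberRep g, apply_fiberRep g] at h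
    exact (fiberRep_eq_iff g i i').2 h

/-- Counting objects with few distinct values. -/
theorem Finset.card_le_of_card_image_le {α τ ι : Type*} [Fintype τ] [Fintype ι] (I : Finset α)
    (t : α → τ → ℕ) (d : α → ι → ℕ) (M r : ℕ) (hM : 0 < M)
    (ht : ∀ a ∈ I, ∀ j, t a j < M) (hd : ∀ a ∈ I, ∀ j, d a j < M)
    (hinj : ∀ a ∈ I, ∀ b ∈ I, t a = t b → d a = d b → a = b)
    (hr : ∀ a ∈ I, (Finset.univ.image (d a)).card ≤ r) :
    I.card ≤ M ^ (Fintype.card τ + r) * Fintype.card ι ^ Fintype.card ι := by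
  classical
  -- Elements are sorted by their coincidence pattern. There are boundedly many patterns, and within
  -- one pattern `t a` and the values of `d a` at the representatives determine `a`.
  refine (Finset.card_le_mul_card_image (f := fun a => fiberRep (d a)) I
    (M ^ (Fintype.card τ + r)) ?_).trans ?_
  · intro c hc
    obtain ⟨a₀, ha₀, hca₀⟩ := Finset.mem_image.1 hc
    refine (Finset.card_le_pow_of_determined _ (fun a => Sum.elim (t a) (d a))
      (Finset.univ.disjSum (Finset.univ.image c)) M ?_ ?_).trans ?_
    · intro a ha j _
      rw [Finset.mem_filter] at ha
      cases j with
      | inl j => exact ht a ha.1 j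
      | inr j => exact hd a ha.1 j
    · intro a ha b hb hab
      rw [Finset.mem_filter] at ha hb
      refine hinj a ha.1 b hb.1 (funext fun j => hab (Sum.inl j) (by simp)) (funext fun j => ?_)
      have h := hab (Sum.inr (c j)) (by simp)
      simp only [Sum.elim_inr] at h
      rw [← apply_fiberRep (d a), ← apply_fiberRep (d b), ha.2, hb.2, h]
    · rw [Finset.card_disjSum, Finset.card_univ]
      refine Nat.pow_le_pow_right hM ?_
      have := (card_image_fiberRep_le (d a₀)).trans (hr a₀ ha₀)
      rw [hca₀] at this
      lia
  · refine Nat.mul_le_mul_left _ ?_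
    refine (Finset.card_le_univ _).trans ?_
    rw [Fintype.card_fun]

/-- Counting objects with few distinct values subject to a linear relation which involves one of the
values nontrivially. -/
theorem Finset.card_le_of_card_image_le_of_relation {α τ ι : Type*} [Fintype τ] [Fintype ι]
    (I : Finset α) (t : α → τ → ℕ) (d : α → ι → ℕ) (M r : ℕ) (hM : 0 < M)
    (ht : ∀ a ∈ I, ∀ j, t a j < M) (hd : ∀ a ∈ I, ∀ j, d a j < M)
    (hinj : ∀ a ∈ I, ∀ b ∈ I, t a = t b → d a = d b → a = b)
    (hr : ∀ a ∈ I, (Finset.univ.image (d a)).card ≤ r + 1)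
    (w : ι → ℤ) (hw : ∀ a ∈ I, ∑ j, w j * (d a j : ℤ) = 0)
    (hj : ∀ a ∈ I, ∃ j₀, ∑ j with d a j = d a j₀, w j ≠ 0) :
    I.card ≤ M ^ (Fintype.card τ + r) *
      (Fintype.card ι ^ Fintype.card ι * Fintype.card ι) := by
  classical
  by_cases hI : I = ∅
  · simp [hI]
  obtain ⟨a₁, ha₁⟩ := Finset.nonempty_iff_ne_empty.2 hI
  have hne : Nonempty ι := ⟨(hj a₁ ha₁).choose⟩
  have hj' : ∀ a, ∃ j₀, a ∈ I → ∑ j with d a j = d a j₀, w j ≠ 0 := by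
    intro a
    by_cases ha : a ∈ I
    · obtain ⟨j₀, h⟩ := hj a ha
      exact ⟨j₀, fun _ => h⟩
    · exact ⟨Classical.arbitrary ι, fun h => absurd h ha⟩
  choose j₀ hj₀ using hj'
  -- The pattern now also records which class has nonzero total weight. The value on that class is
  -- not counted, which saves one power of `M`.
  refine (Finset.card_le_mul_card_image (f := fun a => (fiberRep (d a), j₀ a)) I
    (M ^ (Fintype.card τ + r)) ?_).trans ?_
  · rintro ⟨c, i₀⟩ hc
    obtain ⟨a₀, ha₀, hca₀⟩ := Finset.mem_image.1 hc
    rw [Prod.mk.injEq] at hca₀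
    refine (Finset.card_le_pow_of_determined _ (fun a => Sum.elim (t a) (d a))
      (Finset.univ.disjSum ((Finset.univ.image c).erase (c i₀))) M ?_ ?_).trans ?_
    · intro a ha j _
      rw [Finset.mem_filter] at ha
      cases j with
      | inl j => exact ht a ha.1 j
      | inr j => exact hd a ha.1 j
    · intro a ha b hb hab
      rw [Finset.mem_filter, Prod.mk.injEq] at ha hb
      have hoff : ∀ j, c j ≠ c i₀ → d a j = d b j := by
        intro j hj
        have h := hab (Sum.inr (c j)) (by simp [hj])
        simp only [Sum.elim_inr] at h
        rw [← apply_fiberRep (d a), ← apply_fiberRep (d b), ha.2.1, hb.2.1, h]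
      have hon : ∀ a, fiberRep (d a) = c → ∀ j, c j = c i₀ ↔ d a j = d a i₀ := by
        intro a h j
        rw [← h, fiberRep_eq_iff]
      -- The relation is grouped by the marked class, so that it can be solved for the common value
      -- there in terms of the other values.
      have hsplit : ∀ a, fiberRep (d a) = c → ∑ j, w j * (d a j : ℤ) =
          (∑ j with c j = c i₀, w j) * d a i₀ + ∑ j with ¬ c j = c i₀, w j * (d a j : ℤ) := by
        intro a h
        rw [← Finset.sum_filter_add_sum_filter_not _ (fun j => c j = c i₀), Finset.sum_mul]
        congr 1
        refine Finset.sum_congr rfl fun j hj => ?_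
        rw [Finset.mem_filter] at hj
        rw [((hon a h j).1 hj.2)]
      have e1 := hsplit a ha.2.1
      have e2 := hsplit b hb.2.1
      rw [hw a ha.1] at e1
      rw [hw b hb.1] at e2
      have e3 : ∑ j with ¬ c j = c i₀, w j * (d a j : ℤ) =
          ∑ j with ¬ c j = c i₀, w j * (d b j : ℤ) := by
        refine Finset.sum_congr rfl fun j hj => ?_
        rw [Finset.mem_filter] at hj
        rw [hoff j hj.2]
      have hne0 : ∑ j with c j = c i₀, w j ≠ 0 := by
        have := hj₀ a ha.1
        rw [ha.2.2] at this
        convert this using 2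
        ext j
        simp [hon a ha.2.1]
      have e4 : (d a i₀ : ℤ) = d b i₀ := by
        apply mul_left_cancel₀ hne0
        linarith
      refine hinj a ha.1 b hb.1 (funext fun j => hab (Sum.inl j) (by simp)) (funext fun j => ?_)
      by_cases h : c j = c i₀
      · rw [(hon a ha.2.1 j).1 h, (hon b hb.2.1 j).1 h]
        exact_mod_cast e4
      · exact hoff j h
    · rw [Finset.card_disjSum, Finset.card_univ, Finset.card_erase_of_mem (by simp)]
      refine Nat.pow_le_pow_right hM ?_
      have := (card_image_fiberRep_le (d a₀)).trans (hr a₀ ha₀)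
      rw [hca₀.1] at this
      lia
  · refine Nat.mul_le_mul_left _ ?_
    refine (Finset.card_le_univ _).trans ?_
    rw [Fintype.card_prod, Fintype.card_fun]

/-! ### Moments and covariances of words in independent letters -/

/-- The expectation of `∏ j, X (s j)` when the `X v` are independent with moments `M`. -/
noncomputable def wordMoment {ι : Type*} [Fintype ι] (M : ℕ → ℝ) (s : ι → ℕ) : ℝ :=
  ∏ v ∈ Finset.univ.image s, M (Finset.card {j | s j = v})

theorem prod_comp_eq_prod_image_pow {ι : Type*} [Fintype ι] (x : ℕ → ℝ) (s : ι → ℕ) :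
    ∏ j, x (s j) = ∏ v ∈ Finset.univ.image s, x v ^ (Finset.card {j | s j = v}) := by
  rw [Finset.prod_comp]

theorem integrable_prod_comp {Ω : Type*} [MeasurableSpace Ω] {P : Measure Ω}
    [IsProbabilityMeasure P] {X : ℕ → Ω → ℝ} (hX : ∀ k (p : ℕ), MemLp (X k) p P)
    {ι : Type*} [Fintype ι] (s : ι → ℕ) : Integrable (fun ω => ∏ j, X (s j) ω) P := by
  rcases isEmpty_or_nonempty ι with h | h
  · simp
  · have := MemLp.prod' (μ := P) (s := Finset.univ) (f := fun j => X (s j))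
      (p := fun _ => ((Fintype.card ι : ℕ) : ℝ≥0∞)) (fun j _ => hX (s j) _)
    rw [← memLp_one_iff_integrable]
    convert this using 1
    rw [Finset.sum_const, Finset.card_univ, nsmul_eq_mul, ENNReal.mul_inv_cancel, inv_one] <;> simp

theorem integral_prod_comp_eq_wordMoment {Ω : Type*} [MeasurableSpace Ω] {P : Measure Ω}
    [IsProbabilityMeasure P] {X : ℕ → Ω → ℝ} (hm : ∀ k, Measurable (X k)) (hind : iIndepFun X P)
    (hid : ∀ k, IdentDistrib (X k) (X 1) P P) {ι : Type*} [Fintype ι] (s : ι → ℕ) :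
    ∫ ω, ∏ j, X (s j) ω ∂P = wordMoment (fun r => ∫ ω, X 1 ω ^ r ∂P) s := by
  classical
  simp_rw [fun ω => prod_comp_eq_prod_image_pow (fun v => X v ω) s]
  rw [wordMoment]
  have h1 : ∀ v : ℕ, ∫ ω, X v ω ^ (Finset.card {j | s j = v}) ∂P =
      ∫ ω, X 1 ω ^ (Finset.card {j | s j = v}) ∂P := fun v =>
    ((hid v).comp (u := fun y => y ^ (Finset.card {j | s j = v})) (by fun_prop)).integral_eq
  simp_rw [← h1]
  have hind' : iIndepFun (fun v : Finset.univ.image s => X v) P :=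
    hind.precomp Subtype.val_injective
  have := iIndepFun.integral_fun_prod_comp (X := fun v : ↥(Finset.univ.image s) => X v) hind'
    (f := fun v y => y ^ (Finset.card {j | s j = (v : ℕ)}))
    (fun v => (hm v).aemeasurable) (fun v => by fun_prop)
  simp_rw [← Finset.prod_coe_sort (Finset.univ.image s)]
  exact this

theorem wordMoment_eq_zero {ι : Type*} [Fintype ι] {M : ℕ → ℝ} (hM : M 1 = 0) {s : ι → ℕ}
    (j : ι) (h : Finset.card {i | s i = s j} = 1) : wordMoment M s = 0 :=
  Finset.prod_eq_zero (i := s j) (by simp) (by rw [h, hM])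

theorem wordMoment_eq_one {ι : Type*} [Fintype ι] {M : ℕ → ℝ} (hM : M 2 = 1) {s : ι → ℕ}
    (h : ∀ j, Finset.card {i | s i = s j} = 2) : wordMoment M s = 1 := by
  refine Finset.prod_eq_one fun v hv => ?_
  obtain ⟨j, -, rfl⟩ := Finset.mem_image.1 hv
  rw [h, hM]

/-- A multiplicity in a word of given length never exceeds that length, so only finitely many values
of `M` matter and the bound is uniform in the letters. -/
theorem exists_abs_wordMoment_le (ι : Type*) [Fintype ι] (M : ℕ → ℝ) :
    ∃ C, 0 ≤ C ∧ ∀ s : ι → ℕ, |wordMoment M s| ≤ C := by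
  set L : ℝ := 1 + ∑ r ∈ Finset.range (Fintype.card ι + 1), |M r|
  have hL : 1 ≤ L := by
    have : 0 ≤ ∑ r ∈ Finset.range (Fintype.card ι + 1), |M r| :=
      Finset.sum_nonneg fun _ _ => abs_nonneg _
    simp only [L]; linarith
  refine ⟨L ^ Fintype.card ι, by positivity, fun s => ?_⟩
  rw [wordMoment, Finset.abs_prod]
  calc _ ≤ ∏ v ∈ Finset.univ.image s, L := by
        refine Finset.prod_le_prod (fun _ _ => abs_nonneg _) fun v _ => ?_
        have h : Finset.card {j | s j = v} ∈ Finset.range (Fintype.card ι + 1) := by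
          rw [Finset.mem_range]
          exact Nat.lt_succ_of_le (Finset.card_le_univ _)
        have := Finset.single_le_sum (f := fun r => |M r|) (fun _ _ => abs_nonneg _) h
        simp only [L]; linarith
    _ = L ^ (Finset.univ.image s).card := by rw [Finset.prod_const]
    _ ≤ _ := pow_le_pow_right₀ hL (Finset.card_image_le.trans (Finset.card_univ).le)

theorem card_filter_sumElim {ι κ : Type*} [Fintype ι] [Fintype κ] (s : ι → ℕ) (s' : κ → ℕ)
    (v : ℕ) : Finset.card {j | Sum.elim s s' j = v} =
      Finset.card {j | s j = v} + Finset.card {j | s' j = v} := by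
  rw [Finset.card_filter, Finset.card_filter, Finset.card_filter, Fintype.sum_sum_type]
  rfl

theorem wordMoment_sumElim {ι κ : Type*} [Fintype ι] [Fintype κ] (M : ℕ → ℝ) (s : ι → ℕ)
    (s' : κ → ℕ) (h : ∀ j j', s j ≠ s' j') :
    wordMoment M (Sum.elim s s') = wordMoment M s * wordMoment M s' := by
  have himg : Finset.univ.image (Sum.elim s s') = Finset.univ.image s ∪ Finset.univ.image s' := by
    ext v; simp
  have hdisj : Disjoint (Finset.univ.image s) (Finset.univ.image s') := by
    rw [Finset.disjoint_left]
    intro v hv hv'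
    obtain ⟨j, -, rfl⟩ := Finset.mem_image.1 hv
    obtain ⟨j', -, h'⟩ := Finset.mem_image.1 hv'
    exact h j j' h'.symm
  rw [wordMoment, himg, Finset.prod_union hdisj, wordMoment, wordMoment]
  congr 1
  · refine Finset.prod_congr rfl fun v hv => ?_
    obtain ⟨j, -, rfl⟩ := Finset.mem_image.1 hv
    rw [card_filter_sumElim]
    have : Finset.card {j' | s' j' = s j} = 0 := by
      simp only [Finset.card_eq_zero, Finset.filter_eq_empty_iff]
      exact fun j' _ h' => h j j' h'.symm
    rw [this, add_zero]
  · refine Finset.prod_congr rfl fun v hv => ?_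
    obtain ⟨j', -, rfl⟩ := Finset.mem_image.1 hv
    rw [card_filter_sumElim]
    have : Finset.card {j | s j = s' j'} = 0 := by
      simp only [Finset.card_eq_zero, Finset.filter_eq_empty_iff]
      exact fun j _ h' => h j j' h'
    rw [this, zero_add]

theorem one_le_card_fiber {ι : Type*} [Fintype ι] (s : ι → ℕ) (j : ι) :
    1 ≤ Finset.card {i | s i = s j} :=
  Finset.card_pos.2 ⟨j, by simp⟩

theorem sum_card_fiber_image {ι : Type*} [Fintype ι] (s : ι → ℕ) :
    ∑ v ∈ Finset.univ.image s, Finset.card {i | s i = v} = Fintype.card ι := by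
  rw [← Finset.card_univ, Finset.card_eq_sum_card_image s]

theorem two_mul_card_image_le {ι : Type*} [Fintype ι] {s : ι → ℕ}
    (h : ∀ j, 2 ≤ Finset.card {i | s i = s j}) :
    2 * (Finset.univ.image s).card ≤ Fintype.card ι := by
  rw [← sum_card_fiber_image s, mul_comm, ← smul_eq_mul, ← Finset.sum_const]
  refine Finset.sum_le_sum fun v hv => ?_
  obtain ⟨j, -, rfl⟩ := Finset.mem_image.1 hv
  exact h j

/-- The equality case of `two_mul_card_image_le`: one fibre larger than two would make the total too
large. -/
theorem card_fiber_eq_two {ι : Type*} [Fintype ι] {s : ι → ℕ}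
    (h : ∀ j, 2 ≤ Finset.card {i | s i = s j})
    (hc : Fintype.card ι ≤ 2 * (Finset.univ.image s).card) (j : ι) :
    Finset.card {i | s i = s j} = 2 := by
  by_contra hne
  have hlt : ∑ v ∈ Finset.univ.image s, 2 <
      ∑ v ∈ Finset.univ.image s, Finset.card {i | s i = v} := by
    refine Finset.sum_lt_sum (fun v hv => ?_) ⟨s j, by simp, lt_of_le_of_ne (h j) (Ne.symm hne)⟩
    obtain ⟨j, -, rfl⟩ := Finset.mem_image.1 hv
    exact h j
  rw [sum_card_fiber_image, Finset.sum_const, smul_eq_mul] at hlt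
  lia

/-- Two words are linked if they share a letter and no letter of their concatenation occurs only
once. -/
def LinkedWords {ι : Type*} [Fintype ι] (s s' : ι → ℕ) : Prop :=
  (∀ j, 2 ≤ Finset.card {i | Sum.elim s s' i = Sum.elim s s' j}) ∧ ∃ j j', s j = s' j'

/-- Either the words have no common letter and the product splits by independence, or some letter
occurs once in the concatenation. That letter then occurs once in one of the two words as well, and
both sides vanish by centring. -/
theorem wordMoment_sumElim_of_not_linkedWords {ι : Type*} [Fintype ι] {M : ℕ → ℝ} (hM : M 1 = 0)
    {s s' : ι → ℕ} (h : ¬ LinkedWords s s') :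
    wordMoment M (Sum.elim s s') = wordMoment M s * wordMoment M s' := by
  by_cases hs : ∀ j j', s j ≠ s' j'
  · exact wordMoment_sumElim M s s' hs
  push Not at hs
  simp only [LinkedWords, not_and_or] at h
  rcases h with h | h
  · push Not at h
    obtain ⟨j, hj⟩ := h
    have h1 : Finset.card {i | Sum.elim s s' i = Sum.elim s s' j} = 1 :=
      le_antisymm (by lia) (one_le_card_fiber _ j)
    rw [wordMoment_eq_zero hM j h1]
    cases j with
    | inl j =>
      have h2 := one_le_card_fiber s j
      have h3 := (card_filter_sumElim s s' (s j)).symm.trans h1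
      rw [wordMoment_eq_zero (s := s) hM j (by lia), zero_mul]
    | inr j =>
      have h2 := one_le_card_fiber s' j
      have h3 := (card_filter_sumElim s s' (s' j)).symm.trans h1
      rw [wordMoment_eq_zero (s := s') hM j (by lia), mul_zero]
  · exact absurd hs h

/-- The variance of a sum of products of independent variables is bounded by the number of pairs
of linked words. -/
theorem integral_sq_sub_sum_wordMoment_le {Ω : Type*} [MeasurableSpace Ω] {P : Measure Ω}
    [IsProbabilityMeasure P] {X : ℕ → Ω → ℝ} (hm : ∀ k, Measurable (X k)) (hind : iIndepFun X P)
    (hid : ∀ k, IdentDistrib (X k) (X 1) P P) (hX : ∀ k (p : ℕ), MemLp (X k) p P)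
    (h0 : ∫ ω, X 1 ω ∂P = 0) (ι : Type*) [Fintype ι] :
    ∃ C, 0 ≤ C ∧ ∀ (α : Type) [Fintype α] (s : α → ι → ℕ),
      Integrable (fun ω => (∑ a, ∏ j, X (s a j) ω -
        ∑ a, wordMoment (fun r => ∫ ω, X 1 ω ^ r ∂P) (s a)) ^ 2) P ∧
      ∫ ω, (∑ a, ∏ j, X (s a j) ω -
        ∑ a, wordMoment (fun r => ∫ ω, X 1 ω ^ r ∂P) (s a)) ^ 2 ∂P ≤
        C * (Nat.card {p : α × α // LinkedWords (s p.1) (s p.2)} : ℝ) := by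
  classical
  set M : ℕ → ℝ := fun r => ∫ ω, X 1 ω ^ r ∂P
  have hM1 : M 1 = 0 := by simpa [M] using h0
  obtain ⟨C₁, hC₁, h₁⟩ := exists_abs_wordMoment_le ι M
  obtain ⟨C₂, hC₂, h₂⟩ := exists_abs_wordMoment_le (ι ⊕ ι) M
  refine ⟨C₂ + C₁ * C₁, by positivity, fun α _ s => ?_⟩
  have hprod : ∀ a b ω, (∏ j, X (s a j) ω) * ∏ j, X (s b j) ω =
      ∏ j, X (Sum.elim (s a) (s b) j) ω := by
    intro a b ω
    rw [Fintype.prod_sum_type]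
    rfl
  -- The square is expanded into covariances of pairs of words; only the linked pairs contribute,
  -- each by a bounded amount.
  have hexp : ∀ ω, (∑ a, ∏ j, X (s a j) ω - ∑ a, wordMoment M (s a)) ^ 2 =
      ∑ a, ∑ b, (∏ j, X (Sum.elim (s a) (s b) j) ω - (∏ j, X (s a j) ω) * wordMoment M (s b)
        - wordMoment M (s a) * (∏ j, X (s b j) ω) + wordMoment M (s a) * wordMoment M (s b)) := by
    intro ω
    rw [← Finset.sum_sub_distrib, pow_two, Finset.sum_mul_sum]
    refine Finset.sum_congr rfl fun a _ => Finset.sum_congr rfl fun b _ => ?_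
    rw [← hprod]
    ring
  have hInt : ∀ a b, Integrable (fun ω => ∏ j, X (Sum.elim (s a) (s b) j) ω -
      (∏ j, X (s a j) ω) * wordMoment M (s b)
        - wordMoment M (s a) * (∏ j, X (s b j) ω) + wordMoment M (s a) * wordMoment M (s b)) P := by
    intro a b
    have i1 := integrable_prod_comp hX (Sum.elim (s a) (s b))
    have i2 := integrable_prod_comp hX (s a)
    have i3 := integrable_prod_comp hX (s b)
    exact ((i1.sub (i2.mul_const _)).sub (i3.const_mul _)).add (integrable_const _)
  have hval : ∀ a b, ∫ ω, (∏ j, X (Sum.elim (s a) (s b) j) ω -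
      (∏ j, X (s a j) ω) * wordMoment M (s b)
        - wordMoment M (s a) * (∏ j, X (s b j) ω) + wordMoment M (s a) * wordMoment M (s b)) ∂P =
      wordMoment M (Sum.elim (s a) (s b)) - wordMoment M (s a) * wordMoment M (s b) := by
    intro a b
    have i1 := integrable_prod_comp hX (Sum.elim (s a) (s b))
    have i2 := integrable_prod_comp hX (s a)
    have i3 := integrable_prod_comp hX (s b)
    have i4 : Integrable (fun ω => ∏ j, X (Sum.elim (s a) (s b) j) ω -
        (∏ j, X (s a j) ω) * wordMoment M (s b)) P := i1.sub (i2.mul_const _)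
    have i5 : Integrable (fun ω => ∏ j, X (Sum.elim (s a) (s b) j) ω -
        (∏ j, X (s a j) ω) * wordMoment M (s b) -
        wordMoment M (s a) * (∏ j, X (s b j) ω)) P := i4.sub (i3.const_mul _)
    rw [integral_add i5 (integrable_const _), integral_sub i4 (i3.const_mul _),
      integral_sub i1 (i2.mul_const _),
      integral_mul_const, integral_const_mul, integral_prod_comp_eq_wordMoment hm hind hid,
      integral_prod_comp_eq_wordMoment hm hind hid, integral_prod_comp_eq_wordMoment hm hind hid]
    simp [M]
  simp_rw [hexp]
  refine ⟨integrable_finsetSum _ fun a _ => integrable_finsetSum _ fun b _ => hInt a b, ?_⟩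
  rw [integral_finsetSum _ fun a _ => integrable_finsetSum _ fun b _ => hInt a b]
  simp_rw [fun a => integral_finsetSum (μ := P) Finset.univ fun b _ => hInt a b, hval]
  rw [← Fintype.sum_prod_type' (f := fun a b =>
    wordMoment M (Sum.elim (s a) (s b)) - wordMoment M (s a) * wordMoment M (s b))]
  calc _ ≤ ∑ p : α × α, if LinkedWords (s p.1) (s p.2) then (C₂ + C₁ * C₁) else 0 := by
        refine Finset.sum_le_sum fun p _ => ?_
        split_ifs with h
        · have e1 := h₂ (Sum.elim (s p.1) (s p.2))
          have e2 : |wordMoment M (s p.1) * wordMoment M (s p.2)| ≤ C₁ * C₁ := by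
            rw [abs_mul]
            exact mul_le_mul (h₁ _) (h₁ _) (abs_nonneg _) hC₁
          have := abs_le.1 e1
          have := abs_le.1 e2
          linarith
        · rw [wordMoment_sumElim_of_not_linkedWords hM1 h, sub_self]
    _ = _ := by
        rw [← Finset.sum_filter, Finset.sum_const, nsmul_eq_mul, mul_comm, Nat.card_eq_fintype_card,
          Fintype.card_subtype]

/-- Counting linked pairs among words determined by their letters. -/
theorem card_linkedWords_le_of_injective {α ι : Type*} [Fintype α] [Fintype ι] (s : α → ι → ℕ)
    (N : ℕ) (hN : 0 < N) (hs : ∀ a j, s a j < N) (hinj : Function.Injective s) :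
    Nat.card {p : α × α // LinkedWords (s p.1) (s p.2)} ≤
      N ^ (Fintype.card ι) * Fintype.card (ι ⊕ ι) ^ Fintype.card (ι ⊕ ι) := by
  classical
  rw [Nat.card_eq_fintype_card, Fintype.card_subtype]
  refine (Finset.card_le_of_card_image_le (τ := Empty) _ (fun _ j => j.elim)
    (fun p : α × α => Sum.elim (s p.1) (s p.2)) N (Fintype.card ι) hN (fun _ _ j => j.elim) ?_ ?_
      ?_).trans (by simp)
  · rintro p - (j | j)
    · exact hs _ _
    · exact hs _ _
  · intro p _ q _ _ h
    refine Prod.ext (hinj (funext fun j => ?_)) (hinj (funext fun j => ?_))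
    · exact congrFun h (Sum.inl j)
    · exact congrFun h (Sum.inr j)
  · intro p hp
    rw [Finset.mem_filter] at hp
    have := two_mul_card_image_le hp.2.1
    rw [Fintype.card_sum] at this
    lia

/-- Counting linked pairs among words determined by one parameter and by their letters, the letters
being subject to a linear relation with nonzero coefficients. -/
theorem card_linkedWords_le_of_relation {α ι : Type*} [Fintype α] [Fintype ι] (s : α → ι → ℕ)
    (t : α → ℕ) (N : ℕ) (hN : 0 < N) (hs : ∀ a j, s a j < N) (ht : ∀ a, t a < N)
    (hinj : ∀ a b, t a = t b → s a = s b → a = b) (w : ι → ℤ) (hw : ∀ j, w j ≠ 0)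
    (hrel : ∀ a, ∑ j, w j * (s a j : ℤ) = 0) (k : ℕ) (hk : Fintype.card ι = k + 1) :
    Nat.card {p : α × α // LinkedWords (s p.1) (s p.2)} ≤
      N ^ (k + 2) * (2 * (Fintype.card (ι ⊕ ι) ^ Fintype.card (ι ⊕ ι) *
        Fintype.card (ι ⊕ ι))) := by
  classical
  rw [Nat.card_eq_fintype_card, Fintype.card_subtype]
  set d : α × α → ι ⊕ ι → ℕ := fun p => Sum.elim (s p.1) (s p.2)
  set T : α × α → Bool → ℕ := fun p b => if b then t p.1 else t p.2
  have hT : ∀ p b, T p b < N := by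
    intro p b
    simp only [T]
    split_ifs
    · exact ht _
    · exact ht _
  have hd : ∀ p j, d p j < N := by
    rintro p (j | j)
    · exact hs _ _
    · exact hs _ _
  have hinj' : ∀ p q, T p = T q → d p = d q → p = q := by
    intro p q h1 h2
    refine Prod.ext (hinj _ _ ?_ (funext fun j => ?_)) (hinj _ _ ?_ (funext fun j => ?_))
    · simpa [T] using congrFun h1 true
    · exact congrFun h2 (Sum.inl j)
    · simpa [T] using congrFun h1 false
    · exact congrFun h2 (Sum.inr j)
  set I : Finset (α × α) := {p | LinkedWords (s p.1) (s p.2)}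
  rw [← Finset.card_filter_add_card_filter_not (s := I)
    (fun p => (Finset.univ.image (d p)).card ≤ k)]
  have b1 : (I.filter fun p => (Finset.univ.image (d p)).card ≤ k).card ≤
      N ^ (k + 2) * Fintype.card (ι ⊕ ι) ^ Fintype.card (ι ⊕ ι) := by
    have := Finset.card_le_of_card_image_le (I.filter fun p => (Finset.univ.image (d p)).card ≤ k)
      T d N k hN (fun p _ => hT p) (fun p _ => hd p) (fun p _ q _ => hinj' p q)
      (fun p hp => (Finset.mem_filter.1 hp).2)
    rwa [Fintype.card_bool, add_comm 2 k] at this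
  have b2 : (I.filter fun p => ¬ (Finset.univ.image (d p)).card ≤ k).card ≤
      N ^ (k + 2) * (Fintype.card (ι ⊕ ι) ^ Fintype.card (ι ⊕ ι) * Fintype.card (ι ⊕ ι)) := by
    -- With the maximal number `k + 1` of distinct letters, each letter of the concatenation occurs
    -- exactly twice. A shared letter therefore occurs once in the first word, where its coefficient
    -- in the relation is a single nonzero `w i`. The relation thus determines one letter and
    -- compensates for the second of the two parameters in `T`.
    have key : ∀ p ∈ I.filter fun p => ¬ (Finset.univ.image (d p)).card ≤ k,
        (Finset.univ.image (d p)).card ≤ k + 1 ∧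
        ∃ j₀, ∑ j with d p j = d p j₀, Sum.elim w (fun _ => 0) j ≠ 0 := by
      intro p hp
      rw [Finset.mem_filter, Finset.mem_filter] at hp
      obtain ⟨⟨-, h1, j, j', hjj⟩, h2⟩ := hp
      have h3 := two_mul_card_image_le h1
      have h4 := fun hc => card_fiber_eq_two h1 hc (Sum.inl j)
      rw [Fintype.card_sum] at h3 h4
      refine ⟨by simp only [d]; lia, Sum.inl j, ?_⟩
      have h5 := (card_filter_sumElim (s p.1) (s p.2) (s p.1 j)).symm.trans
        (h4 (by simp only [d] at h2; lia))
      have h6 := one_le_card_fiber (s p.1) j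
      have h7 := one_le_card_fiber (s p.2) j'
      rw [← hjj] at h7
      have h8 : Finset.card {i | s p.1 i = s p.1 j} = 1 := by lia
      rw [Finset.card_eq_one] at h8
      obtain ⟨i, hi⟩ := h8
      rw [Finset.sum_filter, Fintype.sum_sum_type]
      change (∑ a, if s p.1 a = s p.1 j then w a else 0) +
        (∑ a, if s p.2 a = s p.1 j then (0 : ℤ) else 0) ≠ 0
      simp only [ite_self, Finset.sum_const_zero, add_zero]
      rw [← Finset.sum_filter, hi, Finset.sum_singleton]
      exact hw i
    have := Finset.card_le_of_card_image_le_of_relation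
      (I.filter fun p => ¬ (Finset.univ.image (d p)).card ≤ k)
      T d N k hN (fun p _ => hT p) (fun p _ => hd p) (fun p _ q _ => hinj' p q)
      (fun p hp => (key p hp).1) (Sum.elim w fun _ => 0) (fun p _ => by
        rw [Fintype.sum_sum_type]
        simpa [d] using hrel p.1) (fun p hp => (key p hp).2)
    rwa [Fintype.card_bool, add_comm 2 k] at this
  have hpos : 1 ≤ Fintype.card (ι ⊕ ι) := by rw [Fintype.card_sum]; lia
  calc _ ≤ _ := add_le_add b1 b2
    _ ≤ N ^ (k + 2) * (Fintype.card (ι ⊕ ι) ^ Fintype.card (ι ⊕ ι) * Fintype.card (ι ⊕ ι)) +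
        N ^ (k + 2) * (Fintype.card (ι ⊕ ι) ^ Fintype.card (ι ⊕ ι) * Fintype.card (ι ⊕ ι)) := by
        gcongr
        exact Nat.le_mul_of_pos_right _ hpos
    _ = _ := by ring

/-! ### Traces of powers of Hankel matrices as sums over closed walks -/

/-- The free weight `g` on the starting vertex makes the induction close: summing out the first
vertex replaces `g` by its product with `A`. -/
theorem Matrix.sum_mul_prod_walk {n : Type*} [Fintype n] [DecidableEq n] (A : Matrix n n ℝ) (b : n)
    (K : ℕ) (g : n → ℝ) :
    ∑ i : Fin (K + 1) → n, g (i 0) * ((∏ j : Fin K, A (i j.castSucc) (i j.succ)) *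
      A (i (Fin.last K)) b) = ∑ a, g a * (A ^ (K + 1)) a b := by
  induction K generalizing g with
  | zero =>
    rw [← (Equiv.funUnique (Fin 1) n).symm.sum_comp]
    simp
  | succ K ih =>
    rw [← (Fin.consEquiv fun _ : Fin (K + 2) => n).sum_comp, Fintype.sum_prod_type, Finset.sum_comm]
    have h1 : ∀ i : Fin (K + 1) → n, ∑ a, g (Fin.cons (α := fun _ => n) a i 0) *
        ((∏ j : Fin (K + 1), A (Fin.cons (α := fun _ => n) a i j.castSucc)
          (Fin.cons (α := fun _ => n) a i j.succ)) *
          A (Fin.cons (α := fun _ => n) a i (Fin.last (K + 1))) b) =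
        (∑ a, g a * A a (i 0)) * ((∏ j : Fin K, A (i j.castSucc) (i j.succ)) *
          A (i (Fin.last K)) b) := by
      intro i
      rw [Finset.sum_mul]
      refine Finset.sum_congr rfl fun a _ => ?_
      rw [Fin.prod_univ_succ, ← Fin.succ_last]
      simp only [Fin.castSucc_zero, Fin.cons_zero, Fin.cons_succ, Fin.castSucc_succ]
      ring
    refine (Finset.sum_congr rfl fun i _ => h1 i).trans ?_
    rw [ih (fun c => ∑ a, g a * A a c)]
    simp_rw [pow_succ' A (K + 1), Matrix.mul_apply, Finset.mul_sum, Finset.sum_mul]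
    rw [Finset.sum_comm]
    simp only [mul_assoc]

/-- The trace of a power of a matrix is a sum over closed walks. -/
theorem Matrix.trace_pow_succ {n : Type*} [Fintype n] [DecidableEq n] (A : Matrix n n ℝ) (K : ℕ) :
    (A ^ (K + 1)).trace = ∑ i : Fin (K + 1) → n, ∏ j, A (i j) (i (j + 1)) := by
  have h : ∀ a, (A ^ (K + 1)) a a = ∑ i : Fin (K + 1) → n, (if i 0 = a then 1 else 0) *
      ((∏ j : Fin K, A (i j.castSucc) (i j.succ)) * A (i (Fin.last K)) a) := by
    intro a
    rw [Matrix.sum_mul_prod_walk A a K fun c => if c = a then 1 else 0]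
    simp
  rw [Matrix.trace]
  simp_rw [Matrix.diag_apply, h]
  rw [Finset.sum_comm]
  refine Finset.sum_congr rfl fun i _ => ?_
  rw [Fin.prod_univ_castSucc]
  simp

/-- The letters `i_j + i_{j+1} + 1` read along a closed walk. -/
def walkWord {K n : ℕ} (i : Fin (K + 1) → Fin n) (j : Fin (K + 1)) : ℕ :=
  (i j : ℕ) + i (j + 1) + 1

/-- The letters read along the closed walk `a₀ b₀ a₁ b₁ ⋯` of even length. -/
def bipartiteWord {k n : ℕ} (p : (Fin (k + 1) → Fin n) × (Fin (k + 1) → Fin n)) :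
    Fin (k + 1) ⊕ Fin (k + 1) → ℕ :=
  Sum.elim (fun l => (p.1 l : ℕ) + p.2 l + 1) (fun l => (p.2 l : ℕ) + p.1 (l + 1) + 1)

theorem trace_hankelMatrix_pow_succ (x : ℕ → ℝ) (n K : ℕ) :
    (hankelMatrix x n ^ (K + 1)).trace = ∑ i : Fin (K + 1) → Fin n, ∏ j, x (walkWord i j) :=
  Matrix.trace_pow_succ _ _

theorem trace_hankelMatrix_pow_even (x : ℕ → ℝ) (n k : ℕ) :
    (hankelMatrix x n ^ (2 * (k + 1))).trace =
      ∑ p : (Fin (k + 1) → Fin n) × (Fin (k + 1) → Fin n), ∏ j, x (bipartiteWord p j) := by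
  rw [pow_mul, Matrix.trace_pow_succ, Fintype.sum_prod_type]
  refine Finset.sum_congr rfl fun a _ => ?_
  simp_rw [pow_two, Matrix.mul_apply]
  rw [Finset.prod_univ_sum, Fintype.piFinset_univ]
  refine Finset.sum_congr rfl fun b _ => ?_
  rw [Fintype.prod_sum_type, ← Finset.prod_mul_distrib]
  rfl

theorem walkWord_lt {K n : ℕ} (i : Fin (K + 1) → Fin n) (j : Fin (K + 1)) :
    walkWord i j < 2 * n := by
  have := (i j).2
  have := (i (j + 1)).2
  simp only [walkWord]
  lia

theorem bipartiteWord_lt {k n : ℕ} (p : (Fin (k + 1) → Fin n) × (Fin (k + 1) → Fin n))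
    (j : Fin (k + 1) ⊕ Fin (k + 1)) : bipartiteWord p j < 2 * n := by
  rcases j with j | j
  · have := (p.1 j).2
    have := (p.2 j).2
    simp only [bipartiteWord, Sum.elim_inl]
    lia
  · have := (p.1 (j + 1)).2
    have := (p.2 j).2
    simp only [bipartiteWord, Sum.elim_inr]
    lia

/-- Around an odd cycle the letters determine the walk. -/
theorem walkWord_injective (k n : ℕ) :
    Function.Injective (walkWord : (Fin (2 * k + 1) → Fin n) → Fin (2 * k + 1) → ℕ) := by
  intro i i' h
  have hstep : ∀ j, ((i (j + 1) : ℕ) : ℤ) - i' (j + 1) = -(((i j : ℕ) : ℤ) - i' j) := by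
    intro j
    have := congrFun h j
    simp only [walkWord] at this
    lia
  have hm : ∀ (m : ℕ) (j : Fin (2 * k + 1)), ((i (j + m • 1) : ℕ) : ℤ) - i' (j + m • 1) =
      (-1) ^ m * (((i j : ℕ) : ℤ) - i' j) := by
    intro m j
    induction m with
    | zero => simp
    | succ m ih =>
      rw [succ_nsmul, ← add_assoc, hstep, ih]
      ring
  funext j
  have h0 : ((2 * k + 1) • (1 : Fin (2 * k + 1))) = 0 := by
    have := card_nsmul_eq_zero (x := (1 : Fin (2 * k + 1)))
    rwa [Fintype.card_fin] at this
  -- One full turn around the odd cycle sends the difference of the two walks to its negative at the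
  -- same vertex, so it vanishes.
  have := hm (2 * k + 1) j
  rw [h0, add_zero, Odd.neg_one_pow ⟨k, rfl⟩] at this
  exact Fin.ext (by lia)

/-- On an even cycle the letters leave one degree of freedom: once `a₀` is known, the vertices are
recovered alternately from the successive letters. -/
theorem bipartiteWord_determines {k n : ℕ}
    {p q : (Fin (k + 1) → Fin n) × (Fin (k + 1) → Fin n)}
    (h0 : (p.1 0 : ℕ) = q.1 0) (h : bipartiteWord p = bipartiteWord q) : p = q := by
  have e1 : ∀ l, (p.1 l : ℕ) = q.1 l → (p.2 l : ℕ) = q.2 l := by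
    intro l hl
    have := congrFun h (Sum.inl l)
    simp only [bipartiteWord, Sum.elim_inl] at this
    lia
  have e2 : ∀ l, (p.2 l : ℕ) = q.2 l → (p.1 (l + 1) : ℕ) = q.1 (l + 1) := by
    intro l hl
    have := congrFun h (Sum.inr l)
    simp only [bipartiteWord, Sum.elim_inr] at this
    lia
  have e3 : ∀ l, (p.1 l : ℕ) = q.1 l := by
    intro l
    induction l using Fin.induction with
    | zero => exact h0
    | succ l ih =>
      rw [← Fin.coeSucc_eq_succ]
      exact e2 _ (e1 _ ih)
  exact Prod.ext (funext fun l => Fin.ext (e3 l)) (funext fun l => Fin.ext (e1 l (e3 l)))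

/-- Every vertex lies on one letter of each class, so all contributions cancel. This identity
selects the pairings that match the two classes, and it also gains the extra factor in the variance.
-/
theorem bipartiteWord_relation {k n : ℕ} (p : (Fin (k + 1) → Fin n) × (Fin (k + 1) → Fin n)) :
    ∑ j, Sum.elim (fun _ => (1 : ℤ)) (fun _ => -1) j * (bipartiteWord p j : ℤ) = 0 := by
  rw [Fintype.sum_sum_type]
  simp only [Sum.elim_inl, Sum.elim_inr, bipartiteWord, one_mul, neg_one_mul]
  push_cast
  simp only [Finset.sum_neg_distrib, Finset.sum_add_distrib]
  have := Equiv.sum_comp (Equiv.addRight (1 : Fin (k + 1))) (fun l => ((p.1 l : ℕ) : ℤ))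
  simp only [Equiv.coe_addRight] at this
  rw [this]
  ring

/-! ### Expected traces and matchings -/

/-- The number of closed walks of length `2 (k + 1)` whose letters match according to `σ`. -/
noncomputable def matchCount {k : ℕ} (σ : Equiv.Perm (Fin (k + 1))) (n : ℕ) : ℕ :=
  Nat.card {p : (Fin (k + 1) → Fin n) × (Fin (k + 1) → Fin n) //
    ∀ l, bipartiteWord p (Sum.inl l) = bipartiteWord p (Sum.inr (σ l))}

theorem card_inl_eq_card_inr_of_balanced {k : ℕ} {s : Fin (k + 1) ⊕ Fin (k + 1) → ℕ}
    {v : ℕ} (hw : ∑ j with s j = v, Sum.elim (fun _ => (1 : ℤ)) (fun _ => -1) j = 0) :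
    Finset.card {l | s (Sum.inl l) = v} = Finset.card {l | s (Sum.inr l) = v} := by
  rw [Finset.sum_filter, Fintype.sum_sum_type] at hw
  simp only [Sum.elim_inl, Sum.elim_inr] at hw
  rw [← Finset.sum_filter, ← Finset.sum_filter, Finset.sum_const, Finset.sum_const] at hw
  simp only [nsmul_eq_mul, mul_one, mul_neg] at hw
  lia

/-- A word in which every letter occurs exactly twice, once on each side, has exactly one
matching. -/
theorem sum_perm_matching_eq_one {k : ℕ} {s : Fin (k + 1) ⊕ Fin (k + 1) → ℕ}
    (h1 : ∀ l, Finset.card {m | s (Sum.inl m) = s (Sum.inl l)} = 1)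
    (h2 : ∀ l, Finset.card {m | s (Sum.inr m) = s (Sum.inl l)} = 1) :
    ∑ σ : Equiv.Perm (Fin (k + 1)),
      (if ∀ l, s (Sum.inl l) = s (Sum.inr (σ l)) then (1 : ℝ) else 0) = 1 := by
  simp_rw [Finset.card_eq_one] at h1 h2
  choose f hf using h2
  have hf' : ∀ l m, s (Sum.inr m) = s (Sum.inl l) ↔ m = f l := by
    intro l m
    have := congrArg (fun t => m ∈ t) (hf l)
    simpa using this
  have hinj : Function.Injective f := by
    intro l l' hll
    have e1 := (hf' l (f l)).2 rfl
    have e2 := (hf' l' (f l)).2 hll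
    obtain ⟨c, hc⟩ := h1 l
    have m1 : l ∈ ({c} : Finset (Fin (k + 1))) := by rw [← hc]; simp
    have m2 : l' ∈ ({c} : Finset (Fin (k + 1))) := by
      rw [← hc]; simp [← e1, ← e2]
    rw [Finset.mem_singleton] at m1 m2
    rw [m1, m2]
  let σ₀ : Equiv.Perm (Fin (k + 1)) := Equiv.ofBijective f (Finite.injective_iff_bijective.1 hinj)
  rw [Finset.sum_eq_single σ₀, if_pos]
  · intro l
    exact ((hf' l (σ₀ l)).2 rfl).symm
  · intro σ _ hσ
    rw [if_neg]
    intro h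
    exact hσ (Equiv.ext fun l => (hf' l (σ l)).1 (h l).symm)
  · simp

/-- Up to lower order terms, the expected trace of an even power counts matched walks. -/
theorem exists_abs_sum_wordMoment_sub_matchCount_le (M : ℕ → ℝ) (hM1 : M 1 = 0) (hM2 : M 2 = 1)
    (k : ℕ) : ∃ C : ℝ, 0 ≤ C ∧ ∀ n : ℕ, 0 < n →
      |∑ p : (Fin (k + 1) → Fin n) × (Fin (k + 1) → Fin n), wordMoment M (bipartiteWord p) -
        ∑ σ : Equiv.Perm (Fin (k + 1)), (matchCount σ n : ℝ)| ≤ C * (n : ℝ) ^ (k + 1) := by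
  classical
  obtain ⟨C₁, hC₁, hb⟩ := exists_abs_wordMoment_le (Fin (k + 1) ⊕ Fin (k + 1)) M
  set ι := Fin (k + 1) ⊕ Fin (k + 1)
  set F : ℝ := (Fintype.card (Equiv.Perm (Fin (k + 1))) : ℝ)
  set D : ℕ := Fintype.card ι ^ Fintype.card ι + Fintype.card ι ^ Fintype.card ι * Fintype.card ι
  refine ⟨(C₁ + F) * (2 ^ (k + 1) * D), by positivity, fun n hn => ?_⟩
  set w : ι → ℤ := Sum.elim (fun _ => (1 : ℤ)) (fun _ => -1)
  let α := (Fin (k + 1) → Fin n) × (Fin (k + 1) → Fin n)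
  -- The two kinds of negligible walks: those with at most `k` distinct letters, and those with at
  -- most `k + 1` whose relation is nontrivial on some class of equal letters. Each kind has order
  -- at most `n ^ (k + 1)`, counting the parameter `a₀`.
  set B₁ : Finset α := {p | (Finset.univ.image (bipartiteWord p)).card ≤ k}
  set B₂ : Finset α := {p | (Finset.univ.image (bipartiteWord p)).card ≤ k + 1 ∧
    ∃ j₀, ∑ j with bipartiteWord p j = bipartiteWord p j₀, w j ≠ 0}
  have hB₁ : B₁.card ≤ (2 * n) ^ (k + 1) * Fintype.card ι ^ Fintype.card ι := by
    have := Finset.card_le_of_card_image_le B₁ (fun p (_ : Unit) => (p.1 0 : ℕ)) bipartiteWord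
      (2 * n) k (by lia) (fun p _ _ => by have := (p.1 0).2; lia)
      (fun p _ => bipartiteWord_lt p) (fun p _ q _ h => bipartiteWord_determines (congrFun h ()))
      (fun p hp => (Finset.mem_filter.1 hp).2)
    rwa [Fintype.card_unit, add_comm 1 k] at this
  have hB₂ : B₂.card ≤ (2 * n) ^ (k + 1) * (Fintype.card ι ^ Fintype.card ι * Fintype.card ι) := by
    have := Finset.card_le_of_card_image_le_of_relation B₂ (fun p (_ : Unit) => (p.1 0 : ℕ))
      bipartiteWord (2 * n) k (by lia) (fun p _ _ => by have := (p.1 0).2; lia)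
      (fun p _ => bipartiteWord_lt p) (fun p _ q _ h => bipartiteWord_determines (congrFun h ()))
      (fun p hp => (Finset.mem_filter.1 hp).2.1) w (fun p _ => bipartiteWord_relation p)
      (fun p hp => (Finset.mem_filter.1 hp).2.2)
    rwa [Fintype.card_unit, add_comm 1 k] at this
  let J : α → ℝ := fun p => ∑ σ : Equiv.Perm (Fin (k + 1)),
    (if ∀ l, bipartiteWord p (Sum.inl l) = bipartiteWord p (Sum.inr (σ l)) then (1 : ℝ) else 0)
  have hJ : ∑ σ : Equiv.Perm (Fin (k + 1)), (matchCount σ n : ℝ) = ∑ p, J p := by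
    simp only [J]
    rw [Finset.sum_comm]
    refine Finset.sum_congr rfl fun σ _ => ?_
    rw [matchCount, Nat.card_eq_fintype_card, Fintype.card_subtype, Finset.sum_ite]
    simp only [Finset.sum_const, nsmul_eq_mul, mul_one, mul_zero, add_zero]
    congr
  have hJ0 : ∀ p, 0 ≤ J p ∧ J p ≤ F := by
    intro p
    constructor
    · exact Finset.sum_nonneg fun σ _ => by split_ifs <;> norm_num
    · refine (Finset.sum_le_sum (g := fun _ => (1 : ℝ)) fun σ _ => ?_).trans ?_
      · split_ifs <;> norm_num
      · simp [F]
  have hgood : ∀ p, p ∉ B₁ ∪ B₂ → wordMoment M (bipartiteWord p) = J p := by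
    intro p hp
    simp only [B₁, B₂, Finset.mem_union, Finset.mem_filter, Finset.mem_univ, true_and, not_or,
      not_and, not_exists, not_not] at hp
    obtain ⟨hp1, hp2⟩ := hp
    -- Off the negligible walks, either some letter is isolated, so that the mean is zero and no
    -- matching exists, or every letter occurs exactly twice, once in each class, so that the mean
    -- is one and the matching is unique.
    by_cases hone : ∃ j, Finset.card {i | bipartiteWord p i = bipartiteWord p j} = 1
    · obtain ⟨j, hj⟩ := hone
      rw [wordMoment_eq_zero hM1 j hj]
      symm
      refine Finset.sum_eq_zero fun σ _ => ?_
      rw [if_neg]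
      intro hσ
      rw [Finset.card_eq_one] at hj
      obtain ⟨c, hc⟩ := hj
      have hmem : ∀ i, bipartiteWord p i = bipartiteWord p j → i = c := by
        intro i hi
        have : i ∈ ({c} : Finset ι) := by rw [← hc]; simpa using hi
        simpa using this
      rcases j with l | l
      · have e1 := hmem _ rfl
        have e2 := hmem _ (hσ l).symm
        rw [← e1] at e2
        exact absurd e2 (by simp)
      · have e1 := hmem _ rfl
        have e2 := hmem (Sum.inl (σ.symm l)) (by rw [hσ]; simp)
        rw [← e1] at e2
        exact absurd e2 (by simp)
    · push Not at hone
      have htwo : ∀ j, 2 ≤ Finset.card {i | bipartiteWord p i = bipartiteWord p j} := by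
        intro j
        have := one_le_card_fiber (bipartiteWord p) j
        have := hone j
        lia
      have hle := two_mul_card_image_le htwo
      have hcard : Fintype.card (Fin (k + 1) ⊕ Fin (k + 1)) = 2 * (k + 1) := by
        rw [Fintype.card_sum, Fintype.card_fin]; ring
      rw [hcard] at hle
      have heq := card_fiber_eq_two htwo (by rw [hcard]; lia)
      rw [wordMoment_eq_one hM2 heq]
      symm
      have hbal : ∀ l, Finset.card {m | bipartiteWord p (Sum.inl m) = bipartiteWord p (Sum.inl l)} =
          1 ∧ Finset.card {m | bipartiteWord p (Sum.inr m) = bipartiteWord p (Sum.inl l)} = 1 := by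
        intro l
        have e1 := card_inl_eq_card_inr_of_balanced (hp2 (by lia) (Sum.inl l))
        have e2 := heq (Sum.inl l)
        have e3 : Finset.card {i | bipartiteWord p i = bipartiteWord p (Sum.inl l)} =
            Finset.card {m | bipartiteWord p (Sum.inl m) = bipartiteWord p (Sum.inl l)} +
            Finset.card {m | bipartiteWord p (Sum.inr m) = bipartiteWord p (Sum.inl l)} := by
          rw [Finset.card_filter, Finset.card_filter, Finset.card_filter, Fintype.sum_sum_type]
        lia
      exact sum_perm_matching_eq_one (fun l => (hbal l).1) (fun l => (hbal l).2)
  rw [hJ, ← Finset.sum_sub_distrib]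
  have hsub : ∑ p : α, (wordMoment M (bipartiteWord p) - J p) =
      ∑ p ∈ B₁ ∪ B₂, (wordMoment M (bipartiteWord p) - J p) := by
    symm
    refine Finset.sum_subset (Finset.subset_univ _) fun p _ hp => ?_
    rw [hgood p hp, sub_self]
  rw [hsub]
  have hcardB : ((B₁ ∪ B₂).card : ℝ) ≤ 2 ^ (k + 1) * D * (n : ℝ) ^ (k + 1) := by
    have : (B₁ ∪ B₂).card ≤ (2 * n) ^ (k + 1) * D := by
      refine (Finset.card_union_le _ _).trans ((add_le_add hB₁ hB₂).trans ?_)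
      rw [← mul_add]
    calc ((B₁ ∪ B₂).card : ℝ) ≤ (((2 * n) ^ (k + 1) * D : ℕ) : ℝ) := by exact_mod_cast this
      _ = _ := by push_cast; ring
  calc _ ≤ ∑ p ∈ B₁ ∪ B₂, |wordMoment M (bipartiteWord p) - J p| := Finset.abs_sum_le_sum_abs _ _
    _ ≤ ∑ p ∈ B₁ ∪ B₂, (C₁ + F) := by
        refine Finset.sum_le_sum fun p _ => (abs_sub _ _).trans (add_le_add (hb _) ?_)
        rw [abs_of_nonneg (hJ0 p).1]
        exact (hJ0 p).2
    _ = (C₁ + F) * ((B₁ ∪ B₂).card : ℝ) := by rw [Finset.sum_const, nsmul_eq_mul, mul_comm]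
    _ ≤ (C₁ + F) * (2 ^ (k + 1) * D * (n : ℝ) ^ (k + 1)) := by
        gcongr
    _ = _ := by ring

/-- The expected trace of an odd power is of lower order. -/
theorem exists_abs_sum_wordMoment_walkWord_le (M : ℕ → ℝ) (hM1 : M 1 = 0) (k : ℕ) :
    ∃ C : ℝ, 0 ≤ C ∧ ∀ n : ℕ, 0 < n →
      |∑ i : Fin (2 * k + 1) → Fin n, wordMoment M (walkWord i)| ≤ C * (n : ℝ) ^ k := by
  classical
  obtain ⟨C₁, hC₁, hb⟩ := exists_abs_wordMoment_le (Fin (2 * k + 1)) M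
  set D : ℕ := (2 * k + 1) ^ (2 * k + 1)
  refine ⟨C₁ * (2 ^ k * D), by positivity, fun n hn => ?_⟩
  set B : Finset (Fin (2 * k + 1) → Fin n) := {i | (Finset.univ.image (walkWord i)).card ≤ k}
  have hB : B.card ≤ (2 * n) ^ k * D := by
    have := Finset.card_le_of_card_image_le (τ := Empty) B (fun _ j => j.elim) walkWord
      (2 * n) k (by lia) (fun _ _ j => j.elim) (fun i _ => walkWord_lt i)
      (fun i _ i' _ _ h => walkWord_injective k n h)
      (fun p hp => (Finset.mem_filter.1 hp).2)
    simpa using this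
  have hsub : ∑ i : Fin (2 * k + 1) → Fin n, wordMoment M (walkWord i) =
      ∑ i ∈ B, wordMoment M (walkWord i) := by
    symm
    refine Finset.sum_subset (Finset.subset_univ _) fun i _ hi => ?_
    by_contra hne
    apply hi
    rw [Finset.mem_filter]
    refine ⟨Finset.mem_univ _, ?_⟩
    -- Without isolated letters, `2k + 1` positions carry at most `k` distinct letters, and on an
    -- odd cycle these determine the walk.
    have h2 : ∀ j, 2 ≤ Finset.card {m | walkWord i m = walkWord i j} := by
      intro j
      have h1 := one_le_card_fiber (walkWord i) j
      have h3 : Finset.card {m | walkWord i m = walkWord i j} ≠ 1 := fun h =>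
        hne (wordMoment_eq_zero hM1 j h)
      lia
    have := two_mul_card_image_le h2
    rw [Fintype.card_fin] at this
    lia
  rw [hsub]
  calc _ ≤ ∑ i ∈ B, |wordMoment M (walkWord i)| := Finset.abs_sum_le_sum_abs _ _
    _ ≤ ∑ i ∈ B, C₁ := Finset.sum_le_sum fun i _ => hb _
    _ = C₁ * (B.card : ℝ) := by rw [Finset.sum_const, nsmul_eq_mul, mul_comm]
    _ ≤ C₁ * (((2 * n) ^ k * D : ℕ) : ℝ) := by gcongr
    _ = _ := by push_cast; ring

/-! ### Matched walks as lattice points of a polytope -/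

/-- The vertex `a_l` of a walk matched by `σ`, in terms of the parameters `y none = a₀` and
`y (some l) = a_l + b_l`. -/
def matchedVertex {k : ℕ} (σ : Equiv.Perm (Fin (k + 1))) {R : Type*} [CommRing R]
    (y : Option (Fin (k + 1)) → R) (l : Fin (k + 1)) : R :=
  y none + ∑ m with m < l, (y (some (σ.symm m)) - y (some m))

theorem matchedVertex_zero {k : ℕ} (σ : Equiv.Perm (Fin (k + 1))) {R : Type*} [CommRing R]
    (y : Option (Fin (k + 1)) → R) : matchedVertex σ y 0 = y none := by
  simp [matchedVertex]

/-- The recursion also holds at the last index, where `m + 1 = 0`: the increments sum to zero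
because `σ` only permutes them, so the walk closes up without any further equation. -/
theorem matchedVertex_add_one {k : ℕ} (σ : Equiv.Perm (Fin (k + 1))) {R : Type*} [CommRing R]
    (y : Option (Fin (k + 1)) → R) (m : Fin (k + 1)) :
    matchedVertex σ y (m + 1) = matchedVertex σ y m + y (some (σ.symm m)) - y (some m) := by
  have htot : ∑ m, (y (some (σ.symm m)) - y (some m)) = 0 := by
    rw [Finset.sum_sub_distrib, Equiv.sum_comp σ.symm fun m => y (some m), sub_self]
  have hins : ∀ m : Fin (k + 1), ∑ j with j ≤ m, (y (some (σ.symm j)) - y (some j)) =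
      (y (some (σ.symm m)) - y (some m)) +
        ∑ j with j < m, (y (some (σ.symm j)) - y (some j)) := by
    intro m
    have : (Finset.univ.filter fun j => j ≤ m) =
        insert m (Finset.univ.filter fun j => j < m) := by
      ext j
      simp [le_iff_lt_or_eq, or_comm]
    rw [this, Finset.sum_insert (by simp)]
  simp only [matchedVertex]
  induction m using Fin.lastCases with
  | last =>
    rw [Fin.last_add_one]
    have := hins (Fin.last k)
    simp only [Fin.le_last, Finset.filter_true, htot] at this
    simp only [Fin.not_lt_zero, Finset.filter_false, Finset.sum_empty]
    linear_combination this
  | cast m =>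
    rw [Fin.coeSucc_eq_succ]
    have : (Finset.univ.filter fun j => j < m.succ) =
        Finset.univ.filter fun j => j ≤ m.castSucc := by
      ext j
      simp [Fin.lt_def, Fin.le_def]
    rw [this, hins]
    ring

/-- The polytope of rescaled walks matched by `σ`. -/
def matchPolytope {k : ℕ} (σ : Equiv.Perm (Fin (k + 1))) : Set (Option (Fin (k + 1)) → ℝ) :=
  {y | ∀ l, matchedVertex σ y l ∈ Set.Ico (0 : ℝ) 1 ∧
    y (some l) - matchedVertex σ y l ∈ Set.Ico (0 : ℝ) 1}

theorem matchPolytope_subset {k : ℕ} (σ : Equiv.Perm (Fin (k + 1))) :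
    matchPolytope σ ⊆ Set.Icc 0 2 := by
  intro y hy
  have h : ∀ o, 0 ≤ y o ∧ y o ≤ 2 := by
    rintro (_ | l)
    · have := (hy 0).1
      rw [matchedVertex_zero] at this
      exact ⟨this.1, by linarith [this.2]⟩
    · have h1 := (hy l).1
      have h2 := (hy l).2
      exact ⟨by linarith [h1.1, h2.1], by linarith [h1.2, h2.2]⟩
  exact ⟨fun o => (h o).1, fun o => (h o).2⟩

theorem measurable_matchedVertex {k : ℕ} (σ : Equiv.Perm (Fin (k + 1))) (l : Fin (k + 1)) :
    Measurable fun y : Option (Fin (k + 1)) → ℝ => matchedVertex σ y l := by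
  unfold matchedVertex
  fun_prop

theorem measurableSet_matchPolytope {k : ℕ} (σ : Equiv.Perm (Fin (k + 1))) :
    MeasurableSet (matchPolytope σ) := by
  have : matchPolytope σ = ⋂ l, ((fun y => matchedVertex σ y l) ⁻¹' Set.Ico (0 : ℝ) 1 ∩
      (fun y : Option (Fin (k + 1)) → ℝ => y (some l) - matchedVertex σ y l) ⁻¹'
        Set.Ico (0 : ℝ) 1) := by
    ext y
    simp [matchPolytope]
  rw [this]
  refine MeasurableSet.iInter fun l => ?_
  have h := measurable_matchedVertex σ l
  exact (h measurableSet_Ico).inter (((measurable_pi_apply _).sub h) measurableSet_Ico)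

theorem convex_matchPolytope {k : ℕ} (σ : Equiv.Perm (Fin (k + 1))) :
    Convex ℝ (matchPolytope σ) := by
  intro x hx y hy a b ha hb hab l
  have hlin : matchedVertex σ (a • x + b • y) l =
      a • matchedVertex σ x l + b • matchedVertex σ y l := by
    simp only [matchedVertex, Pi.add_apply, Pi.smul_apply, smul_eq_mul, mul_add, Finset.mul_sum]
    rw [add_add_add_comm, ← Finset.sum_add_distrib]
    congr 1
    exact Finset.sum_congr rfl fun m _ => by ring
  refine ⟨?_, ?_⟩
  · rw [hlin]
    exact convex_Ico (0 : ℝ) 1 (hx l).1 (hy l).1 ha hb hab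
  · have := convex_Ico (0 : ℝ) 1 (hx l).2 (hy l).2 ha hb hab
    rw [hlin]
    convert this using 1
    simp only [Pi.add_apply, Pi.smul_apply, smul_eq_mul]
    ring

/-- The parameters of a walk, divided by `n`. -/
noncomputable def walkParam {k n : ℕ} (p : (Fin (k + 1) → Fin n) × (Fin (k + 1) → Fin n)) :
    Option (Fin (k + 1)) → ℝ
  | none => (p.1 0 : ℕ) / n
  | some l => ((p.1 l : ℕ) + (p.2 l : ℕ)) / n

theorem matchedVertex_walkParam {k n : ℕ} (σ : Equiv.Perm (Fin (k + 1)))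
    {p : (Fin (k + 1) → Fin n) × (Fin (k + 1) → Fin n)}
    (hp : ∀ l, bipartiteWord p (Sum.inl l) = bipartiteWord p (Sum.inr (σ l))) (l : Fin (k + 1)) :
    matchedVertex σ (walkParam p) l = (p.1 l : ℕ) / n := by
  induction l using Fin.induction with
  | zero => rw [matchedVertex_zero]; rfl
  | succ l ih =>
    rw [← Fin.coeSucc_eq_succ, matchedVertex_add_one, ih]
    have := hp (σ.symm l.castSucc)
    simp only [bipartiteWord, Sum.elim_inl, Sum.elim_inr, Equiv.apply_symm_apply] at this
    have h : (((p.1 (σ.symm l.castSucc) : ℕ) : ℝ) + (p.2 (σ.symm l.castSucc) : ℕ)) =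
        (p.2 l.castSucc : ℕ) + (p.1 (l.castSucc + 1) : ℕ) := by
      exact_mod_cast Nat.succ_injective this
    simp only [walkParam]
    rw [h]
    ring

-- The matching equations are solved by the free integers `a₀` and `a_l + b_l`. What remains is that
-- every `a_l` and `b_l` lies in `[0, n)`, which after division by `n` is membership in the
-- polytope. Half-open intervals make the correspondence exact.
open Pointwise in
theorem matchCount_eq_card_lattice {k : ℕ} (σ : Equiv.Perm (Fin (k + 1))) (n : ℕ) [NeZero n] :
    matchCount σ n = Nat.card ↑(matchPolytope σ ∩ ((n : ℝ)⁻¹ •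
      (Submodule.span ℤ (Set.range (Pi.basisFun ℝ (Option (Fin (k + 1))))) :
        Submodule ℤ (Option (Fin (k + 1)) → ℝ)) : Set (Option (Fin (k + 1)) → ℝ))) := by
  have hn : (0 : ℝ) < n := by exact_mod_cast Nat.pos_of_neZero n
  have hmem : ∀ p : {p : (Fin (k + 1) → Fin n) × (Fin (k + 1) → Fin n) //
      ∀ l, bipartiteWord p (Sum.inl l) = bipartiteWord p (Sum.inr (σ l))},
      walkParam p.1 ∈ matchPolytope σ ∩ ((n : ℝ)⁻¹ •
      (Submodule.span ℤ (Set.range (Pi.basisFun ℝ (Option (Fin (k + 1))))) :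
        Submodule ℤ (Option (Fin (k + 1)) → ℝ)) : Set (Option (Fin (k + 1)) → ℝ)) := by
    rintro ⟨p, hp⟩
    refine ⟨fun l => ?_, ?_⟩
    · rw [matchedVertex_walkParam σ hp]
      have e : walkParam p (some l) - (p.1 l : ℕ) / n = (p.2 l : ℕ) / n := by
        simp only [walkParam]; ring
      rw [e]
      have h1 : ((p.1 l : ℕ) : ℝ) < n := by exact_mod_cast (p.1 l).2
      have h2 : ((p.2 l : ℕ) : ℝ) < n := by exact_mod_cast (p.2 l).2
      exact ⟨⟨by positivity, (div_lt_one hn).2 h1⟩, ⟨by positivity, (div_lt_one hn).2 h2⟩⟩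
    · have : walkParam p ∈ ((n : ℝ)⁻¹ • (Submodule.span ℤ
          (Set.range (Pi.basisFun ℝ (Option (Fin (k + 1))))) :
          Submodule ℤ (Option (Fin (k + 1)) → ℝ))) := by
        rw [BoxIntegral.unitPartition.mem_smul_span_iff]
        rintro (_ | l)
        · refine ⟨((p.1 0 : ℕ) : ℤ), ?_⟩
          simp only [walkParam, algebraMap_int_eq, eq_intCast, Int.cast_natCast]
          field_simp
        · refine ⟨(((p.1 l : ℕ) + (p.2 l : ℕ) : ℕ) : ℤ), ?_⟩
          simp only [walkParam, algebraMap_int_eq, eq_intCast, Int.cast_natCast]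
          push_cast
          field_simp
      exact this
  refine Nat.card_congr (Equiv.ofBijective (fun p => ⟨walkParam p.1, hmem p⟩) ⟨?_, ?_⟩)
  · rintro ⟨p, hp⟩ ⟨q, hq⟩ hpq
    have hy : walkParam p = walkParam q := congrArg Subtype.val hpq
    have h0 : (p.1 0 : ℕ) = q.1 0 := by
      have := congrFun hy none
      simp only [walkParam] at this
      rw [div_left_inj' hn.ne'] at this
      exact_mod_cast this
    have h1 : ∀ l, bipartiteWord p (Sum.inl l) = bipartiteWord q (Sum.inl l) := by
      intro l
      have := congrFun hy (some l)
      simp only [walkParam] at this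
      rw [div_left_inj' hn.ne'] at this
      simp only [bipartiteWord, Sum.elim_inl]
      exact congrArg (· + 1) (by exact_mod_cast this)
    refine Subtype.ext (bipartiteWord_determines h0 (funext ?_))
    rintro (l | l)
    · exact h1 l
    · have e1 := hp (σ.symm l)
      have e2 := hq (σ.symm l)
      rw [Equiv.apply_symm_apply] at e1 e2
      rw [← e1, ← e2, h1]
  · rintro ⟨y, hyP, hyL⟩
    have hyL' : y ∈ ((n : ℝ)⁻¹ • (Submodule.span ℤ
          (Set.range (Pi.basisFun ℝ (Option (Fin (k + 1))))) :
          Submodule ℤ (Option (Fin (k + 1)) → ℝ))) := hyL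
    rw [BoxIntegral.unitPartition.mem_smul_span_iff] at hyL'
    choose z hz using hyL'
    simp only [algebraMap_int_eq, eq_intCast] at hz
    have hA : ∀ l, ((matchedVertex σ z l : ℤ) : ℝ) = n * matchedVertex σ y l := by
      intro l
      simp only [matchedVertex]
      push_cast
      rw [mul_add, Finset.mul_sum]
      simp only [mul_sub, hz]
    have hA0 : ∀ l, 0 ≤ matchedVertex σ z l ∧ matchedVertex σ z l < n := by
      intro l
      have h1 := (hyP l).1
      constructor
      · have : (0 : ℝ) ≤ (matchedVertex σ z l : ℤ) := by
          rw [hA]; exact mul_nonneg hn.le h1.1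
        exact_mod_cast this
      · have : ((matchedVertex σ z l : ℤ) : ℝ) < n := by
          rw [hA]; nlinarith [h1.2]
        exact_mod_cast this
    have hB0 : ∀ l, 0 ≤ z (some l) - matchedVertex σ z l ∧
        z (some l) - matchedVertex σ z l < n := by
      intro l
      have h1 := (hyP l).2
      have e : ((z (some l) - matchedVertex σ z l : ℤ) : ℝ) =
          n * (y (some l) - matchedVertex σ y l) := by
        push_cast; rw [hA, hz]; ring
      constructor
      · have : (0 : ℝ) ≤ (z (some l) - matchedVertex σ z l : ℤ) := by
          rw [e]; exact mul_nonneg hn.le h1.1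
        exact_mod_cast this
      · have : ((z (some l) - matchedVertex σ z l : ℤ) : ℝ) < n := by
          rw [e]; nlinarith [h1.2]
        exact_mod_cast this
    let p : (Fin (k + 1) → Fin n) × (Fin (k + 1) → Fin n) :=
      (fun l => ⟨(matchedVertex σ z l).toNat, by have := hA0 l; lia⟩,
        fun l => ⟨(z (some l) - matchedVertex σ z l).toNat, by have := hB0 l; lia⟩)
    have hp1 : ∀ l, ((p.1 l : ℕ) : ℤ) = matchedVertex σ z l := fun l =>
      Int.toNat_of_nonneg (hA0 l).1
    have hp2 : ∀ l, ((p.2 l : ℕ) : ℤ) = z (some l) - matchedVertex σ z l := fun l =>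
      Int.toNat_of_nonneg (hB0 l).1
    refine ⟨⟨p, fun l => ?_⟩, ?_⟩
    · simp only [bipartiteWord, Sum.elim_inl, Sum.elim_inr]
      zify
      rw [hp1, hp2, hp2, hp1, matchedVertex_add_one, Equiv.symm_apply_apply]
      ring
    · refine Subtype.ext (funext ?_)
      rintro (_ | l)
      · simp only [walkParam]
        have : ((p.1 0 : ℕ) : ℝ) = n * y none := by
          have h := congrArg (fun x : ℤ => (x : ℝ)) (hp1 0)
          simp only [Int.cast_natCast] at h
          rw [h, hA, matchedVertex_zero]
        rw [this]
        field_simp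
      · simp only [walkParam]
        have : ((p.1 l : ℕ) : ℝ) + (p.2 l : ℕ) = n * y (some l) := by
          have h : ((p.1 l : ℕ) : ℤ) + (p.2 l : ℕ) = z (some l) := by
            rw [hp1, hp2]; ring
          rw [← hz]
          exact_mod_cast h
        rw [this]
        field_simp

/-- A bounded convex set has null frontier, so its rescaled lattice point count converges to its
volume. The exponent is the number of free parameters. -/
theorem tendsto_matchCount_div {k : ℕ} (σ : Equiv.Perm (Fin (k + 1))) :
    Tendsto (fun n : ℕ => (matchCount σ n : ℝ) / (n : ℝ) ^ (k + 2)) atTop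
      (𝓝 (volume.real (matchPolytope σ))) := by
  have h := tendsto_card_div_pow_atTop_volume (matchPolytope σ)
    ((Metric.isBounded_Icc _ _).subset (matchPolytope_subset σ)) (measurableSet_matchPolytope σ)
    ((convex_matchPolytope σ).addHaar_frontier volume)
  refine h.congr' ?_
  filter_upwards [eventually_gt_atTop 0] with n hn
  have : NeZero n := ⟨hn.ne'⟩
  rw [matchCount_eq_card_lattice, Fintype.card_option, Fintype.card_fin]

theorem volume_matchPolytope_le {k : ℕ} (σ : Equiv.Perm (Fin (k + 1))) :
    volume.real (matchPolytope σ) ≤ 2 ^ (k + 2) := by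
  have h1 : volume (Set.Icc (0 : Option (Fin (k + 1)) → ℝ) 2) = ENNReal.ofReal (2 ^ (k + 2)) := by
    rw [Real.volume_Icc_pi]
    simp [ENNReal.ofReal_pow]
  have h2 := measure_mono (μ := volume) (matchPolytope_subset σ)
  rw [h1] at h2
  exact ENNReal.toReal_le_of_le_ofReal (by positivity) h2

/-! ### Limiting moments and almost sure convergence along squares -/

/-- The moments of the limiting spectral distribution of Hankel matrices. -/
noncomputable def hankelMoment (K : ℕ) : ℝ :=
  if Even K then
    match K / 2 with
    | 0 => 1
    | k + 1 => ∑ σ : Equiv.Perm (Fin (k + 1)), volume.real (matchPolytope σ)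
  else 0

theorem hankelMoment_zero : hankelMoment 0 = 1 := by
  simp [hankelMoment]

theorem hankelMoment_even (k : ℕ) : hankelMoment (2 * (k + 1)) =
    ∑ σ : Equiv.Perm (Fin (k + 1)), volume.real (matchPolytope σ) := by
  simp [hankelMoment]

theorem hankelMoment_odd (k : ℕ) : hankelMoment (2 * k + 1) = 0 := by
  rw [hankelMoment, if_neg]
  simp

/-- One bounded volume for each of the `k!` permutations. Factorial growth at half the order is what
makes the moment problem determinate. -/
theorem hankelMoment_even_nonneg_le (k : ℕ) :
    0 ≤ hankelMoment (2 * k) ∧ hankelMoment (2 * k) ≤ k.factorial * 2 ^ (k + 1) := by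
  cases k with
  | zero => simp [hankelMoment_zero]
  | succ k =>
    rw [hankelMoment_even]
    refine ⟨Finset.sum_nonneg fun σ _ => measureReal_nonneg, ?_⟩
    refine (Finset.sum_le_sum fun σ _ => volume_matchPolytope_le σ).trans ?_
    rw [Finset.sum_const, Finset.card_univ, Fintype.card_perm, Fintype.card_fin, nsmul_eq_mul]

/-- The sum of the squares has finite expectation, hence is almost surely finite, and its terms tend
to zero. -/
theorem ae_tendsto_zero_of_summable_integral_sq {Ω : Type*} [MeasurableSpace Ω] {P : Measure Ω}
    (f : ℕ → Ω → ℝ) (hf : ∀ m, Integrable (fun ω => f m ω ^ 2) P)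
    (hs : Summable fun m => ∫ ω, f m ω ^ 2 ∂P) :
    ∀ᵐ ω ∂P, Tendsto (fun m => f m ω) atTop (𝓝 0) := by
  have hmeas : ∀ m, AEMeasurable (fun ω => ENNReal.ofReal (f m ω ^ 2)) P := fun m =>
    (hf m).aestronglyMeasurable.aemeasurable.ennreal_ofReal
  have hfin : ∫⁻ ω, ∑' m, ENNReal.ofReal (f m ω ^ 2) ∂P ≠ ∞ := by
    rw [lintegral_tsum hmeas]
    have h : ∀ m, ∫⁻ ω, ENNReal.ofReal (f m ω ^ 2) ∂P = ENNReal.ofReal (∫ ω, f m ω ^ 2 ∂P) :=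
      fun m => (ofReal_integral_eq_lintegral_ofReal (hf m) (ae_of_all _ fun ω => sq_nonneg _)).symm
    simp_rw [h]
    exact hs.tsum_ofReal_ne_top
  filter_upwards [ae_lt_top' (AEMeasurable.tsum hmeas) hfin] with ω hω
  have h1 := ENNReal.tendsto_atTop_zero_of_tsum_ne_top hω.ne
  have h2 := (ENNReal.tendsto_toReal ENNReal.zero_ne_top).comp h1
  have h3 : Tendsto (fun m => f m ω ^ 2) atTop (𝓝 0) := by
    refine h2.congr fun m => ?_
    simp [ENNReal.toReal_ofReal (sq_nonneg _)]
  have h4 := h3.sqrt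
  simp only [Real.sqrt_sq_eq_abs, Real.sqrt_zero] at h4
  exact (tendsto_zero_iff_abs_tendsto_zero _).2 h4

theorem tendsto_inv_mul_sqrt_pow_odd {e : ℕ → ℝ} {C : ℝ} {k : ℕ}
    (he : ∀ n : ℕ, 0 < n → |e n| ≤ C * (n : ℝ) ^ k) :
    Tendsto (fun n : ℕ => (n : ℝ)⁻¹ * ((√n)⁻¹ ^ (2 * k + 1) * e n)) atTop (𝓝 0) := by
  have hlim : Tendsto (fun n : ℕ => C * (n : ℝ)⁻¹) atTop (𝓝 0) := by
    simpa using tendsto_inv_atTop_nhds_zero_nat (𝕜 := ℝ) |>.const_mul C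
  refine squeeze_zero_norm' ?_ hlim
  filter_upwards [eventually_gt_atTop 0] with n hn
  have hn' : (1 : ℝ) ≤ n := by exact_mod_cast hn
  have hs : 1 ≤ √(n : ℝ) := Real.one_le_sqrt.2 hn'
  have h1 : (√(n : ℝ))⁻¹ ^ (2 * k + 1) ≤ ((n : ℝ) ^ k)⁻¹ := by
    rw [pow_succ, pow_mul, inv_pow, Real.sq_sqrt (by positivity), inv_pow]
    exact mul_le_of_le_one_right (by positivity) (inv_le_one_of_one_le₀ hs)
  rw [Real.norm_eq_abs, abs_mul, abs_mul, abs_of_nonneg (by positivity : (0 : ℝ) ≤ (n : ℝ)⁻¹),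
    abs_of_nonneg (by positivity : (0 : ℝ) ≤ (√(n : ℝ))⁻¹ ^ (2 * k + 1))]
  calc _ ≤ (n : ℝ)⁻¹ * (((n : ℝ) ^ k)⁻¹ * (C * (n : ℝ) ^ k)) := by
        gcongr
        exact he n hn
    _ = _ := by field_simp

/-- The normalization is exactly division by `n ^ (k + 2)`, the order of the matched walks; the
error is one power smaller. -/
theorem tendsto_inv_mul_sqrt_pow_even {e : ℕ → ℝ} {C : ℝ} {k : ℕ}
    (he : ∀ n : ℕ, 0 < n →
      |e n - ∑ σ : Equiv.Perm (Fin (k + 1)), (matchCount σ n : ℝ)| ≤ C * (n : ℝ) ^ (k + 1)) :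
    Tendsto (fun n : ℕ => (n : ℝ)⁻¹ * ((√n)⁻¹ ^ (2 * (k + 1)) * e n)) atTop
      (𝓝 (hankelMoment (2 * (k + 1)))) := by
  rw [hankelMoment_even]
  have h1 : Tendsto (fun n : ℕ => ∑ σ : Equiv.Perm (Fin (k + 1)),
      (matchCount σ n : ℝ) / (n : ℝ) ^ (k + 2)) atTop
      (𝓝 (∑ σ : Equiv.Perm (Fin (k + 1)), volume.real (matchPolytope σ))) :=
    tendsto_finsetSum _ fun σ _ => tendsto_matchCount_div σ
  have hlim : Tendsto (fun n : ℕ => C * (n : ℝ)⁻¹) atTop (𝓝 0) := by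
    simpa using tendsto_inv_atTop_nhds_zero_nat (𝕜 := ℝ) |>.const_mul C
  have h2 : Tendsto (fun n : ℕ => (n : ℝ)⁻¹ * ((√n)⁻¹ ^ (2 * (k + 1)) * e n) -
      ∑ σ : Equiv.Perm (Fin (k + 1)), (matchCount σ n : ℝ) / (n : ℝ) ^ (k + 2)) atTop (𝓝 0) := by
    refine squeeze_zero_norm' ?_ hlim
    filter_upwards [eventually_gt_atTop 0] with n hn
    have hn' : (0 : ℝ) < n := by exact_mod_cast hn
    have e1 : (n : ℝ)⁻¹ * ((√n)⁻¹ ^ (2 * (k + 1)) * e n) -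
        ∑ σ : Equiv.Perm (Fin (k + 1)), (matchCount σ n : ℝ) / (n : ℝ) ^ (k + 2) =
        ((n : ℝ) ^ (k + 2))⁻¹ *
          (e n - ∑ σ : Equiv.Perm (Fin (k + 1)), (matchCount σ n : ℝ)) := by
      rw [pow_mul, inv_pow, Real.sq_sqrt (by positivity), ← Finset.sum_div, pow_succ _ (k + 1),
        inv_pow]
      field_simp
    rw [e1, Real.norm_eq_abs, abs_mul, abs_of_nonneg (by positivity)]
    calc _ ≤ ((n : ℝ) ^ (k + 2))⁻¹ * (C * (n : ℝ) ^ (k + 1)) := by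
          gcongr
          exact he n hn
      _ = _ := by
          rw [pow_succ _ (k + 1)]
          field_simp
  simpa using h2.add h1

/-- First and second order asymptotics of the traces of powers of a random Hankel matrix. -/
theorem exists_trace_hankelMatrix_asymptotics {Ω : Type*} [MeasurableSpace Ω] {P : Measure Ω}
    [IsProbabilityMeasure P] {X : ℕ → Ω → ℝ} (hm : ∀ k, Measurable (X k)) (hind : iIndepFun X P)
    (hid : ∀ k, IdentDistrib (X k) (X 1) P P) (hX : ∀ k (p : ℕ), MemLp (X k) p P)
    (h0 : ∫ ω, X 1 ω ∂P = 0) (h1 : ∫ ω, X 1 ω ^ 2 ∂P = 1) (K : ℕ) :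
    ∃ (e : ℕ → ℝ) (C : ℝ), 0 ≤ C ∧
      (∀ n, Integrable (fun ω => (hankelMatrix (fun j => X j ω) n ^ K).trace) P ∧
        ∫ ω, (hankelMatrix (fun j => X j ω) n ^ K).trace ∂P = e n) ∧
      Tendsto (fun n : ℕ => (n : ℝ)⁻¹ * ((√n)⁻¹ ^ K * e n)) atTop (𝓝 (hankelMoment K)) ∧
      ∀ n, 0 < n →
        Integrable (fun ω => ((hankelMatrix (fun j => X j ω) n ^ K).trace - e n) ^ 2) P ∧
        ∫ ω, ((hankelMatrix (fun j => X j ω) n ^ K).trace - e n) ^ 2 ∂P ≤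
          C * (n : ℝ) ^ (K + 1) := by
  set M : ℕ → ℝ := fun r => ∫ ω, X 1 ω ^ r ∂P
  have hM1 : M 1 = 0 := by simpa [M] using h0
  rcases Nat.even_or_odd' K with ⟨k, rfl | rfl⟩
  · cases k with
    | zero =>
      refine ⟨fun n => n, 0, le_rfl, fun n => by simp, ?_, fun n hn => by simp⟩
      rw [mul_zero, hankelMoment_zero]
      refine tendsto_const_nhds.congr' ?_
      filter_upwards [eventually_gt_atTop 0] with n hn
      have : (n : ℝ) ≠ 0 := by exact_mod_cast hn.ne'
      field_simp
    | succ k =>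
      obtain ⟨C, hC, hvar⟩ := integral_sq_sub_sum_wordMoment_le hm hind hid hX h0
        (Fin (k + 1) ⊕ Fin (k + 1))
      obtain ⟨C', hC', he⟩ := exists_abs_sum_wordMoment_sub_matchCount_le M hM1 h1 k
      set D : ℕ := 2 * (Fintype.card ((Fin (k + 1) ⊕ Fin (k + 1)) ⊕ (Fin (k + 1) ⊕ Fin (k + 1))) ^
        Fintype.card ((Fin (k + 1) ⊕ Fin (k + 1)) ⊕ (Fin (k + 1) ⊕ Fin (k + 1))) *
        Fintype.card ((Fin (k + 1) ⊕ Fin (k + 1)) ⊕ (Fin (k + 1) ⊕ Fin (k + 1))))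
      refine ⟨fun n => ∑ p : (Fin (k + 1) → Fin n) × (Fin (k + 1) → Fin n),
        wordMoment M (bipartiteWord p), C * (2 ^ (2 * (k + 1) + 1) * D), by positivity,
        fun n => ?_, tendsto_inv_mul_sqrt_pow_even he, fun n hn => ?_⟩
      · simp_rw [trace_hankelMatrix_pow_even]
        refine ⟨integrable_finsetSum _ fun p _ => integrable_prod_comp hX _, ?_⟩
        rw [integral_finsetSum _ fun p _ => integrable_prod_comp hX _]
        exact Finset.sum_congr rfl fun p _ => integral_prod_comp_eq_wordMoment hm hind hid _
      · simp_rw [trace_hankelMatrix_pow_even]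
        obtain ⟨i1, i2⟩ := hvar ((Fin (k + 1) → Fin n) × (Fin (k + 1) → Fin n)) bipartiteWord
        refine ⟨i1, i2.trans ?_⟩
        have hcard := card_linkedWords_le_of_relation
          (bipartiteWord : (Fin (k + 1) → Fin n) × (Fin (k + 1) → Fin n) → _)
          (fun p => (p.1 0 : ℕ)) (2 * n) (by lia) bipartiteWord_lt
          (fun p => by have := (p.1 0).2; lia) (fun p q => bipartiteWord_determines)
          (Sum.elim (fun _ => 1) (fun _ => -1)) (by rintro (j | j) <;> simp)
          bipartiteWord_relation (2 * k + 1) (by simp; ring)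
        rw [mul_assoc]
        refine mul_le_mul_of_nonneg_left ?_ hC
        calc _ ≤ (((2 * n) ^ (2 * k + 1 + 2) * D : ℕ) : ℝ) := by exact_mod_cast hcard
          _ = _ := by push_cast; ring
  · obtain ⟨C, hC, hvar⟩ := integral_sq_sub_sum_wordMoment_le hm hind hid hX h0 (Fin (2 * k + 1))
    obtain ⟨C', hC', he⟩ := exists_abs_sum_wordMoment_walkWord_le M hM1 k
    set D : ℕ := Fintype.card (Fin (2 * k + 1) ⊕ Fin (2 * k + 1)) ^
      Fintype.card (Fin (2 * k + 1) ⊕ Fin (2 * k + 1))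
    refine ⟨fun n => ∑ i : Fin (2 * k + 1) → Fin n, wordMoment M (walkWord i),
      C * (2 ^ (2 * k + 1) * D), by positivity, fun n => ?_, ?_, fun n hn => ?_⟩
    · simp_rw [trace_hankelMatrix_pow_succ]
      refine ⟨integrable_finsetSum _ fun p _ => integrable_prod_comp hX _, ?_⟩
      rw [integral_finsetSum _ fun p _ => integrable_prod_comp hX _]
      exact Finset.sum_congr rfl fun p _ => integral_prod_comp_eq_wordMoment hm hind hid _
    · rw [hankelMoment_odd]
      exact tendsto_inv_mul_sqrt_pow_odd he
    · simp_rw [trace_hankelMatrix_pow_succ]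
      obtain ⟨i1, i2⟩ := hvar (Fin (2 * k + 1) → Fin n) walkWord
      refine ⟨i1, i2.trans ?_⟩
      have hcard := card_linkedWords_le_of_injective
        (walkWord : (Fin (2 * k + 1) → Fin n) → Fin (2 * k + 1) → ℕ)
        (2 * n) (by lia) walkWord_lt (walkWord_injective k n)
      rw [Fintype.card_fin (2 * k + 1)] at hcard
      rw [mul_assoc]
      refine mul_le_mul_of_nonneg_left ?_ hC
      have hn1 : (1 : ℝ) ≤ n := by exact_mod_cast hn
      calc _ ≤ (((2 * n) ^ (2 * k + 1) * D : ℕ) : ℝ) := by exact_mod_cast hcard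
        _ = 2 ^ (2 * k + 1) * D * (n : ℝ) ^ (2 * k + 1) := by push_cast; ring
        _ ≤ _ := by
          gcongr
          lia

theorem tendsto_integral_moment_hankelSpectralMeasure {Ω : Type*} [MeasurableSpace Ω]
    {P : Measure Ω} [IsProbabilityMeasure P] {X : ℕ → Ω → ℝ} (hm : ∀ k, Measurable (X k))
    (hind : iIndepFun X P) (hid : ∀ k, IdentDistrib (X k) (X 1) P P)
    (hX : ∀ k (p : ℕ), MemLp (X k) p P)
    (h0 : ∫ ω, X 1 ω ∂P = 0) (h1 : ∫ ω, X 1 ω ^ 2 ∂P = 1) (K : ℕ) :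
    (∀ n, Integrable (fun ω => (hankelMatrix (fun j => X j ω) n ^ K).trace) P) ∧
    Tendsto (fun n : ℕ => ∫ ω, (n : ℝ)⁻¹ * ((√n)⁻¹ ^ K *
      (hankelMatrix (fun j => X j ω) n ^ K).trace) ∂P) atTop (𝓝 (hankelMoment K)) := by
  obtain ⟨e, C, -, he, hlim, -⟩ := exists_trace_hankelMatrix_asymptotics hm hind hid hX h0 h1 K
  refine ⟨fun n => (he n).1, ?_⟩
  simp_rw [integral_const_mul, fun n => (he n).2]
  exact hlim

/-- Almost sure convergence of the moments along the squares. -/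
theorem ae_tendsto_moment_hankelSpectralMeasure_sq {Ω : Type*} [MeasurableSpace Ω]
    {P : Measure Ω} [IsProbabilityMeasure P] {X : ℕ → Ω → ℝ} (hm : ∀ k, Measurable (X k))
    (hind : iIndepFun X P) (hid : ∀ k, IdentDistrib (X k) (X 1) P P)
    (hX : ∀ k (p : ℕ), MemLp (X k) p P)
    (h0 : ∫ ω, X 1 ω ∂P = 0) (h1 : ∫ ω, X 1 ω ^ 2 ∂P = 1) :
    ∀ᵐ ω ∂P, ∀ K : ℕ, Tendsto (fun m : ℕ =>
      ∫ y, y ^ K ∂(hankelSpectralMeasure (fun j => X j ω) ((m + 1) ^ 2) : Measure ℝ)) atTop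
      (𝓝 (hankelMoment K)) := by
  rw [ae_all_iff]
  intro K
  obtain ⟨e, C, hC, he, hlim, hvar⟩ :=
    exists_trace_hankelMatrix_asymptotics hm hind hid hX h0 h1 K
  let c : ℕ → ℝ := fun n => (n : ℝ)⁻¹ * (√n)⁻¹ ^ K
  let f : ℕ → Ω → ℝ := fun m ω => c ((m + 1) ^ 2) *
    ((hankelMatrix (fun j => X j ω) ((m + 1) ^ 2) ^ K).trace - e ((m + 1) ^ 2))
  have hpos : ∀ m : ℕ, 0 < (m + 1) ^ 2 := fun m => by positivity
  -- The normalized variance is of order `1 / n`, so summability holds along the squares but not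
  -- along all sizes.
  have hc2 : ∀ n : ℕ, 0 < n → c n ^ 2 * (n : ℝ) ^ (K + 1) = (n : ℝ)⁻¹ := by
    intro n hn
    have hn' : (0 : ℝ) < n := by exact_mod_cast hn
    simp only [c]
    rw [mul_pow, ← pow_mul, mul_comm K 2, pow_mul, inv_pow (√(n : ℝ)) 2,
      Real.sq_sqrt hn'.le, inv_pow, inv_pow]
    field_simp
    ring
  have hsum : Summable fun m => ∫ ω, f m ω ^ 2 ∂P := by
    have hs : Summable fun m : ℕ => C * (((m + 1 : ℕ) : ℝ) ^ 2)⁻¹ := by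
      refine Summable.mul_left C ?_
      have := Real.summable_nat_pow_inv (p := 2) |>.2 (by norm_num)
      exact (summable_nat_add_iff 1).2 this
    refine Summable.of_nonneg_of_le (fun m => integral_nonneg fun ω => sq_nonneg _) (fun m => ?_) hs
    simp only [f, mul_pow]
    rw [integral_const_mul]
    calc _ ≤ c ((m + 1) ^ 2) ^ 2 * (C * (((m + 1) ^ 2 : ℕ) : ℝ) ^ (K + 1)) := by
          gcongr
          exact (hvar _ (hpos m)).2
      _ = C * (c ((m + 1) ^ 2) ^ 2 * (((m + 1) ^ 2 : ℕ) : ℝ) ^ (K + 1)) := by ring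
      _ = _ := by rw [hc2 _ (hpos m)]; push_cast; ring
  have hInt : ∀ m, Integrable (fun ω => f m ω ^ 2) P := by
    intro m
    simp only [f, mul_pow]
    exact (hvar _ (hpos m)).1.const_mul _
  filter_upwards [ae_tendsto_zero_of_summable_integral_sq f hInt hsum] with ω hω
  have hsub : Tendsto (fun m : ℕ => (m + 1) ^ 2) atTop atTop :=
    (tendsto_pow_atTop (α := ℕ) two_ne_zero).comp (tendsto_add_atTop_nat 1)
  have h2 := hω.add (hlim.comp hsub)
  rw [zero_add] at h2
  refine h2.congr fun m => ?_
  rw [integral_pow_hankelSpectralMeasure]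
  simp only [f, c, Function.comp]
  ring

/-! ### The method of moments -/

/-- The derivative of the remainder is `i` times the previous remainder, so the bound integrates
from one order to the next, starting from `|exp(ix)| = 1`. -/
theorem norm_exp_mul_I_sub_taylor_le_of_nonneg (n : ℕ) (x : ℝ) (hx : 0 ≤ x) :
    ‖Complex.exp (x * Complex.I) - ∑ m ∈ Finset.range n, (x * Complex.I) ^ m / m.factorial‖ ≤
      x ^ n / n.factorial := by
  induction n generalizing x with
  | zero => simp [Complex.norm_exp_ofReal_mul_I]
  | succ n ih =>
    let f : ℝ → ℂ := fun y => Complex.exp (y * Complex.I) -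
      ∑ m ∈ Finset.range (n + 1), (y * Complex.I) ^ m / m.factorial
    let f' : ℝ → ℂ := fun y => Complex.I * (Complex.exp (y * Complex.I) -
      ∑ m ∈ Finset.range n, (y * Complex.I) ^ m / m.factorial)
    have hlin : ∀ y : ℝ, HasDerivAt (fun y : ℝ => (y : ℂ) * Complex.I) Complex.I y := by
      intro y
      simpa using (hasDerivAt_id y).ofReal_comp.mul_const Complex.I
    have hf : ∀ y, HasDerivAt f (f' y) y := by
      intro y
      have h1 := (hlin y).cexp
      have h2 : HasDerivAt (fun y : ℝ => ∑ m ∈ Finset.range (n + 1),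
          ((y : ℂ) * Complex.I) ^ m / m.factorial)
          (∑ m ∈ Finset.range (n + 1), (m * ((y : ℂ) * Complex.I) ^ (m - 1) * Complex.I) /
            m.factorial) y :=
        HasDerivAt.fun_sum fun m _ => ((hlin y).fun_pow m).div_const _
      refine (h1.sub h2).congr_deriv ?_
      simp only [f']
      rw [Finset.sum_range_succ', mul_sub, Finset.mul_sum]
      simp only [Nat.cast_zero, zero_mul, zero_div, add_zero, Nat.add_sub_cancel]
      congr 1
      · ring
      · refine Finset.sum_congr rfl fun m _ => ?_
        rw [Nat.factorial_succ]
        have : (m.factorial : ℂ) ≠ 0 := by exact_mod_cast m.factorial_ne_zero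
        have : ((m : ℂ) + 1) ≠ 0 := by exact_mod_cast m.succ_ne_zero
        push_cast
        field_simp
    have hB : ∀ y : ℝ, HasDerivAt (fun y : ℝ => y ^ (n + 1) / ((n + 1).factorial : ℝ))
        (y ^ n / n.factorial) y := by
      intro y
      refine ((hasDerivAt_pow (n + 1) y).div_const _).congr_deriv ?_
      rw [Nat.factorial_succ]
      have : (n.factorial : ℝ) ≠ 0 := by exact_mod_cast n.factorial_ne_zero
      push_cast
      field_simp
    refine image_norm_le_of_norm_deriv_right_le_deriv_boundary (f := f) (f' := f') (a := 0) (b := x)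
      (fun y _ => (hf y).continuousAt.continuousWithinAt)
      (fun y _ => (hf y).hasDerivWithinAt) ?_ hB ?_ ⟨hx, le_rfl⟩
    · simp [f, Finset.sum_range_succ']
    · intro y hy
      simp only [f', norm_mul, Complex.norm_I, one_mul]
      exact ih y hy.1

/-- The Taylor remainder of the exponential on the imaginary axis. -/
theorem norm_exp_mul_I_sub_taylor_le (n : ℕ) (x : ℝ) :
    ‖Complex.exp (x * Complex.I) - ∑ m ∈ Finset.range n, (x * Complex.I) ^ m / m.factorial‖ ≤
      |x| ^ n / n.factorial := by
  rcases le_total 0 x with hx | hx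
  · rw [abs_of_nonneg hx]
    exact norm_exp_mul_I_sub_taylor_le_of_nonneg n x hx
  · have h := norm_exp_mul_I_sub_taylor_le_of_nonneg n (-x) (by linarith)
    rw [abs_of_nonpos hx, ← Complex.norm_conj]
    convert h using 2
    rw [map_sub, ← Complex.exp_conj, map_sum]
    simp

/-- Stopping the expansion at even order makes the remainder an honest moment, without absolute
values. -/
theorem norm_charFun_sub_sum_moment_le {μ : Measure ℝ} [IsProbabilityMeasure μ]
    (hμ : ∀ k : ℕ, Integrable (fun x : ℝ => x ^ k) μ) (N : ℕ) (t : ℝ) :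
    ‖charFun μ t - ∑ m ∈ Finset.range (2 * N), (t * Complex.I) ^ m / m.factorial *
      ((∫ x, x ^ m ∂μ : ℝ) : ℂ)‖ ≤ t ^ (2 * N) / (2 * N).factorial * ∫ x, x ^ (2 * N) ∂μ := by
  have hInt : ∀ m : ℕ, Integrable (fun x : ℝ => (t * Complex.I) ^ m / m.factorial *
      ((x ^ m : ℝ) : ℂ)) μ := fun m => (hμ m).ofReal.const_mul _
  have hexp : Integrable (fun x : ℝ => Complex.exp (t * x * Complex.I)) μ := by
    refine (integrable_const (1 : ℝ)).mono' (by fun_prop) (ae_of_all _ fun x => ?_)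
    have : ((t : ℂ) * x) = ((t * x : ℝ) : ℂ) := by push_cast; rfl
    rw [this, Complex.norm_exp_ofReal_mul_I]
  have hsum : ∑ m ∈ Finset.range (2 * N), (t * Complex.I) ^ m / m.factorial *
      ((∫ x, x ^ m ∂μ : ℝ) : ℂ) = ∫ x : ℝ, ∑ m ∈ Finset.range (2 * N),
        (t * Complex.I) ^ m / m.factorial * ((x ^ m : ℝ) : ℂ) ∂μ := by
    rw [integral_finsetSum _ fun m _ => hInt m]
    refine Finset.sum_congr rfl fun m _ => ?_
    rw [integral_const_mul, integral_complex_ofReal]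
  rw [charFun_apply_real, hsum, ← integral_sub hexp (integrable_finsetSum _ fun m _ => hInt m),
    ← integral_const_mul]
  refine norm_integral_le_of_norm_le ((hμ _).const_mul _) (ae_of_all _ fun x => ?_)
  have h := norm_exp_mul_I_sub_taylor_le (2 * N) (t * x)
  have e : |t * x| ^ (2 * N) / ((2 * N).factorial : ℝ) =
      t ^ (2 * N) / (2 * N).factorial * x ^ (2 * N) := by
    rw [(even_two_mul N).pow_abs, mul_pow]; ring
  rw [e] at h
  refine le_trans (le_of_eq (congrArg norm (congrArg₂ (· - ·) ?_ ?_))) h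
  · push_cast; rfl
  · refine Finset.sum_congr rfl fun m _ => ?_
    push_cast
    ring

theorem tendsto_pow_div_factorial_mul_hankelMoment (t : ℝ) :
    Tendsto (fun N : ℕ => t ^ (2 * N) / (2 * N).factorial * hankelMoment (2 * N)) atTop (𝓝 0) := by
  have h1 : Tendsto (fun N : ℕ => 2 * ((2 * t ^ 2) ^ N / (N.factorial : ℝ))) atTop (𝓝 0) := by
    have := (FloorSemiring.tendsto_pow_div_factorial_atTop (2 * t ^ 2)).const_mul 2
    rwa [mul_zero] at this
  refine squeeze_zero (fun N => ?_) (fun N => ?_) h1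
  · have := (hankelMoment_even_nonneg_le N).1
    rw [pow_mul]
    positivity
  -- One of the two factorials absorbs the growth of the moment and the other beats the geometric
  -- factor, for every `t`.
  · have hf : (N.factorial : ℝ) * N.factorial ≤ (2 * N).factorial := by
      have := Nat.le_of_dvd (Nat.factorial_pos _)
        (Nat.factorial_mul_factorial_dvd_factorial_add N N)
      rw [two_mul]
      exact_mod_cast this
    have hpos : (0 : ℝ) < N.factorial := by exact_mod_cast N.factorial_pos
    calc t ^ (2 * N) / (2 * N).factorial * hankelMoment (2 * N)
        ≤ t ^ (2 * N) / (N.factorial * N.factorial) * (N.factorial * 2 ^ (N + 1)) := by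
          rw [pow_mul]
          gcongr
          · exact (hankelMoment_even_nonneg_le N).1
          · exact (hankelMoment_even_nonneg_le N).2
      _ = _ := by
          rw [pow_mul, mul_pow]
          field_simp
          ring

/-- Measures whose moments converge to the Hankel moments converge to any measure having these
moments. -/
theorem tendsto_of_tendsto_hankelMoment {γ : ProbabilityMeasure ℝ}
    (hγ : ∀ k : ℕ, Integrable (fun x : ℝ => x ^ k) (γ : Measure ℝ))
    (hγm : ∀ k : ℕ, ∫ x, x ^ k ∂(γ : Measure ℝ) = hankelMoment k)
    {μ : ℕ → ProbabilityMeasure ℝ}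
    (hμ : ∀ n (k : ℕ), Integrable (fun x : ℝ => x ^ k) (μ n : Measure ℝ))
    (hμm : ∀ k : ℕ, Tendsto (fun n => ∫ x, x ^ k ∂(μ n : Measure ℝ)) atTop
      (𝓝 (hankelMoment k))) :
    Tendsto μ atTop (𝓝 γ) := by
  rw [ProbabilityMeasure.tendsto_iff_tendsto_charFun]
  intro t
  rw [Metric.tendsto_atTop]
  intro ε hε
  -- The order `N` is fixed first from the limit moments. Both remainders are then below `ε / 4` for
  -- large `n`, and only finitely many moments have to be close.
  obtain ⟨N, hN⟩ := ((tendsto_pow_div_factorial_mul_hankelMoment t).eventually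
    (gt_mem_nhds (show (0 : ℝ) < ε / 4 by positivity))).exists
  have e1 : Tendsto (fun n => t ^ (2 * N) / (2 * N).factorial *
      ∫ x, x ^ (2 * N) ∂(μ n : Measure ℝ)) atTop
      (𝓝 (t ^ (2 * N) / (2 * N).factorial * hankelMoment (2 * N))) :=
    (hμm (2 * N)).const_mul _
  have e2 : Tendsto (fun n => ∑ m ∈ Finset.range (2 * N), (t * Complex.I) ^ m / m.factorial *
      ((∫ x, x ^ m ∂(μ n : Measure ℝ) : ℝ) : ℂ)) atTop
      (𝓝 (∑ m ∈ Finset.range (2 * N), (t * Complex.I) ^ m / m.factorial *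
        ((hankelMoment m : ℝ) : ℂ))) := by
    refine tendsto_finsetSum _ fun m _ => Tendsto.const_mul _ ?_
    exact (Complex.continuous_ofReal.tendsto _).comp (hμm m)
  have e3 := (e1.eventually (gt_mem_nhds hN)).and
    (Metric.tendsto_nhds.1 e2 (ε / 4) (by positivity))
  obtain ⟨n₀, hn₀⟩ := eventually_atTop.1 e3
  refine ⟨n₀, fun n hn => ?_⟩
  obtain ⟨h1, h2⟩ := hn₀ n hn
  have h3 := norm_charFun_sub_sum_moment_le (hμ n) N t
  have h4 := norm_charFun_sub_sum_moment_le hγ N t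
  simp_rw [hγm] at h4
  rw [dist_eq_norm] at h2 ⊢
  set S := ∑ m ∈ Finset.range (2 * N), (t * Complex.I) ^ m / m.factorial *
      ((∫ x, x ^ m ∂(μ n : Measure ℝ) : ℝ) : ℂ)
  set S' := ∑ m ∈ Finset.range (2 * N), (t * Complex.I) ^ m / m.factorial *
        ((hankelMoment m : ℝ) : ℂ)
  calc _ = ‖(charFun (μ n : Measure ℝ) t - S) + (S - S') - (charFun (γ : Measure ℝ) t - S')‖ := by
        congr 1; ring
    _ ≤ ‖charFun (μ n : Measure ℝ) t - S‖ + ‖S - S'‖ + ‖charFun (γ : Measure ℝ) t - S'‖ :=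
        (norm_sub_le _ _).trans (by gcongr; exact norm_add_le _ _)
    _ < ε := by linarith

/-- The clamp acts only where `|x ^ K| ≥ R`, and there `|x ^ K|` is at most `(x ^ K) ^ 2 / R`. This
gives uniform integrability from moments of twice the order. -/
theorem abs_pow_sub_clamp_le (K : ℕ) {R : ℝ} (hR : 0 < R) (x : ℝ) :
    |x ^ K - max (-R) (min R (x ^ K))| ≤ x ^ (2 * K) / R := by
  rw [mul_comm 2 K, pow_mul]
  set y := x ^ K
  rw [le_div_iff₀ hR]
  rcases le_total y R with h1 | h1
  · rw [min_eq_right h1]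
    rcases le_total (-R) y with h2 | h2
    · rw [max_eq_right h2, sub_self, abs_zero, zero_mul]; positivity
    · rw [max_eq_left h2, abs_of_nonpos (by linarith)]
      nlinarith
  · rw [min_eq_left h1, max_eq_right (by linarith), abs_of_nonneg (by linarith)]
    nlinarith

open BoundedContinuousFunction in
/-- Weak convergence with bounded even moments implies convergence of the moments. -/
theorem tendsto_integral_pow_of_tendsto {ι : Type*} {l : Filter ι} [l.NeBot]
    {γ : ProbabilityMeasure ℝ} {μ : ι → ProbabilityMeasure ℝ} (h : Tendsto μ l (𝓝 γ))
    (K : ℕ) (C : ℝ)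
    (hμ : ∀ i (k : ℕ), Integrable (fun x : ℝ => x ^ k) (μ i : Measure ℝ))
    (hC : ∀ᶠ i in l, ∫ x, x ^ (2 * K) ∂(μ i : Measure ℝ) ≤ C) :
    Integrable (fun x : ℝ => x ^ K) (γ : Measure ℝ) ∧
    Tendsto (fun i => ∫ x, x ^ K ∂(μ i : Measure ℝ)) l (𝓝 (∫ x, x ^ K ∂(γ : Measure ℝ))) := by
  rw [ProbabilityMeasure.tendsto_iff_forall_integral_tendsto] at h
  have hC0 : 0 ≤ C := by
    obtain ⟨i, hi⟩ := hC.exists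
    exact (integral_nonneg fun x => by rw [pow_mul]; positivity).trans hi
  have hnn : ∀ x : ℝ, 0 ≤ x ^ (2 * K) := fun x => by rw [pow_mul]; positivity
  let F : ℕ → ℝ →ᵇ ℝ := fun R => ofNormedAddCommGroup (fun x => min (R : ℝ) (x ^ (2 * K)))
    (by fun_prop) R (fun x => by
      rw [Real.norm_eq_abs, abs_of_nonneg (le_min (by positivity) (hnn x))]
      exact min_le_left _ _)
  have hF : ∀ R : ℕ, ∫ x, min (R : ℝ) (x ^ (2 * K)) ∂(γ : Measure ℝ) ≤ C := by
    intro R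
    refine le_of_tendsto (h (F R)) ?_
    filter_upwards [hC] with i hi
    refine le_trans (integral_mono ((F R).integrable _) (hμ i _) fun x => min_le_right _ _) hi
  -- Fatou's lemma along truncations, each of which is a bounded continuous test function.
  have hlint : ∫⁻ x, ENNReal.ofReal (x ^ (2 * K)) ∂(γ : Measure ℝ) ≤ ENNReal.ofReal C := by
    have hlim : ∀ x : ℝ, liminf (fun R : ℕ => ENNReal.ofReal (min (R : ℝ) (x ^ (2 * K)))) atTop =
        ENNReal.ofReal (x ^ (2 * K)) := by
      intro x
      refine Tendsto.liminf_eq (tendsto_const_nhds.congr' ?_)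
      filter_upwards [eventually_ge_atTop ⌈x ^ (2 * K)⌉₊] with R hR
      rw [min_eq_right (Nat.ceil_le.1 hR)]
    simp_rw [← hlim]
    refine (lintegral_liminf_le fun R => by fun_prop).trans ?_
    refine (liminf_le_liminf (v := fun _ => ENNReal.ofReal C)
      (Eventually.of_forall fun R => ?_)).trans
      (by simp)
    rw [← ofReal_integral_eq_lintegral_ofReal (f := fun x : ℝ => min (R : ℝ) (x ^ (2 * K)))
      ((F R).integrable _) (ae_of_all _ fun x => le_min (by positivity) (hnn x))]
    exact ENNReal.ofReal_le_ofReal (hF R)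
  have hInt2 : Integrable (fun x : ℝ => x ^ (2 * K)) (γ : Measure ℝ) := by
    refine ⟨by fun_prop, ?_⟩
    rw [hasFiniteIntegral_iff_ofReal (ae_of_all _ hnn)]
    exact hlint.trans_lt ENNReal.ofReal_lt_top
  have hCγ : ∫ x, x ^ (2 * K) ∂(γ : Measure ℝ) ≤ C := by
    rw [integral_eq_lintegral_of_nonneg_ae (ae_of_all _ hnn) (by fun_prop)]
    exact ENNReal.toReal_le_of_le_ofReal hC0 hlint
  have hInt : Integrable (fun x : ℝ => x ^ K) (γ : Measure ℝ) := by
    refine ((integrable_const (1 : ℝ)).add hInt2).mono' (by fun_prop) (ae_of_all _ fun x => ?_)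
    rw [Real.norm_eq_abs, Pi.add_apply, mul_comm 2 K, pow_mul, ← sq_abs (x ^ K)]
    nlinarith [sq_nonneg (|x ^ K| - 1)]
  refine ⟨hInt, ?_⟩
  rw [Metric.tendsto_nhds]
  intro ε hε
  obtain ⟨R, hR0, hR⟩ : ∃ R : ℝ, 0 < R ∧ C / R < ε / 3 := by
    refine ⟨3 * (C + 1) / ε, by positivity, ?_⟩
    rw [div_lt_iff₀ (by positivity)]
    field_simp
    linarith
  let G : ℝ →ᵇ ℝ := ofNormedAddCommGroup (fun x => max (-R) (min R (x ^ K)))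
    (by fun_prop) R (fun x => by
      rw [Real.norm_eq_abs, abs_le]
      exact ⟨le_max_left _ _, max_le (by linarith) (min_le_left _ _)⟩)
  have hdiff : ∀ ν : ProbabilityMeasure ℝ, Integrable (fun x : ℝ => x ^ K) (ν : Measure ℝ) →
      Integrable (fun x : ℝ => x ^ (2 * K)) (ν : Measure ℝ) →
      ∫ x, x ^ (2 * K) ∂(ν : Measure ℝ) ≤ C →
      |∫ x, x ^ K ∂(ν : Measure ℝ) - ∫ x, G x ∂(ν : Measure ℝ)| < ε / 3 := by
    intro ν h1 h2 h3
    rw [← integral_sub h1 (G.integrable _)]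
    refine lt_of_le_of_lt (abs_integral_le_integral_abs.trans ?_) hR
    calc _ ≤ ∫ x, x ^ (2 * K) / R ∂(ν : Measure ℝ) := by
          refine integral_mono (h1.sub (G.integrable _)).abs (h2.div_const R) fun x => ?_
          exact abs_pow_sub_clamp_le K hR0 x
      _ ≤ C / R := by
          rw [integral_div]
          gcongr
  filter_upwards [hC, Metric.tendsto_nhds.1 (h G) (ε / 3) (by positivity)] with i hi1 hi2
  have d1 := abs_lt.1 (hdiff (μ i) (hμ i _) (hμ i _) hi1)
  have d2 := abs_lt.1 (hdiff γ hInt hInt2 hCγ)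
  rw [Real.dist_eq] at hi2 ⊢
  have d3 := abs_lt.1 hi2
  rw [abs_lt]
  constructor <;> linarith [d1.1, d1.2, d2.1, d2.2, d3.1, d3.2]

/-- Compactness: a sequence whose moments converge to the Hankel moments yields a probability
measure with these moments. -/
theorem exists_probabilityMeasure_hankelMoment {μ : ℕ → ProbabilityMeasure ℝ}
    (hμ : ∀ n (k : ℕ), Integrable (fun x : ℝ => x ^ k) (μ n : Measure ℝ))
    (hμm : ∀ k : ℕ, Tendsto (fun n => ∫ x, x ^ k ∂(μ n : Measure ℝ)) atTop
      (𝓝 (hankelMoment k))) :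
    ∃ γ : ProbabilityMeasure ℝ, (∀ k : ℕ, Integrable (fun x : ℝ => x ^ k) (γ : Measure ℝ)) ∧
      ∀ k : ℕ, ∫ x, x ^ k ∂(γ : Measure ℝ) = hankelMoment k := by
  obtain ⟨C, hC⟩ := (hμm 2).bddAbove_range
  have hC' : ∀ n, ∫ x, x ^ 2 ∂(μ n : Measure ℝ) ≤ C := fun n => hC ⟨n, rfl⟩
  -- Chebyshev with the bounded second moments.
  have htight : IsTightMeasureSet {x : Measure ℝ | ∃ ν ∈ Set.range μ, (ν : Measure ℝ) = x} := by
    rw [isTightMeasureSet_iff_tendsto_measure_norm_gt]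
    have hlim : Tendsto (fun r : ℝ => ENNReal.ofReal (C / r ^ 2)) atTop (𝓝 0) := by
      rw [← ENNReal.ofReal_zero]
      refine ENNReal.tendsto_ofReal ?_
      exact Tendsto.div_atTop tendsto_const_nhds (tendsto_pow_atTop two_ne_zero)
    refine tendsto_of_tendsto_of_tendsto_of_le_of_le' tendsto_const_nhds hlim
      (Eventually.of_forall fun _ => zero_le) ?_
    filter_upwards [eventually_gt_atTop 0] with r hr
    simp only [iSup_le_iff]
    rintro _ ⟨_, ⟨n, rfl⟩, rfl⟩
    have hm := mul_meas_ge_le_integral_of_nonneg (μ := (μ n : Measure ℝ))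
      (f := fun x : ℝ => x ^ 2) (ae_of_all _ fun x => sq_nonneg x) (hμ n 2) (r ^ 2)
    rw [← ENNReal.ofReal_toReal (measure_ne_top (μ n : Measure ℝ) _)]
    refine ENNReal.ofReal_le_ofReal ?_
    rw [le_div_iff₀ (by positivity), mul_comm]
    refine le_trans (mul_le_mul_of_nonneg_left (ENNReal.toReal_mono (measure_ne_top _ _)
      (measure_mono ?_)) (by positivity)) (hm.trans (hC' n))
    intro x hx
    simp only [Set.mem_ofPred_eq, Real.norm_eq_abs] at hx ⊢
    rw [← sq_abs x]
    gcongr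
  have hcomp := isCompact_closure_of_isTightMeasureSet htight
  -- A limit along a free ultrafilter takes the place of a convergent subsequence.
  obtain ⟨γ, -, hγ⟩ := hcomp.ultrafilter_le_nhds' ((hyperfilter ℕ).map μ)
    (by
      rw [Ultrafilter.mem_map]
      exact Filter.univ_mem' fun n => subset_closure ⟨n, rfl⟩)
  have hγ' : Tendsto μ (hyperfilter ℕ : Filter ℕ) (𝓝 γ) := hγ
  have hmom : ∀ k : ℕ, Integrable (fun x : ℝ => x ^ k) (γ : Measure ℝ) ∧
      ∫ x, x ^ k ∂(γ : Measure ℝ) = hankelMoment k := by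
    intro k
    have hb := ((hμm (2 * k)).mono_left Nat.hyperfilter_le_atTop).eventually
      (gt_mem_nhds (lt_add_one _))
    obtain ⟨h1, h2⟩ := tendsto_integral_pow_of_tendsto hγ' k (hankelMoment (2 * k) + 1) hμ
      (hb.mono fun i hi => le_of_lt hi)
    exact ⟨h1, tendsto_nhds_unique h2 ((hμm k).mono_left Nat.hyperfilter_le_atTop)⟩
  exact ⟨γ, fun k => (hmom k).1, fun k => (hmom k).2⟩

/-! ### Stability of the characteristic function, and passage from squares to all sizes -/

/-- The normalized trace of `exp (i t H_n / √n)`. -/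
noncomputable def hankelCharFun (x : ℕ → ℝ) (n : ℕ) (t : ℝ) : ℂ :=
  (n : ℂ)⁻¹ * ∑ i,
    Complex.exp (t * (scaledHankelMatrix_isHermitian x n).eigenvalues i * Complex.I)

/-- Each row contains an entry of the sequence at most once, with indices below `2n`. The `n` rows
and the factor `1 / n` from the scaling cancel in the squared Frobenius norm. -/
theorem norm_hankelCharFun_sub_le (x y : ℕ → ℝ) {n : ℕ} (hn : 0 < n) (t : ℝ) :
    ‖hankelCharFun x n t - hankelCharFun y n t‖ ≤
      |t| * √((∑ k ∈ Finset.range (2 * n), (x k - y k) ^ 2) / n) := by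
  have hn' : (0 : ℝ) < n := by exact_mod_cast hn
  set S := ∑ k ∈ Finset.range (2 * n), (x k - y k) ^ 2
  have hS : 0 ≤ S := Finset.sum_nonneg fun _ _ => sq_nonneg _
  have hfro : ∑ i, ∑ j, (scaledHankelMatrix x n - scaledHankelMatrix y n) i j ^ 2 ≤ S := by
    have hrow : ∀ i : Fin n, ∑ j : Fin n, (x (i + j + 1) - y (i + j + 1)) ^ 2 ≤ S := by
      intro i
      have himg : ∑ j : Fin n, (x (i + j + 1) - y (i + j + 1)) ^ 2 =
          ∑ k ∈ Finset.univ.image (fun j : Fin n => (i : ℕ) + j + 1), (x k - y k) ^ 2 := by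
        rw [Finset.sum_image]
        intro j _ j' _ h
        exact Fin.ext (by simpa using h)
      rw [himg]
      refine Finset.sum_le_sum_of_subset_of_nonneg ?_ fun _ _ _ => sq_nonneg _
      intro k hk
      simp only [Finset.mem_image, Finset.mem_univ, true_and] at hk
      obtain ⟨j, rfl⟩ := hk
      rw [Finset.mem_range]
      have := i.2
      have := j.2
      lia
    have e : ∀ i j, (scaledHankelMatrix x n - scaledHankelMatrix y n) i j ^ 2 =
        (n : ℝ)⁻¹ * (x (i + j + 1) - y (i + j + 1)) ^ 2 := by
      intro i j
      simp only [scaledHankelMatrix, hankelMatrix, Matrix.sub_apply, Matrix.smul_apply,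
        Matrix.of_apply, smul_eq_mul]
      rw [← mul_sub, mul_pow, inv_pow, Real.sq_sqrt hn'.le]
    simp_rw [e, ← Finset.mul_sum]
    calc _ ≤ (n : ℝ)⁻¹ * ∑ i : Fin n, S := by
          gcongr with i
          exact hrow i
      _ = S := by
          rw [Finset.sum_const, Finset.card_univ, Fintype.card_fin, nsmul_eq_mul]
          field_simp
  have h := (scaledHankelMatrix_isHermitian x n).norm_sum_exp_sub_le_frobenius
    (scaledHankelMatrix_isHermitian y n) t
  rw [hankelCharFun, hankelCharFun, ← mul_sub, norm_mul, norm_inv, Complex.norm_natCast]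
  rw [Fintype.card_fin] at h
  calc _ ≤ (n : ℝ)⁻¹ * (|t| * (√n * √S)) := by
        gcongr
        exact h.trans (by gcongr)
    _ = _ := by
        rw [Real.sqrt_div hS]
        nth_rewrite 1 [← Real.mul_self_sqrt hn'.le]
        have : √(n : ℝ) ≠ 0 := (Real.sqrt_pos.2 hn').ne'
        field_simp

/-- A constant shift adds a multiple of the all-ones matrix. Its Frobenius norm after scaling has
order `√n`, too large for the previous bound, but it has rank one. -/
theorem norm_hankelCharFun_sub_shift_le (x : ℕ → ℝ) (c : ℝ) {n : ℕ} (hn : 0 < n) (t : ℝ) :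
    ‖hankelCharFun x n t - hankelCharFun (fun k => x k - c) n t‖ ≤ |t| * |c| / √n := by
  have hn' : (0 : ℝ) < n := by exact_mod_cast hn
  have h := (scaledHankelMatrix_isHermitian x n).norm_sum_exp_sub_le_rankOne
    (scaledHankelMatrix_isHermitian (fun k => x k - c) n) t ((√n)⁻¹ * c) (fun _ => 1) (by
      intro i j
      simp only [scaledHankelMatrix, hankelMatrix, Matrix.sub_apply, Matrix.smul_apply,
        Matrix.of_apply, smul_eq_mul]
      ring)
  rw [hankelCharFun, hankelCharFun, ← mul_sub, norm_mul, norm_inv, Complex.norm_natCast]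
  calc _ ≤ (n : ℝ)⁻¹ * (|t| * (|(√n)⁻¹ * c| * ∑ i : Fin n, (1 : ℝ) ^ 2)) := by
        gcongr
    _ = _ := by
        rw [abs_mul, abs_of_nonneg (by positivity : (0 : ℝ) ≤ (√(n : ℝ))⁻¹)]
        simp only [one_pow, Finset.sum_const, Finset.card_univ, Fintype.card_fin, nsmul_eq_mul,
          mul_one]
        field_simp

/-- The smaller Hankel matrix is the upper left block of the larger one. Padding it by zeros adds
`d` eigenvalues `0`, each contributing `1` to the trace of the exponential. -/
theorem norm_hankelCharFun_sub_padding_le {x : ℕ → ℝ} {M : ℝ} (hM : ∀ k, |x k| ≤ M) {n d : ℕ}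
    (hn : 0 < n) (t : ℝ) :
    ‖hankelCharFun x (n + d) t - ((n : ℂ) / (n + d : ℕ) * hankelCharFun x n t +
      (d : ℂ) / (n + d : ℕ))‖ ≤ |t| * (M * √(3 * (d / (n + d : ℕ)))) := by
  have hM0 : 0 ≤ M := (abs_nonneg _).trans (hM 0)
  have hn' : (0 : ℝ) < n := by exact_mod_cast hn
  set N : ℕ := n + d
  have hNd : (N : ℝ) = n + d := by simp [N]
  have hN : (0 : ℝ) < N := by rw [hNd]; positivity
  set B : Matrix (Fin N) (Fin N) ℝ := Matrix.reindex finSumFinEquiv finSumFinEquiv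
      (Matrix.fromBlocks (scaledHankelMatrix x n) 0 0 (0 : Matrix (Fin d) (Fin d) ℝ)) with hBdef
  have hB : B.IsHermitian := by
    rw [hBdef, Matrix.reindex_apply]
    refine Matrix.IsHermitian.submatrix ?_ _
    exact Matrix.IsHermitian.fromBlocks (scaledHankelMatrix_isHermitian x n) (by simp)
      (Matrix.isHermitian_zero)
  have hpad := (scaledHankelMatrix_isHermitian x n).sum_eigenvalues_zero_padding hB hBdef
    (fun y => Complex.exp (t * y * Complex.I))
  simp only [Complex.ofReal_zero, mul_zero, zero_mul, Complex.exp_zero, mul_one] at hpad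
  have hfro : ∑ i, ∑ j, (scaledHankelMatrix x N - B) i j ^ 2 ≤ M ^ 2 * (3 * d) := by
    have hsq : ∀ k, x k ^ 2 ≤ M ^ 2 := fun k => sq_le_sq' (abs_le.1 (hM k)).1 (abs_le.1 (hM k)).2
    have e11 : ∀ i j : Fin n, (scaledHankelMatrix x N - B) (finSumFinEquiv (Sum.inl i))
        (finSumFinEquiv (Sum.inl j)) ^ 2 ≤ M ^ 2 * ((√n)⁻¹ - (√N)⁻¹) ^ 2 := by
      intro i j
      have : (scaledHankelMatrix x N - B) (finSumFinEquiv (Sum.inl i))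
        (finSumFinEquiv (Sum.inl j)) = x (i + j + 1) * ((√N)⁻¹ - (√n)⁻¹) := by
        rw [Matrix.sub_apply, hBdef, Matrix.reindex_apply, Matrix.submatrix_apply,
          Equiv.symm_apply_apply, Equiv.symm_apply_apply, Matrix.fromBlocks_apply₁₁]
        simp only [scaledHankelMatrix, hankelMatrix, Matrix.smul_apply,
          Matrix.of_apply, smul_eq_mul, finSumFinEquiv_apply_left, Fin.val_castAdd]
        ring
      rw [this, mul_pow, ← neg_sub ((√(n : ℝ))⁻¹), neg_sq]
      exact mul_le_mul_of_nonneg_right (hsq _) (sq_nonneg _)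
    have eother : ∀ u v : Fin N, B u v = 0 → (scaledHankelMatrix x N - B) u v ^ 2 ≤
        M ^ 2 * (N : ℝ)⁻¹ := by
      intro u v huv
      rw [Matrix.sub_apply, huv, sub_zero]
      simp only [scaledHankelMatrix, hankelMatrix, Matrix.smul_apply, Matrix.of_apply, smul_eq_mul]
      rw [mul_pow, inv_pow, Real.sq_sqrt hN.le, mul_comm]
      exact mul_le_mul_of_nonneg_right (hsq _) (by positivity)
    have e12 : ∀ (i : Fin n) (j : Fin d), B (finSumFinEquiv (Sum.inl i))
        (finSumFinEquiv (Sum.inr j)) = 0 := by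
      intro i j
      rw [hBdef, Matrix.reindex_apply, Matrix.submatrix_apply,
          Equiv.symm_apply_apply, Equiv.symm_apply_apply, Matrix.fromBlocks_apply₁₂]
      rfl
    have e21 : ∀ (i : Fin d) (j : Fin n), B (finSumFinEquiv (Sum.inr i))
        (finSumFinEquiv (Sum.inl j)) = 0 := by
      intro i j
      rw [hBdef, Matrix.reindex_apply, Matrix.submatrix_apply,
          Equiv.symm_apply_apply, Equiv.symm_apply_apply, Matrix.fromBlocks_apply₂₁]
      rfl
    have e22 : ∀ (i j : Fin d), B (finSumFinEquiv (Sum.inr i))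
        (finSumFinEquiv (Sum.inr j)) = 0 := by
      intro i j
      rw [hBdef, Matrix.reindex_apply, Matrix.submatrix_apply,
          Equiv.symm_apply_apply, Equiv.symm_apply_apply, Matrix.fromBlocks_apply₂₂]
      rfl
    have hsplit : ∑ i, ∑ j, (scaledHankelMatrix x N - B) i j ^ 2 =
        ∑ i : Fin n ⊕ Fin d, ∑ j : Fin n ⊕ Fin d,
          (scaledHankelMatrix x N - B) (finSumFinEquiv i) (finSumFinEquiv j) ^ 2 := by
      rw [← Equiv.sum_comp finSumFinEquiv]
      refine Finset.sum_congr rfl fun i _ => ?_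
      rw [← Equiv.sum_comp finSumFinEquiv]
    rw [hsplit]
    simp only [Fintype.sum_sum_type]
    calc _ ≤ (∑ i : Fin n, (∑ j : Fin n, M ^ 2 * ((√n)⁻¹ - (√N)⁻¹) ^ 2 +
          ∑ j : Fin d, M ^ 2 * (N : ℝ)⁻¹)) +
          ∑ i : Fin d, (∑ j : Fin n, M ^ 2 * (N : ℝ)⁻¹ + ∑ j : Fin d, M ^ 2 * (N : ℝ)⁻¹) := by
          gcongr with i _ j _ j _ i _ j _ j _
          · exact e11 i j
          · exact eother _ _ (e12 i j)
          · exact eother _ _ (e21 i j)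
          · exact eother _ _ (e22 i j)
      _ = M ^ 2 * ((n * ((√n)⁻¹ - (√N)⁻¹)) * (n * ((√n)⁻¹ - (√N)⁻¹)) +
            d * ((n + (n + d)) * (N : ℝ)⁻¹)) := by
          simp only [Finset.sum_const, Finset.card_univ, Fintype.card_fin, nsmul_eq_mul]
          ring
      _ ≤ M ^ 2 * (3 * d) := by
          gcongr
          -- The three border blocks account for `2d`. The change of scaling from `√n` to `√N` in
          -- the common block accounts for the remaining `d`.
          have h1 : (n + (n + d)) * (N : ℝ)⁻¹ ≤ 2 := by
            rw [← div_eq_mul_inv, div_le_iff₀ hN, hNd]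
            have : (0 : ℝ) ≤ d := by positivity
            linarith
          have h2 : (n * ((√n)⁻¹ - (√N)⁻¹)) * (n * ((√n)⁻¹ - (√N)⁻¹)) ≤ (d : ℝ) := by
            set a := √(n : ℝ) with ha
            set b := √(N : ℝ) with hb
            have ha0 : 0 < a := Real.sqrt_pos.2 hn'
            have hb0 : 0 < b := Real.sqrt_pos.2 hN
            have haa : a * a = n := Real.mul_self_sqrt hn'.le
            have hbb : b * b = N := Real.mul_self_sqrt hN.le
            have hab : a ≤ b := Real.sqrt_le_sqrt (by rw [hNd]; simp)
            have e : (n : ℝ) * (a⁻¹ - b⁻¹) = (a / b) * (b - a) := by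
              rw [← haa]; field_simp
            have hd' : (d : ℝ) = (b - a) * (b + a) := by
              have : (d : ℝ) = N - n := by rw [hNd]; ring
              rw [this, ← haa, ← hbb]; ring
            have hr : a / b ≤ 1 := (div_le_one hb0).2 hab
            have hr0 : 0 ≤ a / b := by positivity
            rw [e, hd']
            have hba : 0 ≤ b - a := by linarith
            calc a / b * (b - a) * (a / b * (b - a)) ≤ 1 * (b - a) * (1 * (b - a)) := by gcongr
              _ ≤ _ := by nlinarith
          nlinarith [(Nat.cast_nonneg d : (0 : ℝ) ≤ d)]
  have h := (scaledHankelMatrix_isHermitian x N).norm_sum_exp_sub_le_frobenius hB t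
  have e : hankelCharFun x N t - ((n : ℂ) / N * hankelCharFun x n t + (d : ℂ) / N) =
      (N : ℂ)⁻¹ * (∑ i, Complex.exp (t * (scaledHankelMatrix_isHermitian x N).eigenvalues i *
        Complex.I) - ∑ i, Complex.exp (t * hB.eigenvalues i * Complex.I)) := by
    rw [hpad, hankelCharFun, hankelCharFun]
    have h1 : (n : ℂ) * (n : ℂ)⁻¹ = 1 := mul_inv_cancel₀ (by exact_mod_cast hn.ne')
    rw [div_eq_mul_inv, div_eq_mul_inv]
    linear_combination (-(N : ℂ)⁻¹ * ∑ i, Complex.exp (t *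
      (scaledHankelMatrix_isHermitian x n).eigenvalues i * Complex.I)) * h1
  rw [e, norm_mul, norm_inv, Complex.norm_natCast]
  rw [Fintype.card_fin] at h
  calc _ ≤ (N : ℝ)⁻¹ * (|t| * (√N * √(M ^ 2 * (3 * d)))) := by
        gcongr
        exact h.trans (by gcongr)
    _ = _ := by
        rw [Real.sqrt_mul (sq_nonneg M), Real.sqrt_sq hM0, ← mul_div_assoc,
          Real.sqrt_div (by positivity)]
        nth_rewrite 1 [← Real.mul_self_sqrt hN.le]
        have : √(N : ℝ) ≠ 0 := (Real.sqrt_pos.2 hN).ne'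
        field_simp

/-- Convergence along the squares implies convergence along all sizes, for bounded sequences. -/
theorem tendsto_hankelCharFun_of_sq {x : ℕ → ℝ} {M : ℝ} (hM : ∀ k, |x k| ≤ M) {t : ℝ} {φ : ℂ}
    (h : Tendsto (fun m : ℕ => hankelCharFun x ((m + 1) ^ 2) t) atTop (𝓝 φ)) :
    Tendsto (fun n : ℕ => hankelCharFun x n t) atTop (𝓝 φ) := by
  have hsqrt : Tendsto Nat.sqrt atTop atTop := by
    rw [tendsto_atTop]
    intro b
    filter_upwards [eventually_ge_atTop (b * b)] with n hn
    exact Nat.le_sqrt.2 hn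
  have hG : Tendsto (fun n : ℕ => hankelCharFun x (n.sqrt ^ 2) t) atTop (𝓝 φ) :=
    ((tendsto_add_atTop_iff_nat (f := fun s : ℕ => hankelCharFun x (s ^ 2) t) 1).1 h).comp hsqrt
  -- The proportion of padded rows. The distance from `n` down to the nearest square is at most
  -- `2√n`, so this proportion tends to zero.
  let ρ : ℕ → ℝ := fun n => ((n - n.sqrt ^ 2 : ℕ) : ℝ) / n
  have hρ : Tendsto ρ atTop (𝓝 0) := by
    have h1 : Tendsto (fun n : ℕ => 2 / (n.sqrt : ℝ)) atTop (𝓝 0) :=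
      (tendsto_const_div_atTop_nhds_zero_nat 2).comp hsqrt
    refine squeeze_zero' (Eventually.of_forall fun n => by positivity) ?_ h1
    filter_upwards [eventually_ge_atTop 1] with n hn
    have hs : 0 < n.sqrt := Nat.sqrt_pos.2 hn
    have hs' : (0 : ℝ) < n.sqrt := by exact_mod_cast hs
    have hn' : (0 : ℝ) < n := by exact_mod_cast hn
    have h2 : n - n.sqrt ^ 2 ≤ 2 * n.sqrt := by
      have := Nat.sqrt_le_add n
      rw [pow_two]
      lia
    have h3 : (n.sqrt : ℝ) * n.sqrt ≤ n := by exact_mod_cast Nat.sqrt_le n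
    have h4 : ((n - n.sqrt ^ 2 : ℕ) : ℝ) ≤ 2 * n.sqrt := by exact_mod_cast h2
    rw [div_le_div_iff₀ hn' hs']
    nlinarith
  have herr : Tendsto (fun n => |t| * (M * √(3 * ρ n))) atTop (𝓝 0) := by
    have := ((hρ.const_mul 3).sqrt.const_mul M).const_mul |t|
    simpa using this
  have hmain : Tendsto (fun n : ℕ => ((1 - ρ n : ℝ) : ℂ) * hankelCharFun x (n.sqrt ^ 2) t +
      ((ρ n : ℝ) : ℂ)) atTop (𝓝 φ) := by
    have h1 : Tendsto (fun n => ((ρ n : ℝ) : ℂ)) atTop (𝓝 0) :=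
      (Complex.continuous_ofReal.tendsto 0).comp hρ
    have h2 : Tendsto (fun n => ((1 - ρ n : ℝ) : ℂ)) atTop (𝓝 1) := by
      have := (Complex.continuous_ofReal.tendsto _).comp (hρ.const_sub 1)
      simpa [Function.comp_def] using this
    simpa using (h2.mul hG).add h1
  have hdiff : Tendsto (fun n : ℕ => hankelCharFun x n t -
      (((1 - ρ n : ℝ) : ℂ) * hankelCharFun x (n.sqrt ^ 2) t + ((ρ n : ℝ) : ℂ))) atTop (𝓝 0) := by
    refine squeeze_zero_norm' ?_ herr
    filter_upwards [eventually_ge_atTop 1] with n hn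
    have hs : 0 < n.sqrt ^ 2 := pow_pos (Nat.sqrt_pos.2 hn) 2
    have hle : n.sqrt ^ 2 ≤ n := Nat.sqrt_le' n
    obtain ⟨d, hd⟩ := Nat.exists_eq_add_of_le hle
    have h := norm_hankelCharFun_sub_padding_le hM (d := d) hs t
    rw [← hd] at h
    have hsub : n - n.sqrt ^ 2 = d := by lia
    have hn' : (n : ℝ) ≠ 0 := by exact_mod_cast (by lia : n ≠ 0)
    have hρn : ρ n = (d : ℝ) / n := by simp only [ρ, hsub]
    have h1ρ : 1 - ρ n = ((n.sqrt ^ 2 : ℕ) : ℝ) / n := by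
      rw [hρn, eq_div_iff hn', sub_mul, div_mul_cancel₀ _ hn', one_mul, sub_eq_iff_eq_add]
      exact_mod_cast hd
    rw [h1ρ, hρn]
    push_cast at h ⊢
    exact h
  simpa using hdiff.add hmain

/-- Almost sure convergence for bounded, centred and normalized entries. -/
theorem ae_tendsto_hankelCharFun_of_bounded {γ : ProbabilityMeasure ℝ}
    (hγ : ∀ k : ℕ, Integrable (fun x : ℝ => x ^ k) (γ : Measure ℝ))
    (hγm : ∀ k : ℕ, ∫ x, x ^ k ∂(γ : Measure ℝ) = hankelMoment k)
    {Ω : Type*} [MeasurableSpace Ω] {P : Measure Ω} [IsProbabilityMeasure P] {X : ℕ → Ω → ℝ}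
    (hm : ∀ k, Measurable (X k)) (hind : iIndepFun X P)
    (hid : ∀ k, IdentDistrib (X k) (X 1) P P) {M : ℝ} (hM : ∀ k ω, |X k ω| ≤ M)
    (h0 : ∫ ω, X 1 ω ∂P = 0) (h1 : ∫ ω, X 1 ω ^ 2 ∂P = 1) :
    ∀ᵐ ω ∂P, ∀ t, Tendsto (fun n : ℕ => hankelCharFun (fun k => X k ω) n t) atTop
      (𝓝 (charFun (γ : Measure ℝ) t)) := by
  have hX : ∀ k (p : ℕ), MemLp (X k) p P := fun k p =>
    MemLp.of_bound (hm k).aestronglyMeasurable M (ae_of_all _ fun ω => hM k ω)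
  filter_upwards [ae_tendsto_moment_hankelSpectralMeasure_sq hm hind hid hX h0 h1] with ω hω
  intro t
  refine tendsto_hankelCharFun_of_sq (fun k => hM k ω) ?_
  have h := tendsto_of_tendsto_hankelMoment hγ hγm
    (μ := fun m => hankelSpectralMeasure (fun j => X j ω) ((m + 1) ^ 2))
    (fun n k => integrable_hankelSpectralMeasure _ _ _) hω
  rw [ProbabilityMeasure.tendsto_iff_tendsto_charFun] at h
  refine (h t).congr fun m => ?_
  rw [charFun_hankelSpectralMeasure, hankelCharFun]

/-! ### Truncation and universality -/

/-- A normalized square integrable variable is, up to its mean, close in `L²` to a bounded, centred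
and normalized function of itself. -/
theorem exists_bounded_normalized_approx {Ω : Type*} [MeasurableSpace Ω] {P : Measure Ω}
    [IsProbabilityMeasure P] {Y : Ω → ℝ} (hY : Measurable Y) (hY2 : MemLp Y 2 P)
    (hvar : variance Y P = 1) {ε : ℝ} (hε : 0 < ε) :
    ∃ (h : ℝ → ℝ) (M : ℝ), Measurable h ∧ (∀ y, |h y| ≤ M) ∧ ∫ ω, h (Y ω) ∂P = 0 ∧
      ∫ ω, h (Y ω) ^ 2 ∂P = 1 ∧ ∫ ω, (Y ω - ∫ ω, Y ω ∂P - h (Y ω)) ^ 2 ∂P < ε := by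
  set c := ∫ ω, Y ω ∂P
  have hY1 : Integrable Y P := hY2.integrable (by norm_num)
  have hYsq : Integrable (fun ω => Y ω ^ 2) P := hY2.integrable_sq
  have hq : ∫ ω, Y ω ^ 2 ∂P - c ^ 2 = 1 := by
    rw [← hvar, variance_eq_sub hY2]
    rfl
  let g : ℕ → ℝ → ℝ := fun R y => if |y| ≤ R then y else 0
  have hgm : ∀ R, Measurable (g R) := fun R =>
    Measurable.ite (measurableSet_le (by fun_prop) (by fun_prop)) measurable_id measurable_const
  have hgle : ∀ R y, |g R y| ≤ |y| := by
    intro R y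
    simp only [g]
    split_ifs
    · exact le_rfl
    · simp
  have hgR : ∀ (R : ℕ) y, |g R y| ≤ R := by
    intro R y
    simp only [g]
    split_ifs with h
    · exact h
    · simp
  have hglim : ∀ y, Tendsto (fun R => g R y) atTop (𝓝 y) := by
    intro y
    refine tendsto_const_nhds.congr' ?_
    filter_upwards [eventually_ge_atTop ⌈|y|⌉₊] with R hR
    simp [g, Nat.ceil_le.1 hR]
  let cR : ℕ → ℝ := fun R => ∫ ω, g R (Y ω) ∂P
  let vR : ℕ → ℝ := fun R => ∫ ω, g R (Y ω) ^ 2 ∂P - cR R ^ 2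
  have hgmeas : ∀ R, Measurable fun ω => g R (Y ω) := fun R => (hgm R).comp hY
  have hint1 : ∀ R, Integrable (fun ω => g R (Y ω)) P := fun R =>
    hY1.mono (hgmeas R).aestronglyMeasurable (ae_of_all _ fun ω => hgle R (Y ω))
  have hInt2 : ∀ R, Integrable (fun ω => g R (Y ω) ^ 2) P := fun R =>
    hYsq.mono ((hgmeas R).pow_const 2).aestronglyMeasurable (ae_of_all _ fun ω => by
      rw [Real.norm_eq_abs, Real.norm_eq_abs, abs_pow, abs_pow]
      exact pow_le_pow_left₀ (abs_nonneg _) (hgle R (Y ω)) 2)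
  have hc : Tendsto cR atTop (𝓝 c) :=
    tendsto_integral_of_dominated_convergence (fun ω => |Y ω|)
      (fun R => (hgmeas R).aestronglyMeasurable) hY1.abs
      (fun R => ae_of_all _ fun ω => hgle R (Y ω)) (ae_of_all _ fun ω => hglim (Y ω))
  have hv : Tendsto vR atTop (𝓝 1) := by
    rw [← hq]
    refine Tendsto.sub ?_ (hc.pow 2)
    refine tendsto_integral_of_dominated_convergence (fun ω => Y ω ^ 2)
      (fun R => ((hgmeas R).pow_const 2).aestronglyMeasurable) hYsq
      (fun R => ae_of_all _ fun ω => ?_) (ae_of_all _ fun ω => (hglim (Y ω)).pow 2)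
    rw [Real.norm_eq_abs, abs_pow, ← sq_abs (Y ω)]
    exact pow_le_pow_left₀ (abs_nonneg _) (hgle R (Y ω)) 2
  -- The truncation at level `R`, recentred and rescaled to be exactly normalized. The mean and
  -- variance of the truncation converge to `c` and `1`, so this is close to `Y - c` for large `R`.
  let h : ℕ → ℝ → ℝ := fun R y => (g R y - cR R) / √(vR R)
  have hsv : Tendsto (fun R => √(vR R)) atTop (𝓝 1) := by simpa using hv.sqrt
  have hev : ∀ᶠ R in atTop, |cR R| ≤ |c| + 1 ∧ 1 / 2 ≤ √(vR R) := by
    have h1 := hc.abs.eventually (gt_mem_nhds (lt_add_one |c|))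
    have h2 := hsv.eventually (lt_mem_nhds (show (1 / 2 : ℝ) < 1 by norm_num))
    filter_upwards [h1, h2] with R h1 h2
    exact ⟨h1.le, h2.le⟩
  have hD : Tendsto (fun R => ∫ ω, (Y ω - c - h R (Y ω)) ^ 2 ∂P) atTop (𝓝 0) := by
    have hz : (0 : ℝ) = ∫ _ω, (0 : ℝ) ∂P := by simp
    rw [hz]
    -- The dominating function: `3 = 1 + 2`, where `2` bounds the factor `1 / √(vR R)` by the choice
    -- in `hev`.
    have hbd : Integrable (fun ω => (3 * (|Y ω| + (|c| + 1))) ^ 2) P := by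
      have h1 : MemLp (fun ω => 3 * (|Y ω| + (|c| + 1))) 2 P :=
        (hY2.abs.add (memLp_const _)).const_mul 3
      exact h1.integrable_sq
    refine tendsto_integral_filter_of_dominated_convergence
      (fun ω => (3 * (|Y ω| + (|c| + 1))) ^ 2) ?_ ?_ hbd (ae_of_all _ fun ω => ?_)
    · refine Eventually.of_forall fun R => Measurable.aestronglyMeasurable ?_
      exact ((hY.sub_const c).sub (((hgmeas R).sub_const _).div_const _)).pow_const 2
    · filter_upwards [hev] with R hR
      refine ae_of_all _ fun ω => ?_
      rw [Real.norm_eq_abs, abs_pow]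
      gcongr
      have e1 : |h R (Y ω)| ≤ 2 * (|Y ω| + (|c| + 1)) := by
        simp only [h]
        rw [abs_div, abs_of_nonneg (Real.sqrt_nonneg _), div_le_iff₀ (by linarith [hR.2])]
        have e2 : |g R (Y ω) - cR R| ≤ |Y ω| + (|c| + 1) :=
          (abs_sub _ _).trans (add_le_add (hgle _ _) hR.1)
        have e3 : 0 ≤ |Y ω| + (|c| + 1) := by positivity
        nlinarith [hR.2]
      calc |Y ω - c - h R (Y ω)| ≤ |Y ω - c| + |h R (Y ω)| := abs_sub _ _
        _ ≤ (|Y ω| + |c|) + 2 * (|Y ω| + (|c| + 1)) := add_le_add (abs_sub _ _) e1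
        _ ≤ _ := by linarith
    · have e1 : Tendsto (fun R => h R (Y ω)) atTop (𝓝 ((Y ω - c) / 1)) :=
        ((hglim (Y ω)).sub hc).div hsv one_ne_zero
      have e2 := (e1.const_sub (Y ω - c)).pow 2
      simpa using e2
  obtain ⟨R, hR1, hR2⟩ := (hev.and (hD.eventually (gt_mem_nhds hε))).exists
  have hs : 0 < √(vR R) := by linarith [hR1.2]
  have hvpos : 0 < vR R := Real.sqrt_pos.1 hs
  refine ⟨h R, (R + |cR R|) / √(vR R), ((hgm R).sub_const _).div_const _, fun y => ?_, ?_, ?_, hR2⟩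
  · simp only [h]
    rw [abs_div, abs_of_nonneg hs.le]
    gcongr
    exact (abs_sub _ _).trans (add_le_add (hgR R y) le_rfl)
  · simp only [h]
    rw [integral_div, integral_sub (hint1 R) (integrable_const _)]
    simp [cR]
  · simp only [h, div_pow, Real.sq_sqrt hvpos.le]
    rw [integral_div, div_eq_one_iff_eq hvpos.ne']
    have e : ∀ ω, (g R (Y ω) - cR R) ^ 2 =
        g R (Y ω) ^ 2 - (2 * cR R) * g R (Y ω) + cR R ^ 2 := fun ω => by ring
    simp_rw [e]
    have i1 : Integrable (fun ω => g R (Y ω) ^ 2 - (2 * cR R) * g R (Y ω)) P :=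
      (hInt2 R).sub ((hint1 R).const_mul _)
    rw [integral_add i1 (integrable_const _), integral_sub (hInt2 R) ((hint1 R).const_mul _),
      integral_const_mul]
    simp only [integral_const, probReal_univ, one_smul, vR, cR]
    ring

/-- Universality: almost sure weak convergence of the spectral measures. -/
theorem ae_tendsto_hankelSpectralMeasure {γ : ProbabilityMeasure ℝ}
    (hγ : ∀ k : ℕ, Integrable (fun x : ℝ => x ^ k) (γ : Measure ℝ))
    (hγm : ∀ k : ℕ, ∫ x, x ^ k ∂(γ : Measure ℝ) = hankelMoment k)
    {Ω : Type*} [MeasurableSpace Ω] {P : Measure Ω} [IsProbabilityMeasure P] {X : ℕ → Ω → ℝ}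
    (hm : ∀ k, Measurable (X k)) (hind : iIndepFun X P)
    (hid : ∀ k, IdentDistrib (X k) (X 1) P P) (hvar : variance (X 1) P = 1) :
    ∀ᵐ ω ∂P, Tendsto (fun m : ℕ => hankelSpectralMeasure (fun k => X k ω) (m + 1))
      atTop (𝓝 γ) := by
  have hX2 : MemLp (X 1) 2 P := by
    -- Without a second moment `evariance` is infinite, hence the real variance takes the default
    -- value `0`, contrary to `hvar`.
    by_contra hcon
    rw [variance, evariance_eq_top (hm 1).aestronglyMeasurable hcon] at hvar
    simp at hvar
  set c := ∫ ω, X 1 ω ∂P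
  have hex : ∀ j : ℕ, ∃ (h : ℝ → ℝ) (M : ℝ), Measurable h ∧ (∀ y, |h y| ≤ M) ∧
      ∫ ω, h (X 1 ω) ∂P = 0 ∧ ∫ ω, h (X 1 ω) ^ 2 ∂P = 1 ∧
      ∫ ω, (X 1 ω - c - h (X 1 ω)) ^ 2 ∂P < 1 / ((j : ℝ) + 1) := fun j =>
    exists_bounded_normalized_approx (hm 1) hX2 hvar (by positivity)
  choose h M hhm hhM hh0 hh1 hhD using hex
  have hbdd : ∀ᵐ ω ∂P, ∀ j t, Tendsto (fun n : ℕ => hankelCharFun (fun k => h j (X k ω)) n t) atTop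
      (𝓝 (charFun (γ : Measure ℝ) t)) := by
    rw [ae_all_iff]
    intro j
    exact ae_tendsto_hankelCharFun_of_bounded hγ hγm (X := fun k ω => h j (X k ω))
      (fun k => (hhm j).comp (hm k)) (hind.comp (fun _ => h j) fun _ => hhm j)
      (fun k => (hid k).comp (hhm j)) (fun k ω => hhM j _) (hh0 j) (hh1 j)
  have hslln : ∀ᵐ ω ∂P, ∀ j, Tendsto (fun n : ℕ =>
      (∑ k ∈ Finset.range n, (X k ω - c - h j (X k ω)) ^ 2) / n) atTop
      (𝓝 (∫ ω, (X 1 ω - c - h j (X 1 ω)) ^ 2 ∂P)) := by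
    rw [ae_all_iff]
    intro j
    have hu : Measurable fun y : ℝ => (y - c - h j y) ^ 2 :=
      ((measurable_id.sub_const c).sub (hhm j)).pow_const 2
    have hident : ∀ i, IdentDistrib (fun ω => (X i ω - c - h j (X i ω)) ^ 2)
        (fun ω => (X 1 ω - c - h j (X 1 ω)) ^ 2) P P := fun i => (hid i).comp hu
    have hint1 : Integrable (fun ω => (X 1 ω - c - h j (X 1 ω)) ^ 2) P := by
      have : MemLp (fun ω => X 1 ω - c - h j (X 1 ω)) 2 P :=
        (hX2.sub (memLp_const c)).sub (MemLp.of_bound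
          ((hhm j).comp (hm 1)).aestronglyMeasurable (M j) (ae_of_all _ fun ω => hhM j _))
      exact this.integrable_sq
    have := strong_law_ae_real (μ := P) (fun k ω => (X k ω - c - h j (X k ω)) ^ 2)
      ((hident 0).integrable_iff.2 hint1)
      (fun i k hik => (hind.indepFun hik).comp hu hu)
      (fun i => (hident i).trans (hident 0).symm)
    rwa [(hident 0).integral_eq] at this
  filter_upwards [hbdd, hslln] with ω hω1 hω2
  rw [ProbabilityMeasure.tendsto_iff_tendsto_charFun]
  intro t
  suffices hmain : Tendsto (fun n : ℕ => hankelCharFun (fun k => X k ω) n t) atTop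
      (𝓝 (charFun (γ : Measure ℝ) t)) by
    refine (hmain.comp (tendsto_add_atTop_nat 1)).congr fun m => ?_
    rw [charFun_hankelSpectralMeasure, Function.comp_apply, hankelCharFun]
  rw [Metric.tendsto_nhds]
  intro ε hε
  -- The factor `2` appears because the matrix uses indices below `2n` while the sum of squared
  -- errors is divided by `n`. The three parts of `ε` are for centring, truncation and the bounded
  -- case.
  obtain ⟨j, hj⟩ : ∃ j : ℕ, |t| * √(2 * (1 / ((j : ℝ) + 1))) < ε / 3 := by
    have h1 : Tendsto (fun j : ℕ => |t| * √(2 * (1 / ((j : ℝ) + 1)))) atTop (𝓝 0) := by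
      have := ((tendsto_one_div_add_atTop_nhds_zero_nat (𝕜 := ℝ)).const_mul 2).sqrt.const_mul |t|
      simpa using this
    exact (h1.eventually (gt_mem_nhds (by positivity))).exists
  have hS : Tendsto (fun n : ℕ => |t| * √((∑ k ∈ Finset.range (2 * n),
      (X k ω - c - h j (X k ω)) ^ 2) / n)) atTop
      (𝓝 (|t| * √(2 * ∫ ω, (X 1 ω - c - h j (X 1 ω)) ^ 2 ∂P))) := by
    have h2n : Tendsto (fun n : ℕ => 2 * n) atTop atTop :=
      tendsto_id.const_mul_atTop' (by norm_num)
    have h1 := ((((hω2 j).comp h2n).const_mul 2).sqrt).const_mul |t|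
    refine h1.congr fun n => ?_
    simp only [Function.comp_apply]
    congr 2
    push_cast
    rw [mul_comm (2 : ℝ) (n : ℝ), ← div_div, mul_div_cancel₀ _ (two_ne_zero' ℝ)]
  have hS' : |t| * √(2 * ∫ ω, (X 1 ω - c - h j (X 1 ω)) ^ 2 ∂P) < ε / 3 := by
    refine lt_of_le_of_lt ?_ hj
    gcongr
    exact (hhD j).le
  have hR : Tendsto (fun n : ℕ => |t| * |c| / √(n : ℝ)) atTop (𝓝 0) :=
    Tendsto.div_atTop tendsto_const_nhds
      (Real.tendsto_sqrt_atTop.comp tendsto_natCast_atTop_atTop)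
  filter_upwards [hS.eventually (gt_mem_nhds hS'),
    hR.eventually (gt_mem_nhds (show (0 : ℝ) < ε / 3 by positivity)),
    Metric.tendsto_nhds.1 (hω1 j t) (ε / 3) (by positivity), eventually_gt_atTop 0]
    with n e1 e2 e3 hn
  have b1 := norm_hankelCharFun_sub_shift_le (fun k => X k ω) c hn t
  have b2 := norm_hankelCharFun_sub_le (fun k => X k ω - c) (fun k => h j (X k ω)) hn t
  rw [dist_eq_norm] at e3 ⊢
  set A := hankelCharFun (fun k => X k ω) n t
  set B := hankelCharFun (fun k => X k ω - c) n t
  set D := hankelCharFun (fun k => h j (X k ω)) n t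
  calc ‖A - charFun (γ : Measure ℝ) t‖
      = ‖(A - B) + (B - D) + (D - charFun (γ : Measure ℝ) t)‖ := by congr 1; ring
    _ ≤ ‖A - B‖ + ‖B - D‖ + ‖D - charFun (γ : Measure ℝ) t‖ := norm_add₃_le
    _ < ε := by linarith

/-! ### Gaussian entries: existence and symmetry of the limit law -/

/-- The law of a sequence of independent standard Gaussian variables. -/
noncomputable def gaussianSequence : Measure (ℕ → ℝ) :=
  Measure.infinitePi fun _ : ℕ => gaussianReal 0 1

instance isProbabilityMeasure_gaussianSequence : IsProbabilityMeasure gaussianSequence := by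
  unfold gaussianSequence; infer_instance

theorem iIndepFun_gaussianSequence :
    iIndepFun (fun (k : ℕ) (ω : ℕ → ℝ) => ω k) gaussianSequence :=
  iIndepFun_infinitePi (X := fun _ x => x) fun _ => measurable_id

theorem map_eval_gaussianSequence (k : ℕ) :
    gaussianSequence.map (fun ω : ℕ → ℝ => ω k) = gaussianReal 0 1 :=
  Measure.infinitePi_map_eval (fun _ : ℕ => gaussianReal 0 1) k

theorem identDistrib_gaussianSequence (k l : ℕ) :
    IdentDistrib (fun ω : ℕ → ℝ => ω k) (fun ω : ℕ → ℝ => ω l) gaussianSequence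
      gaussianSequence :=
  ⟨(measurable_pi_apply k).aemeasurable, (measurable_pi_apply l).aemeasurable,
    (map_eval_gaussianSequence k).trans (map_eval_gaussianSequence l).symm⟩

theorem memLp_gaussianSequence (k p : ℕ) :
    MemLp (fun ω : ℕ → ℝ => ω k) p gaussianSequence := by
  have h := memLp_id_gaussianReal' (μ := 0) (v := 1) (p : ℝ≥0∞) (by simp)
  rw [← map_eval_gaussianSequence k] at h
  exact (memLp_map_measure_iff aestronglyMeasurable_id (measurable_pi_apply k).aemeasurable).1 h

theorem integral_gaussianSequence (k : ℕ) :
    ∫ ω : ℕ → ℝ, ω k ∂gaussianSequence = 0 := by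
  have h := integral_id_gaussianReal (μ := 0) (v := 1)
  rw [← map_eval_gaussianSequence k,
    integral_map (measurable_pi_apply k).aemeasurable (by fun_prop)] at h
  exact h

theorem integral_sq_gaussianSequence (k : ℕ) :
    ∫ ω : ℕ → ℝ, ω k ^ 2 ∂gaussianSequence = 1 := by
  have h := variance_fun_id_gaussianReal (μ := 0) (v := 1)
  rw [variance_eq_integral (by fun_prop), integral_id_gaussianReal,
    ← map_eval_gaussianSequence k,
    integral_map (measurable_pi_apply k).aemeasurable (by fun_prop)] at h
  simpa using h

/-- There is a probability measure whose moments are the limiting Hankel moments. -/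
theorem exists_hankelLimit :
    ∃ γ : ProbabilityMeasure ℝ, (∀ k : ℕ, Integrable (fun x : ℝ => x ^ k) (γ : Measure ℝ)) ∧
      ∀ k : ℕ, ∫ x, x ^ k ∂(γ : Measure ℝ) = hankelMoment k := by
  obtain ⟨ω, hω⟩ := (ae_tendsto_moment_hankelSpectralMeasure_sq
    (fun k => measurable_pi_apply k) iIndepFun_gaussianSequence
    (fun k => identDistrib_gaussianSequence k 1) memLp_gaussianSequence
    (integral_gaussianSequence 1) (integral_sq_gaussianSequence 1)).exists
  exact exists_probabilityMeasure_hankelMoment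
    (fun n k => integrable_hankelSpectralMeasure _ _ _) hω

/-- The odd moments vanish, so the reflected law has the same moments. Viewed as a constant sequence
it converges to `γ`, hence equals it. -/
theorem isSymmetricMeasure_of_hankelMoment {γ : ProbabilityMeasure ℝ}
    (hγ : ∀ k : ℕ, Integrable (fun x : ℝ => x ^ k) (γ : Measure ℝ))
    (hγm : ∀ k : ℕ, ∫ x, x ^ k ∂(γ : Measure ℝ) = hankelMoment k) :
    IsSymmetricMeasure (γ : Measure ℝ) := by
  have hneg : Measurable fun x : ℝ => -x := measurable_neg
  let ν : ProbabilityMeasure ℝ := γ.map hneg.aemeasurable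
  have hν : (ν : Measure ℝ) = (γ : Measure ℝ).map fun x => -x := rfl
  have hpow : ∀ (k : ℕ) (x : ℝ), (-x) ^ k = (-1) ^ k * x ^ k := fun k x => by
    rw [← mul_pow, neg_one_mul]
  have hInt : ∀ k : ℕ, Integrable (fun x : ℝ => x ^ k) (ν : Measure ℝ) := by
    intro k
    rw [hν, integrable_map_measure (by fun_prop) hneg.aemeasurable]
    exact ((hγ k).const_mul _).congr (ae_of_all _ fun x => (hpow k x).symm)
  have hmom : ∀ k : ℕ, ∫ x, x ^ k ∂(ν : Measure ℝ) = hankelMoment k := by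
    intro k
    rw [hν, integral_map hneg.aemeasurable (by fun_prop)]
    rw [integral_congr_ae (ae_of_all _ fun x => hpow k x), integral_const_mul, hγm]
    rcases Nat.even_or_odd' k with ⟨j, rfl | rfl⟩
    · simp [pow_mul]
    · rw [hankelMoment_odd, mul_zero]
  have h := tendsto_of_tendsto_hankelMoment hγ hγm (μ := fun _ => ν) (fun _ => hInt)
    (fun k => by rw [hmom]; exact tendsto_const_nhds)
  have he : ν = γ := tendsto_nhds_unique tendsto_const_nhds h
  rw [IsSymmetricMeasure, ← hν, he]

/-! ### A Gaussian lower bound for the moments, and unbounded support -/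

/-- A finite linear combination of independent standard Gaussians is distributed as a multiple of
a standard Gaussian. -/
theorem map_sum_gaussianSequence (d : ℕ → ℝ) (N : ℕ) :
    gaussianSequence.map (fun ω : ℕ → ℝ => ∑ m ∈ Finset.range N, d m * ω m) =
      gaussianReal 0 (Real.toNNReal (∑ m ∈ Finset.range N, d m ^ 2)) := by
  induction N with
  | zero => simp
  | succ N ih =>
    have hind : IndepFun (fun ω : ℕ → ℝ => ∑ m ∈ Finset.range N, d m * ω m)
        (fun ω => d N * ω N) gaussianSequence := by
      have h := (iIndepFun_gaussianSequence.comp (fun m (x : ℝ) => d m * x)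
        (fun m => by fun_prop)).indepFun_finsetSum_of_notMem (fun m => by
          simp only [Function.comp_def]; fun_prop) (s := Finset.range N) (i := N) (by simp)
      convert h using 1
      · ext ω
        simp
      · rfl
    have hN : gaussianSequence.map (fun ω : ℕ → ℝ => d N * ω N) =
        gaussianReal 0 (Real.toNNReal (d N ^ 2)) := by
      have : (fun ω : ℕ → ℝ => d N * ω N) = (fun x => d N * x) ∘ fun ω : ℕ → ℝ => ω N := rfl
      rw [this, ← Measure.map_map (by fun_prop) (by fun_prop), map_eval_gaussianSequence,
        gaussianReal_map_const_mul]
      congr 1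
      · simp
      · ext; simp [Real.coe_toNNReal _ (sq_nonneg (d N))]
    have h := gaussianReal_add_gaussianReal_of_indepFun hind ih hN
    rw [Finset.sum_range_succ, Real.toNNReal_add (Finset.sum_nonneg fun m _ => sq_nonneg _)
      (sq_nonneg _)]
    rw [add_zero] at h
    rw [← h]
    congr 1
    ext ω
    simp [Finset.sum_range_succ]

theorem integrable_pow_gaussianReal (k : ℕ) :
    Integrable (fun x : ℝ => x ^ (2 * k)) (gaussianReal 0 1) := by
  have := (memLp_id_gaussianReal' (μ := 0) (v := 1) ((2 * k : ℕ) : ℝ≥0∞)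
    (ENNReal.natCast_ne_top _))
  rcases Nat.eq_zero_or_pos k with rfl | hk
  · simp
  have h2 := this.integrable_norm_pow (by positivity)
  refine h2.congr (ae_of_all _ fun x => ?_)
  simp [pow_mul]

theorem integral_pow_sum_gaussianSequence (d : ℕ → ℝ) (N k : ℕ) :
    Integrable (fun ω : ℕ → ℝ => (∑ m ∈ Finset.range N, d m * ω m) ^ (2 * k)) gaussianSequence ∧
    ∫ ω, (∑ m ∈ Finset.range N, d m * ω m) ^ (2 * k) ∂gaussianSequence =
      (∑ m ∈ Finset.range N, d m ^ 2) ^ k * ∫ x, x ^ (2 * k) ∂gaussianReal 0 1 := by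
  set v := ∑ m ∈ Finset.range N, d m ^ 2 with hv
  have hv0 : 0 ≤ v := Finset.sum_nonneg fun m _ => sq_nonneg _
  have hlaw : gaussianSequence.map (fun ω : ℕ → ℝ => ∑ m ∈ Finset.range N, d m * ω m) =
      (gaussianReal 0 1).map (fun x => √v * x) := by
    rw [map_sum_gaussianSequence, gaussianReal_map_const_mul]
    congr 1
    · simp
    · ext; simp [Real.coe_toNNReal _ hv0, Real.sq_sqrt hv0, ← hv]
  have hmeas : Measurable fun ω : ℕ → ℝ => ∑ m ∈ Finset.range N, d m * ω m := by fun_prop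
  have hpow : ∀ x : ℝ, (√v * x) ^ (2 * k) = v ^ k * x ^ (2 * k) := fun x => by
    rw [mul_pow, pow_mul (√v), Real.sq_sqrt hv0]
  have hg := integrable_pow_gaussianReal k
  constructor
  · have : Integrable (fun x : ℝ => x ^ (2 * k)) (gaussianSequence.map
        (fun ω : ℕ → ℝ => ∑ m ∈ Finset.range N, d m * ω m)) := by
      rw [hlaw, integrable_map_measure (by fun_prop) (by fun_prop)]
      simp only [Function.comp_def, hpow]
      exact hg.const_mul _
    exact (integrable_map_measure (f := fun ω : ℕ → ℝ => ∑ m ∈ Finset.range N, d m * ω m)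
      (g := fun x : ℝ => x ^ (2 * k)) (by fun_prop) hmeas.aemeasurable).1 this
  · rw [← integral_map (φ := fun ω : ℕ → ℝ => ∑ m ∈ Finset.range N, d m * ω m)
      (f := fun x : ℝ => x ^ (2 * k)) hmeas.aemeasurable (by fun_prop), hlaw,
      integral_map (by fun_prop) (by fun_prop)]
    simp only [hpow]
    rw [integral_const_mul]

/-- The even moments of the standard Gaussian are not bounded by a geometric sequence. -/
theorem exists_lt_integral_pow_gaussianReal (M : ℝ) (hM : 0 < M) :
    ∃ k : ℕ, M ^ (2 * k) < ∫ x, x ^ (2 * k) ∂gaussianReal 0 1 := by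
  -- The tail beyond `2M` has positive mass `p` and contributes at least `(2M) ^ (2k) * p`, which
  -- exceeds `M ^ (2k)` once `4 ^ (-k) < p`.
  let p := (gaussianReal 0 1).real (Set.Ici (2 * M))
  have hp : 0 < p := by
    refine ENNReal.toReal_pos (fun h => ?_) (measure_ne_top _ _)
    have := gaussianReal_absolutelyContinuous' 0 (v := 1) one_ne_zero h
    simp at this
  obtain ⟨k, hk⟩ := exists_pow_lt_of_lt_one hp (show (1 / 4 : ℝ) < 1 by norm_num)
  refine ⟨k, ?_⟩
  have hg := integrable_pow_gaussianReal k
  have h1 := mul_meas_ge_le_integral_of_nonneg (μ := gaussianReal 0 1)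
    (f := fun x : ℝ => x ^ (2 * k)) (ae_of_all _ fun x => by
      exact (even_two_mul k).pow_nonneg x) hg ((2 * M) ^ (2 * k))
  refine lt_of_lt_of_le ?_ h1
  have h2 : p ≤ (gaussianReal 0 1).real {x : ℝ | (2 * M) ^ (2 * k) ≤ x ^ (2 * k)} := by
    refine measureReal_mono (fun x hx => ?_) (measure_ne_top _ _)
    exact pow_le_pow_left₀ (by positivity : (0 : ℝ) ≤ 2 * M) hx _
  calc M ^ (2 * k) = (2 * M) ^ (2 * k) * (1 / 4 : ℝ) ^ k := by
        rw [mul_pow 2 M, pow_mul 2 2 k, mul_right_comm, ← mul_pow]; norm_num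
    _ < (2 * M) ^ (2 * k) * p := by gcongr
    _ ≤ _ := by gcongr

theorem sum_cos_two_pi_mul_div_eq_zero {n : ℕ} (hn : 0 < n) {d : ℤ} (hd : ¬ (n : ℤ) ∣ d) :
    ∑ r : Fin n, Real.cos (2 * Real.pi * r / n * d) = 0 := by
  have hn' : (n : ℂ) ≠ 0 := by exact_mod_cast hn.ne'
  let ξ : ℂ := Complex.exp (2 * Real.pi * Complex.I * (d / n))
  have hξn : ξ ^ n = 1 := by
    rw [← Complex.exp_nat_mul, Complex.exp_eq_one_iff]
    exact ⟨d, by field_simp⟩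
  have hξ1 : ξ ≠ 1 := by
    intro h
    obtain ⟨m, hm⟩ := Complex.exp_eq_one_iff.1 h
    refine hd ⟨m, ?_⟩
    have hpi : (2 * Real.pi * Complex.I : ℂ) ≠ 0 := Complex.two_pi_I_ne_zero
    rw [mul_comm (m : ℂ)] at hm
    have h2 := mul_left_cancel₀ hpi hm
    rw [div_eq_iff hn'] at h2
    rw [mul_comm]
    exact_mod_cast h2
  have hsum : ∑ r : Fin n, ξ ^ (r : ℕ) = 0 := by
    rw [Fin.sum_univ_eq_sum_range (fun i => ξ ^ i) n]
    have := mul_geom_sum ξ n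
    rw [hξn, sub_self] at this
    exact (mul_eq_zero.1 this).resolve_left (sub_ne_zero.2 hξ1)
  have hre := congrArg Complex.re hsum
  rw [Complex.re_sum, Complex.zero_re] at hre
  rw [← hre]
  refine Finset.sum_congr rfl fun r _ => ?_
  rw [← Complex.exp_nat_mul]
  have : ((r : ℕ) : ℂ) * (2 * Real.pi * Complex.I * (d / n)) =
      ((2 * Real.pi * (r : ℕ) / n * d : ℝ) : ℂ) * Complex.I := by
    push_cast; ring
  rw [this, Complex.exp_ofReal_mul_I_re]

/-- Parseval's identity for the finite Fourier transform of a real vector. -/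
theorem sum_sq_cos_add_sq_sin {n : ℕ} (hn : 0 < n) (u : Fin n → ℝ) :
    ∑ r : Fin n, ((∑ a, u a * Real.cos (2 * Real.pi * r / n * a)) ^ 2 +
      (∑ a, u a * Real.sin (2 * Real.pi * r / n * a)) ^ 2) = n * ∑ a, u a ^ 2 := by
  have h1 : ∀ r : Fin n, (∑ a, u a * Real.cos (2 * Real.pi * r / n * a)) ^ 2 +
      (∑ a, u a * Real.sin (2 * Real.pi * r / n * a)) ^ 2 =
      ∑ a, ∑ b, u a * u b * Real.cos (2 * Real.pi * r / n * (((a : ℤ) - (b : ℤ) : ℤ) : ℝ)) := by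
    intro r
    rw [sq, sq, Finset.sum_mul_sum, Finset.sum_mul_sum, ← Finset.sum_add_distrib]
    refine Finset.sum_congr rfl fun a _ => ?_
    rw [← Finset.sum_add_distrib]
    refine Finset.sum_congr rfl fun b _ => ?_
    push_cast
    rw [mul_sub, Real.cos_sub]
    ring
  simp_rw [h1]
  rw [Finset.sum_comm, Finset.mul_sum]
  refine Finset.sum_congr rfl fun a _ => ?_
  rw [Finset.sum_comm]
  simp_rw [← Finset.mul_sum]
  rw [Finset.sum_eq_single a]
  · simp; ring
  · intro b _ hb
    rw [sum_cos_two_pi_mul_div_eq_zero hn, mul_zero]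
    rintro ⟨m, hm⟩
    have ha := a.2
    have hb' := b.2
    have hne : (a : ℕ) ≠ b := fun h => hb (Fin.ext h.symm)
    have hm0 : m = 0 := by
      by_contra h0
      have : 1 ≤ |m| := Int.one_le_abs h0
      have h2 : |(a : ℤ) - b| = n * |m| := by rw [hm, abs_mul]; simp
      have h3 : |(a : ℤ) - b| < n := abs_lt.2 ⟨by omega, by omega⟩
      nlinarith
    rw [hm0, mul_zero] at hm
    omega
  · simp

/-- The sum over the Fourier modes of the even powers of a quadratic form is bounded by the trace
of the power. -/
theorem Matrix.IsHermitian.sum_fourier_pow_le_trace {n : ℕ} {A : Matrix (Fin n) (Fin n) ℝ}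
    (hA : A.IsHermitian) (hn : 0 < n) (φ : Fin n → Prop) [DecidablePred φ] (k : ℕ) :
    ∑ r : Fin n, ((n : ℝ)⁻¹ * ∑ a, ∑ b, A a b * (if φ r then
      Real.cos (2 * Real.pi * r / n * (a + b)) else
      Real.sin (2 * Real.pi * r / n * (a + b)))) ^ (2 * k) ≤ (A ^ (2 * k)).trace := by
  obtain ⟨U, hU1, hU2, hAU⟩ := hA.exists_orthogonal_diagonalization
  have hn' : (0 : ℝ) < n := by exact_mod_cast hn
  set lam := hA.eigenvalues with hlam
  let C : Fin n → Fin n → ℝ := fun r i => ∑ a, U a i * Real.cos (2 * Real.pi * r / n * a)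
  let S : Fin n → Fin n → ℝ := fun r i => ∑ a, U a i * Real.sin (2 * Real.pi * r / n * a)
  -- The weight of the `i`-th eigenvector on the Fourier mode `r`. Both bases are orthonormal, so
  -- this matrix is doubly stochastic.
  let w : Fin n → Fin n → ℝ := fun r i => (n : ℝ)⁻¹ * (C r i ^ 2 + S r i ^ 2)
  have hw0 : ∀ r i, 0 ≤ w r i := fun r i => by positivity
  have hwr : ∀ i, ∑ r, w r i = 1 := by
    intro i
    simp only [w, C, S]
    rw [← Finset.mul_sum, sum_sq_cos_add_sq_sin hn (fun a => U a i),
      Matrix.sum_sq_col_of_orthogonal hU2, mul_one, inv_mul_cancel₀ hn'.ne']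
  have hpar : ∀ f : Fin n → ℝ, ∑ i, (∑ a, U a i * f a) ^ 2 = ∑ a, f a ^ 2 := by
    intro f
    have h1 : ∀ i, ∑ a, U a i * f a = (U.transpose.mulVec f) i := fun i => rfl
    simp_rw [h1, sq]
    change (U.transpose.mulVec f) ⬝ᵥ (U.transpose.mulVec f) = f ⬝ᵥ f
    rw [Matrix.dotProduct_mulVec, Matrix.vecMul_transpose, Matrix.mulVec_mulVec, hU1,
      Matrix.one_mulVec]
  have hwi : ∀ r, ∑ i, w r i = 1 := by
    intro r
    simp only [w, C, S]
    rw [← Finset.mul_sum, Finset.sum_add_distrib, hpar, hpar, ← Finset.sum_add_distrib]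
    simp [hn'.ne']
  have hbil : ∀ f g : Fin n → ℝ, ∑ a, ∑ b, A a b * (f a * g b) =
      ∑ i, lam i * ((∑ a, U a i * f a) * ∑ b, U b i * g b) := by
    intro f g
    have hent : ∀ a b, A a b = ∑ i, U a i * lam i * U b i := by
      intro a b
      conv_lhs => rw [hAU]
      simp [Matrix.mul_apply, Matrix.diagonal_apply]
    simp_rw [hent, Finset.sum_mul_sum, Finset.mul_sum, Finset.sum_mul]
    rw [Finset.sum_comm]
    conv_lhs => enter [2, b]; rw [Finset.sum_comm]
    rw [Finset.sum_comm]
    refine Finset.sum_congr rfl fun i _ => ?_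
    rw [Finset.sum_comm]
    refine Finset.sum_congr rfl fun a _ => Finset.sum_congr rfl fun b _ => ?_
    ring
  have hbound : ∀ r, |(n : ℝ)⁻¹ * ∑ a, ∑ b, A a b * (if φ r then
      Real.cos (2 * Real.pi * r / n * (a + b)) else
      Real.sin (2 * Real.pi * r / n * (a + b)))| ≤ ∑ i, w r i * |lam i| := by
    intro r
    -- By the addition formulas the form has coefficients `C² - S²` or `2CS` in the eigenbasis, that
    -- is, the real or imaginary part of `(C + iS)²`.
    have key : ∃ z : Fin n → ℝ, (∀ i, |z i| ≤ C r i ^ 2 + S r i ^ 2) ∧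
        ∑ a, ∑ b, A a b * (if φ r then Real.cos (2 * Real.pi * r / n * (a + b)) else
          Real.sin (2 * Real.pi * r / n * (a + b))) = ∑ i, lam i * z i := by
      by_cases hφ : φ r
      · refine ⟨fun i => C r i * C r i - S r i * S r i, fun i => ?_, ?_⟩
        · rw [abs_le]; constructor <;> nlinarith [sq_nonneg (C r i), sq_nonneg (S r i)]
        · simp_rw [if_pos hφ, mul_sub, Finset.sum_sub_distrib, C, S, ← hbil,
            ← Finset.sum_sub_distrib, ← mul_sub, ← Real.cos_add, ← mul_add]
      · refine ⟨fun i => S r i * C r i + C r i * S r i, fun i => ?_, ?_⟩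
        · rw [abs_le]
          constructor <;> nlinarith [sq_nonneg (C r i - S r i), sq_nonneg (C r i + S r i)]
        · simp_rw [if_neg hφ, mul_add (lam _), Finset.sum_add_distrib, C, S, ← hbil,
            ← Finset.sum_add_distrib, ← mul_add, ← Real.sin_add, ← mul_add]
    obtain ⟨z, hz, he⟩ := key
    rw [he, Finset.mul_sum]
    refine (Finset.abs_sum_le_sum_abs _ _).trans (Finset.sum_le_sum fun i _ => ?_)
    rw [abs_mul, abs_mul, abs_of_pos (inv_pos.2 hn')]
    calc (n : ℝ)⁻¹ * (|lam i| * |z i|) ≤ (n : ℝ)⁻¹ * (|lam i| * (C r i ^ 2 + S r i ^ 2)) := by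
          gcongr; exact hz i
      _ = w r i * |lam i| := by simp only [w]; ring
  -- Jensen uses that the weights sum to one over `i`; summing over the modes then uses that they
  -- sum to one over `r`.
  calc _ ≤ ∑ r, ∑ i, w r i * lam i ^ (2 * k) := by
        refine Finset.sum_le_sum fun r _ => ?_
        rw [← (even_two_mul k).pow_abs]
        refine (pow_le_pow_left₀ (abs_nonneg _) (hbound r) _).trans ?_
        refine (Real.pow_arith_mean_le_arith_mean_pow Finset.univ (w r) (fun i => |lam i|)
          (fun i _ => hw0 r i) (hwi r) (fun i _ => abs_nonneg _) (2 * k)).trans (le_of_eq ?_)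
        simp_rw [(even_two_mul k).pow_abs]
    _ = ∑ i, lam i ^ (2 * k) := by
        rw [Finset.sum_comm]
        simp_rw [← Finset.sum_mul, hwr, one_mul]
    _ = _ := hA.sum_eigenvalues_pow _

/-- The number of representations of `m` as a sum of two elements of `{0, …, n - 1}`. -/
def antidiagCount (n m : ℕ) : ℕ :=
  (Finset.univ.filter fun p : Fin n × Fin n => (p.1 : ℕ) + p.2 = m).card

theorem sum_sum_eq_sum_antidiagCount (n : ℕ) (f : ℕ → ℝ) :
    ∑ a : Fin n, ∑ b : Fin n, f (a + b) = ∑ m ∈ Finset.range (2 * n), antidiagCount n m * f m := by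
  rw [← Fintype.sum_prod_type' (fun a b : Fin n => f (a + b)),
    ← Finset.sum_fiberwise_of_maps_to (s := Finset.univ) (t := Finset.range (2 * n))
      (g := fun p : Fin n × Fin n => (p.1 : ℕ) + p.2)]
  · refine Finset.sum_congr rfl fun m _ => ?_
    rw [Finset.sum_congr rfl (g := fun _ => f m), Finset.sum_const, nsmul_eq_mul, antidiagCount]
    intro p hp
    rw [(Finset.mem_filter.1 hp).2]
  · intro p _
    rw [Finset.mem_range]
    have := p.1.2
    have := p.2.2
    omega

/-- Cauchy–Schwarz: the `n ^ 2` pairs are distributed over `2n` antidiagonals. -/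
theorem pow_three_div_two_le_sum_antidiagCount_sq (n : ℕ) :
    (n : ℝ) ^ 3 / 2 ≤ ∑ m ∈ Finset.range (2 * n), (antidiagCount n m : ℝ) ^ 2 := by
  rcases Nat.eq_zero_or_pos n with rfl | hn
  · simp
  have hn' : (0 : ℝ) < n := by exact_mod_cast hn
  have h1 := sum_sum_eq_sum_antidiagCount n fun _ => 1
  have h2 := sq_sum_le_card_mul_sum_sq (s := Finset.range (2 * n))
    (f := fun m => (antidiagCount n m : ℝ))
  simp only [Finset.sum_const, Finset.card_univ, Fintype.card_fin, nsmul_eq_mul, mul_one] at h1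
  rw [← h1, Finset.card_range] at h2
  push_cast at h2
  refine le_of_mul_le_mul_left ?_ (show (0 : ℝ) < 2 * n by positivity)
  calc 2 * (n : ℝ) * (n ^ 3 / 2) = (n * n) ^ 2 := by ring
    _ ≤ _ := h2

/-- The limiting even moments dominate those of a centred Gaussian of variance `1 / 4`. -/
theorem gaussian_moment_le_hankelMoment (k : ℕ) :
    (1 / 4 : ℝ) ^ k * ∫ x, x ^ (2 * k) ∂gaussianReal 0 1 ≤ hankelMoment (2 * k) := by
  obtain ⟨hInt, hlim⟩ := tendsto_integral_moment_hankelSpectralMeasure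
    (fun k => measurable_pi_apply k) iIndepFun_gaussianSequence
    (fun k => identDistrib_gaussianSequence k 1) memLp_gaussianSequence
    (integral_gaussianSequence 1) (integral_sq_gaussianSequence 1) (2 * k)
  refine ge_of_tendsto hlim ?_
  filter_upwards [eventually_gt_atTop 0] with n hn
  have hn' : (0 : ℝ) < n := by exact_mod_cast hn
  set G := ∫ x, x ^ (2 * k) ∂gaussianReal 0 1 with hG
  have hG0 : 0 ≤ G := integral_nonneg fun x => (even_two_mul k).pow_nonneg x
  let g : Prop → Fin n → ℕ → ℝ := fun q r m => open Classical in
    if q then Real.cos (2 * Real.pi * r / n * m) else Real.sin (2 * Real.pi * r / n * m)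
  let d : Prop → Fin n → ℕ → ℝ := fun q r m => (n : ℝ)⁻¹ * (√n)⁻¹ * (antidiagCount n m * g q r m)
  -- The variances of the cosine and sine forms of one mode add up to at least `1/2`, so one of them
  -- is at least `1/4`. The predicate `φ` makes the choice.
  have hd : ∀ r, 1 / 2 ≤ ∑ m ∈ Finset.range (2 * n), d True r m ^ 2 +
      ∑ m ∈ Finset.range (2 * n), d False r m ^ 2 := by
    intro r
    rw [← Finset.sum_add_distrib]
    have h1 : ∀ m, d True r m ^ 2 + d False r m ^ 2 =
        ((n : ℝ) ^ 3)⁻¹ * (antidiagCount n m : ℝ) ^ 2 := by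
      intro m
      have hs : (√(n : ℝ))⁻¹ ^ 2 = (n : ℝ)⁻¹ := by rw [inv_pow, Real.sq_sqrt hn'.le]
      simp only [d, g, if_true, if_false, mul_pow, hs]
      rw [← mul_add, ← mul_add, Real.cos_sq_add_sin_sq]
      field_simp
    simp_rw [h1]
    rw [← Finset.mul_sum, inv_mul_eq_div, le_div_iff₀ (by positivity)]
    have := pow_three_div_two_le_sum_antidiagCount_sq n
    linarith
  let φ : Fin n → Prop := fun r => 1 / 4 ≤ ∑ m ∈ Finset.range (2 * n), d True r m ^ 2
  classical
  have hdφ : ∀ r, 1 / 4 ≤ ∑ m ∈ Finset.range (2 * n), d (φ r) r m ^ 2 := by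
    intro r
    by_cases h : φ r
    · rw [eq_true h]; exact h
    · rw [eq_false h]
      have := hd r
      simp only [φ, not_le] at h
      linarith
  -- Hankel entries start at index `1`, hence the shift of the coefficients by one and the zero
  -- coefficient for `ω 0`.
  have hdet : ∀ ω : ℕ → ℝ, ∑ r : Fin n,
      (∑ m ∈ Finset.range (2 * n + 1), (if m = 0 then 0 else d (φ r) r (m - 1)) * ω m) ^ (2 * k) ≤
      (√n)⁻¹ ^ (2 * k) * (hankelMatrix (fun j => ω j) n ^ (2 * k)).trace := by
    intro ω
    have h1 := (scaledHankelMatrix_isHermitian ω n).sum_fourier_pow_le_trace hn φ k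
    rw [scaledHankelMatrix, smul_pow, Matrix.trace_smul, smul_eq_mul] at h1
    refine le_trans (le_of_eq ?_) h1
    refine Finset.sum_congr rfl fun r _ => ?_
    congr 1
    have h2 := sum_sum_eq_sum_antidiagCount n fun m => (√n)⁻¹ * ω (m + 1) * g (φ r) r m
    rw [Finset.sum_range_succ']
    simp only [Nat.add_sub_cancel, if_true, zero_mul, add_zero, Nat.add_eq_zero_iff, one_ne_zero,
      and_false, if_false]
    have h3 : ∑ a : Fin n, ∑ b : Fin n, ((√(n : ℝ))⁻¹ • hankelMatrix ω n) a b * (if φ r then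
        Real.cos (2 * Real.pi * r / n * (a + b)) else
        Real.sin (2 * Real.pi * r / n * (a + b))) =
        ∑ a : Fin n, ∑ b : Fin n, (√n)⁻¹ * ω (a + b + 1) * g (φ r) r (a + b) := by
      refine Finset.sum_congr rfl fun a _ => Finset.sum_congr rfl fun b _ => ?_
      simp [hankelMatrix, g]
    rw [h3, h2, Finset.mul_sum]
    refine Finset.sum_congr rfl fun m _ => ?_
    simp only [d]
    ring
  have hI := fun r : Fin n => integral_pow_sum_gaussianSequence
    (fun m => if m = 0 then 0 else d (φ r) r (m - 1)) (2 * n + 1) k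
  have hmono := integral_mono (μ := gaussianSequence)
    (integrable_finsetSum Finset.univ fun r _ => (hI r).1)
    ((hInt n).const_mul ((√n)⁻¹ ^ (2 * k))) hdet
  rw [integral_finsetSum _ fun r _ => (hI r).1] at hmono
  rw [integral_const_mul, inv_mul_eq_div, le_div_iff₀ hn']
  refine le_trans ?_ hmono
  have h4 : ∀ r ∈ (Finset.univ : Finset (Fin n)), (1 / 4 : ℝ) ^ k * G ≤
      ∫ ω, (∑ m ∈ Finset.range (2 * n + 1), (if m = 0 then 0 else d (φ r) r (m - 1)) * ω m) ^
        (2 * k) ∂gaussianSequence := by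
    intro r _
    rw [(hI r).2, Finset.sum_range_succ']
    simp only [Nat.add_sub_cancel, if_true, Nat.add_eq_zero_iff, one_ne_zero,
      and_false, if_false]
    gcongr
    rw [zero_pow two_ne_zero, add_zero]
    exact hdφ r
  have h5 := Finset.card_nsmul_le_sum _ _ _ h4
  rw [Finset.card_univ, Fintype.card_fin, nsmul_eq_mul] at h5
  rwa [mul_comm]

theorem not_isBounded_support_of_hankelMoment {γ : ProbabilityMeasure ℝ}
    (hγ : ∀ k : ℕ, Integrable (fun x : ℝ => x ^ k) (γ : Measure ℝ))
    (hγm : ∀ k : ℕ, ∫ x, x ^ k ∂(γ : Measure ℝ) = hankelMoment k) :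
    ¬ Bornology.IsBounded (γ : Measure ℝ).support := by
  intro hb
  obtain ⟨M, hM0, hM⟩ := hb.exists_pos_norm_le
  have hae : ∀ᵐ x ∂(γ : Measure ℝ), x ∈ (γ : Measure ℝ).support := Measure.support_mem_ae
  -- The radius is doubled to absorb the factor `(1/4) ^ k` of the Gaussian comparison.
  obtain ⟨k, hk⟩ := exists_lt_integral_pow_gaussianReal (2 * M) (by positivity)
  have h1 : hankelMoment (2 * k) ≤ M ^ (2 * k) := by
    rw [← hγm]
    have h2 : ∫ x, x ^ (2 * k) ∂(γ : Measure ℝ) ≤ ∫ _, M ^ (2 * k) ∂(γ : Measure ℝ) := by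
      refine integral_mono_ae (hγ _) (integrable_const _) ?_
      filter_upwards [hae] with x hx
      rw [← (even_two_mul k).pow_abs]
      exact pow_le_pow_left₀ (abs_nonneg x) (hM x hx) _
    simpa using h2
  have h3 := gaussian_moment_le_hankelMoment k
  have h4 : (1 / 4 : ℝ) ^ k * (2 * M) ^ (2 * k) = M ^ (2 * k) := by
    rw [mul_pow 2 M, pow_mul 2 2 k, ← mul_assoc, ← mul_pow]; norm_num
  have h5 := mul_lt_mul_of_pos_left hk (show (0 : ℝ) < (1 / 4) ^ k by positivity)
  linarith

/-! ### A test for unimodality -/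

/-- Under unimodality the mass of consecutive intervals of equal length decreases away from `0`. -/
theorem IsUnimodalSymmetric.measure_Ico_le {ν : Measure ℝ} [IsProbabilityMeasure ν]
    (hν : IsUnimodalSymmetric ν) {x h : ℝ} (hx : 0 < x) (hh : 0 < h) :
    ν (Set.Ico (x + h) (x + 2 * h)) ≤ ν (Set.Ico x (x + h)) := by
  obtain ⟨hsym, hconv⟩ := hν
  have hIci : ∀ y : ℝ, ν.real (Set.Ici y) = ν.real (Set.Iic (-y)) := by
    intro y
    conv_lhs => rw [← hsym]
    rw [map_measureReal_apply measurable_neg measurableSet_Ici]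
    congr 1
    ext z
    simp
  have hIco : ∀ a b : ℝ, a ≤ b → ν.real (Set.Ico a b) = ν.real (Set.Iic (-a)) -
      ν.real (Set.Iic (-b)) := by
    intro a b hab
    rw [← hIci, ← hIci, ← Set.Ici_sdiff_Ici,
      measureReal_sdiff (Set.Ici_subset_Ici.2 hab) measurableSet_Ici]
  rw [← ENNReal.toReal_le_toReal (measure_ne_top _ _) (measure_ne_top _ _)]
  change ν.real _ ≤ ν.real _
  rw [hIco _ _ (by linarith), hIco _ _ (by linarith)]
  have h1 := hconv.2 (show -x ∈ Set.Iio (0 : ℝ) by simp; linarith)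
    (show -(x + 2 * h) ∈ Set.Iio (0 : ℝ) by simp; linarith)
    (show (0 : ℝ) ≤ 1 / 2 by norm_num) (show (0 : ℝ) ≤ 1 / 2 by norm_num) (by norm_num)
  simp only [smul_eq_mul] at h1
  have h2 : 1 / 2 * -x + 1 / 2 * -(x + 2 * h) = -(x + h) := by ring
  rw [h2] at h1
  linarith

/-- After Tonelli the two sides integrate `g x` against the masses of adjacent intervals to the
right of `x`. This is monotonicity of the density in a form that needs no density. -/
theorem IsUnimodalSymmetric.lintegral_shift_le {ν : Measure ℝ} [IsProbabilityMeasure ν]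
    (hν : IsUnimodalSymmetric ν) {g : ℝ → ℝ≥0∞} (hg : Measurable g) (hg0 : ∀ x ≤ 0, g x = 0)
    {h : ℝ} (hh : 0 < h) :
    ∫⁻ y, (∫⁻ x in Set.Ioc (y - 2 * h) (y - h), g x) ∂ν ≤
      ∫⁻ y, (∫⁻ x in Set.Ioc (y - h) y, g x) ∂ν := by
  have key : ∀ a b : ℝ, ∫⁻ y, (∫⁻ x in Set.Ioc (y - b) (y - a), g x) ∂ν =
      ∫⁻ x, g x * ν (Set.Ico (x + a) (x + b)) := by
    intro a b
    have hset : MeasurableSet {p : ℝ × ℝ | p.1 - b < p.2 ∧ p.2 ≤ p.1 - a} :=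
      (measurableSet_lt (f := fun p : ℝ × ℝ => p.1 - b) (g := fun p => p.2) (by fun_prop)
        (by fun_prop)).inter (measurableSet_le (f := fun p : ℝ × ℝ => p.2)
        (g := fun p => p.1 - a) (by fun_prop) (by fun_prop))
    have h1 : ∀ y, ∫⁻ x in Set.Ioc (y - b) (y - a), g x =
        ∫⁻ x, {p : ℝ × ℝ | p.1 - b < p.2 ∧ p.2 ≤ p.1 - a}.indicator (fun p => g p.2) (y, x) := by
      intro y
      rw [← lintegral_indicator measurableSet_Ioc]
      rfl
    simp_rw [h1]
    rw [lintegral_lintegral_swap]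
    · refine lintegral_congr fun x => ?_
      rw [← lintegral_indicator_const measurableSet_Ico]
      refine lintegral_congr fun y => ?_
      simp only [Set.indicator, Set.mem_ofPred_eq, Set.mem_Ico]
      refine if_congr ?_ rfl rfl
      constructor <;> rintro ⟨h1, h2⟩ <;> constructor <;> linarith
    · exact ((hg.comp measurable_snd).indicator hset).aemeasurable
  have k0 := key 0 h
  simp only [sub_zero, add_zero] at k0
  rw [key, k0]
  refine lintegral_mono fun x => ?_
  rcases le_or_gt x 0 with hx | hx
  · simp [hg0 x hx]
  · exact mul_le_mul_right (hν.measure_Ico_le hx hh) _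

/-- A symmetric unimodal law has nonnegative integral over `(0, ∞)` against the derivative of a
function that is nonnegative there and vanishes at `0`. -/
theorem IsUnimodalSymmetric.setIntegral_deriv_nonneg {ν : Measure ℝ} [IsProbabilityMeasure ν]
    (hν : IsUnimodalSymmetric ν) {Q q K : ℝ → ℝ} (hQ : ∀ x, HasDerivAt Q (q x) x) (hQ0 : Q 0 = 0)
    (hQnn : ∀ x, 0 ≤ x → 0 ≤ Q x) (hq : Continuous q) (hK : ∀ x y, |x| ≤ |y| → |q x| ≤ K y)
    (hKint : Integrable K ν) (hKint' : Integrable (fun y => |y| * K y) ν) :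
    0 ≤ ∫ y in Set.Ioi 0, q y ∂ν := by
  -- `Q` is cut off to the left of `0`. The hypothesis `Q 0 = 0` keeps `g` continuous and locally
  -- Lipschitz, with constant `K y` up to `y`.
  let g : ℝ → ℝ := fun x => Q (max x 0)
  have hQc : Continuous Q := continuous_iff_continuousAt.2 fun x => (hQ x).continuousAt
  have hgc : Continuous g := hQc.comp (continuous_id.max continuous_const)
  have hg0 : ∀ x ≤ 0, g x = 0 := fun x hx => by simp [g, max_eq_right hx, hQ0]
  have hgnn : ∀ x, 0 ≤ g x := fun x => hQnn _ (le_max_right _ _)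
  have hK0 : ∀ y, 0 ≤ K y := fun y => (abs_nonneg _).trans (hK y y le_rfl)
  have hlip : ∀ x x' y : ℝ, x ≤ y → x' ≤ y → |g x - g x'| ≤ K y * |x - x'| := by
    intro x x' y hx hx'
    have h1 : |max x 0 - max x' 0| ≤ |x - x'| := abs_max_sub_max_le_abs x x' 0
    rcases le_or_gt y 0 with hy | hy
    · rw [hg0 x (hx.trans hy), hg0 x' (hx'.trans hy), sub_zero, abs_zero]
      exact mul_nonneg (hK0 y) (abs_nonneg _)
    · refine le_trans ?_ (mul_le_mul_of_nonneg_left h1 (hK0 y))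
      have := (convex_Icc 0 y).norm_image_sub_le_of_norm_hasDerivWithin_le (f := Q) (f' := q)
        (C := K y) (x := max x' 0) (y := max x 0) (fun z _ => (hQ z).hasDerivWithinAt)
        (fun z hz => hK z y (by rw [abs_of_nonneg hz.1, abs_of_pos hy]; exact hz.2))
        ⟨le_max_right _ _, max_le hx' hy.le⟩ ⟨le_max_right _ _, max_le hx hy.le⟩
      exact this
  have hgle : ∀ x y : ℝ, x ≤ y → g x ≤ |y| * K y := by
    intro x y hxy
    rcases le_or_gt x 0 with hx | hx
    · rw [hg0 x hx]; exact mul_nonneg (abs_nonneg _) (hK0 y)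
    · have := hlip x 0 y hxy (hx.le.trans hxy)
      rw [hg0 0 le_rfl, sub_zero, sub_zero, abs_of_nonneg (hgnn x), abs_of_pos hx] at this
      refine this.trans ?_
      rw [mul_comm, abs_of_pos (hx.trans_le hxy)]
      exact mul_le_mul_of_nonneg_right hxy (hK0 y)
  have hii : ∀ a b : ℝ, IntervalIntegrable g volume a b := fun a b => hgc.intervalIntegrable a b
  -- `(A h - B h) / h ^ 2` is an averaged difference quotient of `g`. It has nonnegative
  -- `ν`-integral for each `h > 0` and, as `h → 0`, tends to `q` on the positive half line and to
  -- `0` elsewhere, dominated by `K`.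
  let A : ℝ → ℝ → ℝ := fun h y => ∫ x in (y - h)..y, g x
  let B : ℝ → ℝ → ℝ := fun h y => ∫ x in (y - 2 * h)..(y - h), g x
  have hPc : Continuous fun y : ℝ => ∫ x in (0 : ℝ)..y, g x :=
    intervalIntegral.continuous_primitive hii 0
  have hAc : ∀ h, Continuous (A h) := by
    intro h
    have : A h = fun y => (∫ x in (0 : ℝ)..y, g x) - ∫ x in (0 : ℝ)..(y - h), g x := by
      ext y; exact (intervalIntegral.integral_interval_sub_left (hii _ _) (hii _ _)).symm
    rw [this]
    exact hPc.sub (hPc.comp (continuous_id.sub continuous_const))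
  have hBA : ∀ h y, B h y = A h (y - h) := by
    intro h y
    simp only [A, B]
    congr 1
    ring
  have hBc : ∀ h, Continuous (B h) := by
    intro h
    have : B h = fun y => A h (y - h) := funext (hBA h)
    rw [this]
    exact (hAc h).comp (continuous_id.sub continuous_const)
  have hbd : ∀ a b y : ℝ, a ≤ b → b ≤ y → 0 ≤ ∫ x in a..b, g x ∧
      ∫ x in a..b, g x ≤ (b - a) * (|y| * K y) := by
    intro a b y hab hby
    refine ⟨intervalIntegral.integral_nonneg hab fun x _ => hgnn x, ?_⟩
    have := intervalIntegral.integral_mono_on hab (hii a b)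
      (intervalIntegrable_const (μ := volume) (c := |y| * K y))
      (fun x hx => hgle x y (hx.2.trans hby))
    rwa [intervalIntegral.integral_const, smul_eq_mul] at this
  have hAi : ∀ h, 0 < h → Integrable (A h) ν := by
    intro h hh
    refine (hKint'.const_mul h).mono' (hAc h).aestronglyMeasurable (ae_of_all _ fun y => ?_)
    obtain ⟨h1, h2⟩ := hbd (y - h) y y (by linarith) le_rfl
    rw [Real.norm_eq_abs, abs_of_nonneg h1]
    simpa using h2
  have hBi : ∀ h, 0 < h → Integrable (B h) ν := by
    intro h hh
    refine (hKint'.const_mul h).mono' (hBc h).aestronglyMeasurable (ae_of_all _ fun y => ?_)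
    obtain ⟨h1, h2⟩ := hbd (y - 2 * h) (y - h) y (by linarith) (by linarith)
    rw [Real.norm_eq_abs, abs_of_nonneg h1]
    refine h2.trans (le_of_eq ?_)
    ring
  have hle : ∀ h, 0 < h → ∫ y, B h y ∂ν ≤ ∫ y, A h y ∂ν := by
    intro h hh
    have hconv : ∀ a b : ℝ, a ≤ b → ∫⁻ x in Set.Ioc a b, ENNReal.ofReal (g x) =
        ENNReal.ofReal (∫ x in a..b, g x) := by
      intro a b hab
      rw [intervalIntegral.integral_of_le hab, ofReal_integral_eq_lintegral_ofReal
        ((hii a b).1) (ae_of_all _ hgnn)]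
    have h1 := hν.lintegral_shift_le (g := fun x => ENNReal.ofReal (g x))
      hgc.measurable.ennreal_ofReal (fun x hx => by rw [hg0 x hx, ENNReal.ofReal_zero]) hh
    have h2 : ∀ y, ∫⁻ x in Set.Ioc (y - 2 * h) (y - h), ENNReal.ofReal (g x) =
      ENNReal.ofReal (B h y) := fun y => hconv _ _ (by linarith)
    have h3 : ∀ y, ∫⁻ x in Set.Ioc (y - h) y, ENNReal.ofReal (g x) =
      ENNReal.ofReal (A h y) := fun y => hconv _ _ (by linarith)
    simp_rw [h2, h3] at h1
    rw [← ofReal_integral_eq_lintegral_ofReal (hBi h hh)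
        (ae_of_all _ fun y => (hbd _ _ y (by linarith) (by linarith)).1),
      ← ofReal_integral_eq_lintegral_ofReal (hAi h hh)
        (ae_of_all _ fun y => (hbd _ _ y (by linarith) le_rfl).1)] at h1
    exact (ENNReal.ofReal_le_ofReal_iff (integral_nonneg fun y =>
      (hbd _ _ y (by linarith) le_rfl).1)).1 h1
  have hdiff : ∀ h y, A h y - B h y = ∫ x in (y - h)..y, (g x - g (x - h)) := by
    intro h y
    have hshift : ∫ x in (y - h)..y, g (x - h) = B h y := by
      rw [intervalIntegral.integral_comp_sub_right]
      simp only [B]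
      congr 1
      ring
    have hgs : Continuous fun x => g (x - h) := hgc.comp (continuous_id.sub continuous_const)
    rw [intervalIntegral.integral_sub (hii _ _) (hgs.intervalIntegrable _ _), hshift]
  let u : ℕ → ℝ := fun m => 1 / ((m : ℝ) + 1)
  have hu : ∀ m, 0 < u m := fun m => by positivity
  have hu0 : Tendsto u atTop (𝓝 0) := tendsto_one_div_add_atTop_nhds_zero_nat
  let D : ℕ → ℝ → ℝ := fun m y => ((u m) ^ 2)⁻¹ * (A (u m) y - B (u m) y)
  have hest : ∀ (h y c ε : ℝ), 0 < h →
      (∀ x ∈ Set.Ioc (y - h) y, |g x - g (x - h) - c * h| ≤ ε * h) →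
      |(h ^ 2)⁻¹ * (A h y - B h y) - c| ≤ ε := by
    intro h y c ε hh hx
    have h1 : A h y - B h y - c * h ^ 2 = ∫ x in (y - h)..y, (g x - g (x - h) - c * h) := by
      have hgs : Continuous fun x => g x - g (x - h) :=
        hgc.sub (hgc.comp (continuous_id.sub continuous_const))
      rw [intervalIntegral.integral_sub (hgs.intervalIntegrable _ _) intervalIntegrable_const,
        ← hdiff, intervalIntegral.integral_const, smul_eq_mul]
      ring
    have h2 := intervalIntegral.norm_integral_le_of_norm_le_const (a := y - h) (b := y)
      (f := fun x => g x - g (x - h) - c * h) (C := ε * h) (fun x hx' => by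
        rw [Set.uIoc_of_le (by linarith)] at hx'
        exact hx x hx')
    rw [← h1, Real.norm_eq_abs, sub_sub_cancel, abs_of_pos hh] at h2
    have h3 : (h ^ 2)⁻¹ * (A h y - B h y) - c = (h ^ 2)⁻¹ * (A h y - B h y - c * h ^ 2) := by
      field_simp
    rw [h3, abs_mul, abs_of_pos (by positivity), inv_mul_le_iff₀ (by positivity)]
    linarith
  have hDbound : ∀ m y, ‖D m y‖ ≤ K y := by
    intro m y
    have := hest (u m) y 0 (K y) (hu m) (fun x hx => by
      have h1 := hlip x (x - u m) y hx.2 (by linarith [hx.2, hu m])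
      rw [sub_sub_cancel, abs_of_pos (hu m)] at h1
      simpa using h1)
    rw [sub_zero] at this
    exact this
  have hDlim : ∀ y, Tendsto (fun m => D m y) atTop (𝓝 ((Set.Ioi 0).indicator q y)) := by
    intro y
    rcases le_or_gt y 0 with hy | hy
    · rw [Set.indicator_of_notMem (by simpa using hy)]
      refine tendsto_const_nhds.congr fun m => ?_
      have := hest (u m) y 0 0 (hu m) (fun x hx => by
        rw [hg0 x (hx.2.trans hy), hg0 (x - u m) (by linarith [hx.2, hu m])]; simp)
      rw [sub_zero] at this
      exact (abs_nonpos_iff.1 this).symm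
    · rw [Set.indicator_of_mem (by simpa using hy), Metric.tendsto_nhds]
      intro ε hε
      obtain ⟨δ, hδ, hδq⟩ := Metric.continuous_iff.1 hq y (ε / 2) (by positivity)
      filter_upwards [hu0.eventually (gt_mem_nhds (show 0 < min (δ / 2) (y / 2) by positivity))]
        with m hm
      have hm1 := hm.trans_le (min_le_left _ _)
      have hm2 := hm.trans_le (min_le_right _ _)
      refine lt_of_le_of_lt (hest (u m) y (q y) (ε / 2) (hu m) fun x hx => ?_) (by linarith)
      have hx1 := hx.1
      have hx2 := hx.2
      have hum := hu m
      have hgx : g x = Q x := by simp only [g]; rw [max_eq_left (by linarith)]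
      have hgx' : g (x - u m) = Q (x - u m) := by simp only [g]; rw [max_eq_left (by linarith)]
      have hmv := (convex_Icc (x - u m) x).norm_image_sub_le_of_norm_hasDerivWithin_le
        (f := fun z => Q z - q y * z) (f' := fun z => q z - q y) (C := ε / 2)
        (x := x - u m) (y := x)
        (fun z _ => by
          have := ((hQ z).sub ((hasDerivAt_id z).const_mul (q y))).hasDerivWithinAt
            (s := Set.Icc (x - u m) x)
          rw [mul_one] at this
          exact this)
        (fun z hz => by
          have := hδq z (by
            rw [Real.dist_eq, abs_lt]
            constructor <;> linarith [hz.1, hz.2])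
          rw [Real.dist_eq] at this
          exact this.le)
        ⟨le_rfl, by linarith⟩ ⟨by linarith, le_rfl⟩
      rw [Real.norm_eq_abs, Real.norm_eq_abs, sub_sub_cancel, abs_of_pos hum] at hmv
      rw [hgx, hgx']
      convert hmv using 2
      ring
  have hlim := tendsto_integral_of_dominated_convergence (μ := ν) (F := D) K
    (fun m => (((hAc _).sub (hBc _)).const_mul _).aestronglyMeasurable) hKint
    (fun m => ae_of_all _ (hDbound m)) (ae_of_all _ hDlim)
  rw [integral_indicator measurableSet_Ioi] at hlim
  refine ge_of_tendsto hlim (Eventually.of_forall fun m => ?_)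
  simp only [D]
  rw [integral_const_mul, integral_sub (hAi _ (hu m)) (hBi _ (hu m))]
  exact mul_nonneg (by positivity) (sub_nonneg.2 (hle _ (hu m)))

/-- The octic is the derivative of `y * (y ^ 4 - 8 * y ^ 2 + 14) ^ 2`. Differentiation multiplies
the coefficient of `y ^ (2j)` in the square by `2j + 1`, so this tests positivity of the sequence
`(2j + 1) * m_{2j}`. -/
theorem IsUnimodalSymmetric.integral_octic_nonneg {ν : Measure ℝ} [IsProbabilityMeasure ν]
    (hν : IsUnimodalSymmetric ν) (hInt : ∀ k : ℕ, Integrable (fun x : ℝ => x ^ k) ν) :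
    0 ≤ ∫ y, (9 * y ^ 8 - 112 * y ^ 6 + 460 * y ^ 4 - 672 * y ^ 2 + 196) ∂ν := by
  let q : ℝ → ℝ := fun y => 9 * y ^ 8 - 112 * y ^ 6 + 460 * y ^ 4 - 672 * y ^ 2 + 196
  let K : ℝ → ℝ := fun y => 9 * y ^ 8 + 112 * y ^ 6 + 460 * y ^ 4 + 672 * y ^ 2 + 196
  have hq : Integrable q ν :=
    (((((hInt 8).const_mul 9).sub ((hInt 6).const_mul 112)).add ((hInt 4).const_mul 460)).sub
      ((hInt 2).const_mul 672)).add (integrable_const 196)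
  have hKi : Integrable K ν :=
    (((((hInt 8).const_mul 9).add ((hInt 6).const_mul 112)).add ((hInt 4).const_mul 460)).add
      ((hInt 2).const_mul 672)).add (integrable_const 196)
  have hKi' : Integrable (fun y => |y| * K y) ν := by
    have h1 : Integrable (fun y : ℝ => y * K y) ν := by
      have := (((((hInt 9).const_mul 9).add ((hInt 7).const_mul 112)).add
        ((hInt 5).const_mul 460)).add ((hInt 3).const_mul 672)).add ((hInt 1).const_mul 196)
      refine this.congr (ae_of_all _ fun y => ?_)
      simp only [Pi.add_apply, K]
      ring
    refine h1.abs.congr (ae_of_all _ fun y => ?_)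
    simp only [abs_mul]
    rw [abs_of_nonneg (show 0 ≤ K y by positivity)]
  have hpos : 0 ≤ ∫ y in Set.Ioi 0, q y ∂ν := by
    refine hν.setIntegral_deriv_nonneg (Q := fun y => y * (y ^ 4 - 8 * y ^ 2 + 14) ^ 2) (K := K)
      (fun x => ?_) (by simp) (fun x hx => by positivity) (by fun_prop) (fun x y hxy => ?_) hKi hKi'
    · have h1 := (hasDerivAt_id x).mul (((((hasDerivAt_id x).pow 4).sub
        (((hasDerivAt_id x).pow 2).const_mul 8)).add_const 14).pow 2)
      refine h1.congr_deriv ?_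
      simp only [q, id, Pi.pow_apply, Pi.sub_apply]
      push_cast
      ring
    · have h2 : x ^ 2 ≤ y ^ 2 := sq_le_sq.2 hxy
      have e4 : x ^ 4 ≤ y ^ 4 := by nlinarith [sq_nonneg x, sq_nonneg y]
      have e6 : x ^ 6 ≤ y ^ 6 := by
        calc x ^ 6 = (x ^ 2) ^ 3 := by ring
          _ ≤ (y ^ 2) ^ 3 := pow_le_pow_left₀ (sq_nonneg x) h2 3
          _ = y ^ 6 := by ring
      have e8 : x ^ 8 ≤ y ^ 8 := by
        calc x ^ 8 = (x ^ 2) ^ 4 := by ring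
          _ ≤ (y ^ 2) ^ 4 := pow_le_pow_left₀ (sq_nonneg x) h2 4
          _ = y ^ 8 := by ring
      have p2 : 0 ≤ x ^ 2 := by positivity
      have p4 : 0 ≤ x ^ 4 := by positivity
      have p6 : 0 ≤ x ^ 6 := by positivity
      have p8 : 0 ≤ x ^ 8 := by positivity
      simp only [q, K]
      rw [abs_le]
      constructor <;> linarith
  have hI : Integrable ((Set.Ioi 0).indicator q) ν := hq.indicator measurableSet_Ioi
  have hneg : MeasurePreserving (fun x : ℝ => -x) ν ν := ⟨measurable_neg, hν.1⟩
  have hI' : Integrable (fun y => (Set.Ioi 0).indicator q (-y)) ν :=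
    hneg.integrable_comp_of_integrable hI
  have hemb : MeasurableEmbedding fun x : ℝ => -x := (MeasurableEquiv.neg ℝ).measurableEmbedding
  rw [← integral_indicator measurableSet_Ioi] at hpos
  have hpos' : 0 ≤ ∫ y, (Set.Ioi 0).indicator q (-y) ∂ν := by
    rwa [hneg.integral_comp hemb]
  -- The octic is even, so by symmetry the negative half line contributes the same amount as the
  -- positive one.
  refine (add_nonneg hpos hpos').trans ?_
  rw [← integral_add hI hI']
  refine integral_mono (hI.add hI') hq fun y => ?_
  simp only [Set.indicator, Set.mem_Ioi, Left.neg_pos_iff]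
  rcases lt_trichotomy y 0 with hy | hy | hy
  · rw [if_neg hy.le.not_gt, if_pos hy, zero_add]
    simp only [q]
    apply le_of_eq
    ring
  -- Unimodality allows an atom at `0`; it does no harm because the octic equals `196` there.
  · subst hy
    simp [q]
  · rw [if_pos hy, if_neg hy.le.not_gt, add_zero]

/-! ### Symmetries of the matching volumes -/

/-- The matching obtained by rotating the cyclic word by one letter, which exchanges the two
classes of letters. -/
def Equiv.Perm.rotateMatching {k : ℕ} (σ : Equiv.Perm (Fin (k + 1))) : Equiv.Perm (Fin (k + 1)) :=
  σ⁻¹.trans (Equiv.subRight 1)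

theorem matchCount_eq_card {k : ℕ} (σ : Equiv.Perm (Fin (k + 1))) (n : ℕ) :
    matchCount σ n = Nat.card {p : (Fin (k + 1) → Fin n) × (Fin (k + 1) → Fin n) //
      ∀ l, (p.1 l : ℕ) + p.2 l = p.2 (σ l) + p.1 (σ l + 1)} := by
  rw [matchCount]
  refine Nat.card_congr (Equiv.subtypeEquivRight fun p => forall_congr' fun l => ?_)
  simp [bipartiteWord]

/-- Reading the same closed walk from `b₀` instead of `a₀` is a bijection between the two sets of
matched walks. -/
theorem matchCount_rotateMatching {k : ℕ} (σ : Equiv.Perm (Fin (k + 1))) (n : ℕ) :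
    matchCount σ.rotateMatching n = matchCount σ n := by
  rw [matchCount_eq_card, matchCount_eq_card]
  symm
  refine Nat.card_congr (Equiv.subtypeEquiv
    { toFun := fun p => (p.2, fun l => p.1 (l + 1))
      invFun := fun q => (fun l => q.2 (l - 1), q.1)
      left_inv := fun p => by simp
      right_inv := fun q => by simp } fun p => ?_)
  refine Equiv.forall_congr σ fun l => ?_
  have hs : σ⁻¹ (σ l) = l := σ.symm_apply_apply l
  simp only [Equiv.Perm.rotateMatching, Equiv.coe_fn_mk, Equiv.trans_apply, hs,
    Equiv.subRight_apply, sub_add_cancel]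
  omega

theorem volume_matchPolytope_rotateMatching {k : ℕ} (σ : Equiv.Perm (Fin (k + 1))) :
    volume.real (matchPolytope σ.rotateMatching) = volume.real (matchPolytope σ) := by
  refine tendsto_nhds_unique (tendsto_matchCount_div σ.rotateMatching) ?_
  simp_rw [matchCount_rotateMatching]
  exact tendsto_matchCount_div σ

/-- Removing a matched pair of adjacent letters frees one index. -/
theorem matchCount_eq_mul_of_castSucc {k : ℕ} {σ : Equiv.Perm (Fin (k + 2))}
    {τ : Equiv.Perm (Fin (k + 1))} (hl : σ (Fin.last _) = Fin.last _)
    (h : ∀ l : Fin (k + 1), σ l.castSucc = (τ l).castSucc) (n : ℕ) :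
    matchCount σ n = n * matchCount τ n := by
  -- Matching the last two letters with each other means exactly `a (Fin.last _) = a 0`. The
  -- shortened cycle then closes up correctly, and the last `b` is unconstrained.
  have hstep : ∀ (a : Fin (k + 2) → Fin n), a (Fin.last _) = a 0 → ∀ j : Fin (k + 1),
      a (j.castSucc + 1) = a (j + 1).castSucc := by
    intro a ha j
    rcases eq_or_ne j (Fin.last _) with rfl | hj
    · rw [Fin.last_add_one, Fin.castSucc_zero, ← ha]
      congr 1
      rw [Fin.coeSucc_eq_succ, Fin.succ_last]
    · congr 1
      rw [Fin.coeSucc_eq_succ]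
      ext
      rw [Fin.val_succ, Fin.val_castSucc, Fin.val_add_one_of_lt (Fin.lt_last_iff_ne_last.2 hj)]
  have hsys : ∀ p : (Fin (k + 2) → Fin n) × (Fin (k + 2) → Fin n),
      (∀ l, (p.1 l : ℕ) + p.2 l = p.2 (σ l) + p.1 (σ l + 1)) ↔
      p.1 (Fin.last _) = p.1 0 ∧ ∀ l : Fin (k + 1), (p.1 l.castSucc : ℕ) + p.2 l.castSucc =
        p.2 (τ l).castSucc + p.1 (τ l + 1).castSucc := by
    intro p
    rw [Fin.forall_fin_succ', and_comm, hl, Fin.last_add_one]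
    have h0 : ((p.1 (Fin.last _) : ℕ) + p.2 (Fin.last _) = p.2 (Fin.last _) + p.1 0) ↔
        p.1 (Fin.last _) = p.1 0 := by
      rw [Fin.ext_iff]
      omega
    rw [h0]
    refine and_congr_right fun h2 => forall_congr' fun l => ?_
    rw [h, hstep _ h2]
  rw [matchCount_eq_card, matchCount_eq_card, ← Nat.card_fin n, ← Nat.card_prod, Nat.card_fin n]
  refine Nat.card_congr
    { toFun := fun p => (p.1.2 (Fin.last _), ⟨(fun l => p.1.1 l.castSucc,
        fun l => p.1.2 l.castSucc), ((hsys p.1).1 p.2).2⟩)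
      invFun := fun q => ⟨(Fin.snoc q.2.1.1 (q.2.1.1 0), Fin.snoc q.2.1.2 q.1),
        (hsys _).2 ⟨?_, ?_⟩⟩
      left_inv := ?_
      right_inv := ?_ }
  · change Fin.snoc (α := fun _ => Fin n) q.2.1.1 (q.2.1.1 0) (Fin.last _) =
      Fin.snoc (α := fun _ => Fin n) q.2.1.1 (q.2.1.1 0) (Fin.castSucc 0)
    rw [Fin.snoc_last, Fin.snoc_castSucc]
  · intro l
    simp only [Fin.snoc_castSucc]
    exact q.2.2 l
  · rintro ⟨⟨a, b⟩, hp⟩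
    have ha := ((hsys (a, b)).1 hp).1
    ext l
    · refine Fin.lastCases ?_ (fun i => ?_) l
      · simp only [Fin.snoc_last, Fin.castSucc_zero]
        exact congrArg _ ha.symm
      · simp
    · refine Fin.lastCases ?_ (fun i => ?_) l <;> simp
  · rintro ⟨z, ⟨⟨a, b⟩, hq⟩⟩
    simp

theorem volume_matchPolytope_of_castSucc {k : ℕ} {σ : Equiv.Perm (Fin (k + 2))}
    {τ : Equiv.Perm (Fin (k + 1))} (hl : σ (Fin.last _) = Fin.last _)
    (h : ∀ l : Fin (k + 1), σ l.castSucc = (τ l).castSucc) :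
    volume.real (matchPolytope σ) = volume.real (matchPolytope τ) := by
  refine tendsto_nhds_unique (tendsto_matchCount_div σ) ((tendsto_matchCount_div τ).congr' ?_)
  filter_upwards [eventually_gt_atTop 0] with n hn
  rw [matchCount_eq_mul_of_castSucc hl h]
  push_cast
  field_simp
  ring

theorem volume_matchPolytope_fin_one :
    volume.real (matchPolytope (1 : Equiv.Perm (Fin 1))) = 1 := by
  refine tendsto_nhds_unique (tendsto_matchCount_div _) (tendsto_const_nhds.congr' ?_)
  filter_upwards [eventually_gt_atTop 0] with n hn
  have : matchCount (1 : Equiv.Perm (Fin 1)) n = n ^ 2 := by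
    rw [matchCount_eq_card]
    have h1 : ∀ p : (Fin 1 → Fin n) × (Fin 1 → Fin n), ∀ l : Fin 1, (p.1 l : ℕ) + p.2 l =
        p.2 ((1 : Equiv.Perm (Fin 1)) l) + p.1 ((1 : Equiv.Perm (Fin 1)) l + 1) := by
      intro p l
      rw [Subsingleton.elim (_ + 1) l, Subsingleton.elim ((1 : Equiv.Perm (Fin 1)) l) l, add_comm]
    rw [Nat.card_congr (Equiv.subtypeUnivEquiv h1)]
    simp [sq]
  rw [this]
  push_cast
  rw [div_self (by positivity)]

/-! ### Exact counts for the cyclic matchings on three and four objects -/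

/-- The base points `z` for which the parallelogram with corners `z`, `z + d`, `z + e`,
`z + d + e` lies in `[0, n)`. -/
noncomputable def overlapPoints (n : ℕ) (d e : ℤ) : Finset ℤ :=
  (Finset.Ico (0 : ℤ) n).filter fun z => (0 ≤ z + d ∧ z + d < n) ∧ (0 ≤ z + e ∧ z + e < n) ∧
    (0 ≤ z + d + e ∧ z + d + e < n)

theorem mem_overlapPoints {n : ℕ} {d e z : ℤ} : z ∈ overlapPoints n d e ↔ (0 ≤ z ∧ z < n) ∧
    (0 ≤ z + d ∧ z + d < n) ∧ (0 ≤ z + e ∧ z + e < n) ∧ (0 ≤ z + d + e ∧ z + d + e < n) := by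
  simp [overlapPoints]

/-- The admissible base points form an interval. Truncated subtraction accounts for the case where
it is empty. -/
theorem card_overlapPoints (n : ℕ) (d e : ℤ) :
    (overlapPoints n d e).card = n - d.natAbs - e.natAbs := by
  have h : overlapPoints n d e = Finset.Ico (max 0 (-d) + max 0 (-e)) (n - max 0 d - max 0 e) := by
    ext z
    rw [mem_overlapPoints, Finset.mem_Ico]
    omega
  rw [h, Int.card_Ico]
  omega

/-- The equations say that `b₁ - a₀`, `b₂ - a₁` and `b₀ - a₂` have a common value `d`; given `d`,
the three `a`'s are chosen independently. -/
theorem matchCount_finRotate_three (n : ℕ) : matchCount (finRotate 3) n =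
    ∑ d ∈ Finset.Ioo (-n : ℤ) n, (n - d.natAbs) ^ 3 := by
  let T : Finset (Σ _ : ℤ, ℤ × ℤ × ℤ) := (Finset.Ioo (-n : ℤ) n).sigma fun d =>
    overlapPoints n d 0 ×ˢ overlapPoints n d 0 ×ˢ overlapPoints n d 0
  have hT : T.card = ∑ d ∈ Finset.Ioo (-n : ℤ) n, (n - d.natAbs) ^ 3 := by
    simp only [T, Finset.card_sigma, Finset.card_product, card_overlapPoints]
    refine Finset.sum_congr rfl fun d _ => ?_
    rw [Int.natAbs_zero, Nat.sub_zero]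
    ring
  have hsys : ∀ p : (Fin 3 → Fin n) × (Fin 3 → Fin n),
      (∀ l, (p.1 l : ℕ) + p.2 l = p.2 (finRotate 3 l) + p.1 (finRotate 3 l + 1)) ↔
      (p.1 0 : ℕ) + p.2 0 = p.2 1 + p.1 2 ∧ (p.1 1 : ℕ) + p.2 1 = p.2 2 + p.1 0 ∧
      (p.1 2 : ℕ) + p.2 2 = p.2 0 + p.1 1 := by
    intro p
    have e0 : finRotate 3 0 = 1 := by decide
    have e1 : finRotate 3 1 = 2 := by decide
    have e2 : finRotate 3 2 = 0 := by decide
    rw [Fin.forall_fin_succ, Fin.forall_fin_two]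
    change (_ = (p.2 (finRotate 3 0) : ℕ) + p.1 (finRotate 3 0 + 1)) ∧
      (_ = (p.2 (finRotate 3 1) : ℕ) + p.1 (finRotate 3 1 + 1)) ∧
      (_ = (p.2 (finRotate 3 2) : ℕ) + p.1 (finRotate 3 2 + 1)) ↔ _
    rw [e0, e1, e2]
    rfl
  rw [matchCount_eq_card, ← hT, ← Nat.card_eq_finsetCard]
  refine Nat.card_eq_of_bijective (fun p => ⟨⟨(p.1.2 1 : ℤ) - p.1.1 0,
    ((p.1.1 0 : ℤ), (p.1.1 1 : ℤ), (p.1.1 2 : ℤ))⟩, ?_⟩) ⟨?_, ?_⟩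
  · obtain ⟨h0, h1, h2⟩ := (hsys p.1).1 p.2
    simp only [T, Finset.mem_sigma, Finset.mem_Ioo, Finset.mem_product, mem_overlapPoints]
    omega
  · rintro ⟨⟨a, b⟩, hp⟩ ⟨⟨a', b'⟩, hp'⟩ heq
    obtain ⟨h0, h1, h2⟩ := (hsys _).1 hp
    obtain ⟨h0', h1', h2'⟩ := (hsys _).1 hp'
    simp only [Subtype.mk.injEq, Sigma.mk.injEq, heq_eq_eq, Prod.mk.injEq]
      at heq h0 h1 h2 h0' h1' h2'
    obtain ⟨g1, g2, g3, g4⟩ := heq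
    ext l
    · fin_cases l <;> simp <;> omega
    · fin_cases l <;> simp <;> omega
  · rintro ⟨⟨d, x, y, z⟩, ht⟩
    simp only [T, Finset.mem_sigma, Finset.mem_Ioo, Finset.mem_product, mem_overlapPoints] at ht
    refine ⟨⟨(![⟨x.toNat, by omega⟩, ⟨y.toNat, by omega⟩, ⟨z.toNat, by omega⟩],
      ![⟨(z + d).toNat, by omega⟩, ⟨(x + d).toNat, by omega⟩, ⟨(y + d).toNat, by omega⟩]),
      (hsys _).2 ?_⟩, ?_⟩
    · simp
      omega
    · simp
      omega

/-- With `d = a₀ - a₂` and `e = a₁ - a₃`, the equations place `b₀, b₁, b₂, b₃` at `b₀`, `b₀ + d`,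
`b₀ + d + e`, `b₀ + e`. The base points `a₂`, `a₃` and `b₀` are then chosen independently. -/
theorem matchCount_finRotate_four (n : ℕ) : matchCount (finRotate 4) n =
    ∑ d ∈ Finset.Ioo (-n : ℤ) n, ∑ e ∈ Finset.Ioo (-n : ℤ) n,
      (n - d.natAbs) * ((n - e.natAbs) * (n - d.natAbs - e.natAbs)) := by
  let T : Finset (Σ _ : ℤ × ℤ, ℤ × ℤ × ℤ) :=
    (Finset.Ioo (-n : ℤ) n ×ˢ Finset.Ioo (-n : ℤ) n).sigma fun q =>
    overlapPoints n q.1 0 ×ˢ overlapPoints n q.2 0 ×ˢ overlapPoints n q.1 q.2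
  have hT : T.card = ∑ d ∈ Finset.Ioo (-n : ℤ) n, ∑ e ∈ Finset.Ioo (-n : ℤ) n,
      (n - d.natAbs) * ((n - e.natAbs) * (n - d.natAbs - e.natAbs)) := by
    simp only [T, Finset.card_sigma, Finset.card_product, card_overlapPoints,
      Int.natAbs_zero, Nat.sub_zero]
    rw [Finset.sum_product]
  have hsys : ∀ p : (Fin 4 → Fin n) × (Fin 4 → Fin n),
      (∀ l, (p.1 l : ℕ) + p.2 l = p.2 (finRotate 4 l) + p.1 (finRotate 4 l + 1)) ↔
      (p.1 0 : ℕ) + p.2 0 = p.2 1 + p.1 2 ∧ (p.1 1 : ℕ) + p.2 1 = p.2 2 + p.1 3 ∧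
      (p.1 2 : ℕ) + p.2 2 = p.2 3 + p.1 0 ∧ (p.1 3 : ℕ) + p.2 3 = p.2 0 + p.1 1 := by
    intro p
    have e0 : finRotate 4 0 = 1 := by decide
    have e1 : finRotate 4 1 = 2 := by decide
    have e2 : finRotate 4 2 = 3 := by decide
    have e3 : finRotate 4 3 = 0 := by decide
    rw [Fin.forall_fin_succ, Fin.forall_fin_succ, Fin.forall_fin_two]
    change (_ = (p.2 (finRotate 4 0) : ℕ) + p.1 (finRotate 4 0 + 1)) ∧
      (_ = (p.2 (finRotate 4 1) : ℕ) + p.1 (finRotate 4 1 + 1)) ∧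
      (_ = (p.2 (finRotate 4 2) : ℕ) + p.1 (finRotate 4 2 + 1)) ∧
      (_ = (p.2 (finRotate 4 3) : ℕ) + p.1 (finRotate 4 3 + 1)) ↔ _
    rw [e0, e1, e2, e3]
    rfl
  rw [matchCount_eq_card, ← hT, ← Nat.card_eq_finsetCard]
  refine Nat.card_eq_of_bijective (fun p => ⟨⟨((p.1.1 0 : ℤ) - p.1.1 2, (p.1.1 1 : ℤ) - p.1.1 3),
    ((p.1.1 2 : ℤ), (p.1.1 3 : ℤ), (p.1.2 0 : ℤ))⟩, ?_⟩) ⟨?_, ?_⟩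
  · obtain ⟨h0, h1, h2, h3⟩ := (hsys p.1).1 p.2
    simp only [T, Finset.mem_sigma, Finset.mem_Ioo, Finset.mem_product, mem_overlapPoints]
    omega
  · rintro ⟨⟨a, b⟩, hp⟩ ⟨⟨a', b'⟩, hp'⟩ heq
    obtain ⟨h0, h1, h2, h3⟩ := (hsys _).1 hp
    obtain ⟨h0', h1', h2', h3'⟩ := (hsys _).1 hp'
    simp only [Subtype.mk.injEq, Sigma.mk.injEq, heq_eq_eq, Prod.mk.injEq]
      at heq h0 h1 h2 h3 h0' h1' h2' h3'
    obtain ⟨⟨g1, g2⟩, g3, g4, g5⟩ := heq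
    ext l
    · fin_cases l <;> simp <;> omega
    · fin_cases l <;> simp <;> omega
  · rintro ⟨⟨⟨d, e⟩, x, y, z⟩, ht⟩
    simp only [T, Finset.mem_sigma, Finset.mem_Ioo, Finset.mem_product, mem_overlapPoints] at ht
    refine ⟨⟨(![⟨(x + d).toNat, by omega⟩, ⟨(y + e).toNat, by omega⟩, ⟨x.toNat, by omega⟩,
        ⟨y.toNat, by omega⟩],
      ![⟨z.toNat, by omega⟩, ⟨(z + d).toNat, by omega⟩, ⟨(z + d + e).toNat, by omega⟩,
        ⟨(z + e).toNat, by omega⟩]), (hsys _).2 ?_⟩, ?_⟩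
    · simp
      omega
    · simp
      omega

theorem sum_Ioo_natAbs (N : ℕ) (f : ℕ → ℝ) :
    ∑ d ∈ Finset.Ioo (-(N + 1 : ℕ) : ℤ) (N + 1 : ℕ), f d.natAbs =
      f 0 + 2 * ∑ j ∈ Finset.range N, f (j + 1) := by
  induction N with
  | zero =>
    have : Finset.Ioo (-(0 + 1 : ℕ) : ℤ) (0 + 1 : ℕ) = {0} := by decide
    rw [this]
    simp
  | succ N ih =>
    have h : Finset.Ioo (-(N + 1 + 1 : ℕ) : ℤ) (N + 1 + 1 : ℕ) =
        insert ((N + 1 : ℕ) : ℤ) (insert (-(N + 1 : ℕ) : ℤ)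
          (Finset.Ioo (-(N + 1 : ℕ) : ℤ) (N + 1 : ℕ))) := by
      ext z
      simp only [Finset.mem_insert, Finset.mem_Ioo]
      omega
    rw [h, Finset.sum_insert (by simp; omega), Finset.sum_insert (by simp), ih,
      Finset.sum_range_succ, Int.natAbs_neg, Int.natAbs_natCast]
    ring

theorem matchCount_finRotate_three_eq (N : ℕ) : (matchCount (finRotate 3) (N + 1) : ℝ) =
    (((N + 1 : ℕ) : ℝ) ^ 4 + ((N + 1 : ℕ) : ℝ) ^ 2) / 2 := by
  rw [matchCount_finRotate_three, Nat.cast_sum,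
    sum_Ioo_natAbs N (fun j => (((N + 1 - j) ^ 3 : ℕ) : ℝ))]
  -- Cubes summed downwards from `N ^ 3`: a difference of squared triangular numbers.
  have h : ∀ M ≤ N, ∑ j ∈ Finset.range M, (((N + 1 - (j + 1)) ^ 3 : ℕ) : ℝ) =
      ((N : ℝ) * (N + 1) / 2) ^ 2 - (((N : ℝ) - M) * (N - M + 1) / 2) ^ 2 := by
    intro M hM
    induction M with
    | zero => simp
    | succ M ih =>
      rw [Finset.sum_range_succ, ih (by omega), Nat.add_sub_add_right, Nat.cast_pow,
        Nat.cast_sub (by omega)]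
      push_cast
      ring
  rw [h N le_rfl]
  push_cast
  ring

theorem matchCount_finRotate_four_eq (N : ℕ) : (matchCount (finRotate 4) (N + 1) : ℝ) =
    (11 * ((N + 1 : ℕ) : ℝ) ^ 5 + 15 * ((N + 1 : ℕ) : ℝ) ^ 3 + 4 * ((N + 1 : ℕ) : ℝ)) / 30 := by
  -- Closed form of the inner sum over `e`, at `y = N - |d|`. Terms with `|e| > y` vanish by
  -- truncation, so that sum is polynomial in `y`.
  let J : ℝ → ℝ := fun y => ((N : ℝ) + 1) * (y + 1) +
    2 * (y ^ 2 * N - (N + y) * y * (y - 1) / 2 + (y - 1) * y * (2 * y - 1) / 6)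
  have hinner : ∀ y ≤ N, ∑ e ∈ Finset.Ioo (-(N + 1 : ℕ) : ℤ) (N + 1 : ℕ),
      (((N + 1 - e.natAbs) * (y + 1 - e.natAbs) : ℕ) : ℝ) = J y := by
    intro y hy
    rw [sum_Ioo_natAbs N (fun j => (((N + 1 - j) * (y + 1 - j) : ℕ) : ℝ))]
    have h1 : ∑ j ∈ Finset.range N, (((N + 1 - (j + 1)) * (y + 1 - (j + 1)) : ℕ) : ℝ) =
        ∑ j ∈ Finset.range y, (((N + 1 - (j + 1)) * (y + 1 - (j + 1)) : ℕ) : ℝ) := by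
      symm
      refine Finset.sum_subset (Finset.range_mono hy) fun j _ hj => ?_
      rw [Finset.mem_range, not_lt] at hj
      rw [Nat.add_sub_add_right, Nat.add_sub_add_right, Nat.sub_eq_zero_of_le hj]
      simp
    have h2 : ∀ M ≤ y, ∑ j ∈ Finset.range M, (((N + 1 - (j + 1)) * (y + 1 - (j + 1)) : ℕ) : ℝ) =
        M * (N : ℝ) * y - (N + y) * M * (M - 1) / 2 + (M - 1) * M * (2 * M - 1) / 6 := by
      intro M hM
      induction M with
      | zero => simp
      | succ M ih =>
        rw [Finset.sum_range_succ, ih (by omega), Nat.add_sub_add_right, Nat.add_sub_add_right,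
          Nat.cast_mul, Nat.cast_sub (by omega), Nat.cast_sub (by omega)]
        push_cast
        ring
    rw [h1, h2 y le_rfl]
    simp only [J]
    push_cast
    ring
  have houter : (matchCount (finRotate 4) (N + 1) : ℝ) =
      ∑ d ∈ Finset.Ioo (-(N + 1 : ℕ) : ℤ) (N + 1 : ℕ),
        ((N + 1 - d.natAbs : ℕ) : ℝ) * J ((N - d.natAbs : ℕ) : ℝ) := by
    rw [matchCount_finRotate_four, Nat.cast_sum]
    refine Finset.sum_congr rfl fun d hd => ?_
    rw [Finset.mem_Ioo] at hd
    rw [← hinner _ (Nat.sub_le _ _), Nat.cast_sum, Finset.mul_sum]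
    refine Finset.sum_congr rfl fun e _ => ?_
    have : N + 1 - d.natAbs = N - d.natAbs + 1 := by omega
    rw [Nat.cast_mul, this]
  have hsum : ∑ j ∈ Finset.range N, ((N + 1 - (j + 1) : ℕ) : ℝ) * J ((N - (j + 1) : ℕ) : ℝ) =
      ∑ y ∈ Finset.range N, ((y : ℝ) + 1) * J y := by
    rw [← Finset.sum_range_reflect]
    refine Finset.sum_congr rfl fun j hj => ?_
    rw [Finset.mem_range] at hj
    have e1 : N + 1 - (N - 1 - j + 1) = j + 1 := by omega
    have e2 : N - (N - 1 - j + 1) = j := by omega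
    rw [e1, e2]
    push_cast
    ring
  have hclosed : ∀ M : ℕ, ∑ y ∈ Finset.range M, ((y : ℝ) + 1) * J y =
      (M : ℝ) / 15 + 5 * M ^ 2 / 12 + M ^ 3 / 2 + M ^ 4 / 12 - M ^ 5 / 15 +
        N * (M ^ 2 / 4 + M ^ 3 / 2 + M ^ 4 / 4) := by
    intro M
    induction M with
    | zero => simp
    | succ M ih =>
      rw [Finset.sum_range_succ, ih]
      simp only [J]
      push_cast
      ring
  rw [houter, sum_Ioo_natAbs N (fun j => ((N + 1 - j : ℕ) : ℝ) * J ((N - j : ℕ) : ℝ)), hsum,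
    hclosed]
  simp only [J, Nat.sub_zero]
  push_cast
  ring

theorem volume_matchPolytope_finRotate_three :
    volume.real (matchPolytope (finRotate 3)) = 1 / 2 := by
  refine tendsto_nhds_unique (tendsto_matchCount_div _) ?_
  have hinv : Tendsto (fun n : ℕ => (n : ℝ)⁻¹) atTop (𝓝 0) := tendsto_inv_atTop_nhds_zero_nat
  have h : Tendsto (fun n : ℕ => (1 : ℝ) / 2 + (n : ℝ)⁻¹ ^ 2 / 2) atTop (𝓝 (1 / 2 + 0 ^ 2 / 2)) :=
    tendsto_const_nhds.add ((hinv.pow 2).div_const 2)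
  rw [zero_pow two_ne_zero, zero_div, add_zero] at h
  refine h.congr' ?_
  filter_upwards [eventually_gt_atTop 0] with n hn
  obtain ⟨N, rfl⟩ := Nat.exists_eq_succ_of_ne_zero hn.ne'
  rw [Nat.succ_eq_add_one, matchCount_finRotate_three_eq]
  have : ((N + 1 : ℕ) : ℝ) ≠ 0 := by positivity
  field_simp

theorem volume_matchPolytope_finRotate_four :
    volume.real (matchPolytope (finRotate 4)) = 11 / 30 := by
  refine tendsto_nhds_unique (tendsto_matchCount_div _) ?_
  have hinv : Tendsto (fun n : ℕ => (n : ℝ)⁻¹) atTop (𝓝 0) := tendsto_inv_atTop_nhds_zero_nat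
  have h : Tendsto (fun n : ℕ => (11 : ℝ) / 30 + ((n : ℝ)⁻¹ ^ 2 / 2 + (n : ℝ)⁻¹ ^ 4 * (2 / 15)))
      atTop (𝓝 (11 / 30 + (0 ^ 2 / 2 + 0 ^ 4 * (2 / 15)))) :=
    tendsto_const_nhds.add (((hinv.pow 2).div_const 2).add ((hinv.pow 4).mul_const _))
  rw [zero_pow two_ne_zero, zero_div, zero_pow four_ne_zero, zero_mul, add_zero, add_zero] at h
  refine h.congr' ?_
  filter_upwards [eventually_gt_atTop 0] with n hn
  obtain ⟨N, rfl⟩ := Nat.exists_eq_succ_of_ne_zero hn.ne'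
  rw [Nat.succ_eq_add_one, matchCount_finRotate_four_eq]
  have : ((N + 1 : ℕ) : ℝ) ≠ 0 := by positivity
  field_simp
  ring

/-! ### Orbit sums and the moments up to order eight -/

theorem volume_matchPolytope_iterate_rotateMatching {k : ℕ} (σ : Equiv.Perm (Fin (k + 1)))
    (i : ℕ) : volume.real (matchPolytope (Equiv.Perm.rotateMatching^[i] σ)) =
      volume.real (matchPolytope σ) := by
  induction i with
  | zero => rfl
  | succ i ih => rw [Function.iterate_succ_apply', volume_matchPolytope_rotateMatching, ih]

/-- If the matchings are enumerated by orbits of the rotation, the sum of the volumes is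
the sum over representatives weighted by the sizes of the orbits. -/
theorem sum_volume_matchPolytope_of_orbits {k : ℕ} (L : List (ℕ × Equiv.Perm (Fin (k + 1))))
    (hL : (Finset.univ : Finset (Equiv.Perm (Fin (k + 1)))).val = ((L.flatMap fun q =>
      (List.range q.1).map fun i => Equiv.Perm.rotateMatching^[i] q.2 :
        List (Equiv.Perm (Fin (k + 1)))) : Multiset (Equiv.Perm (Fin (k + 1))))) :
    ∑ σ : Equiv.Perm (Fin (k + 1)), volume.real (matchPolytope σ) =
      (L.map fun q => (q.1 : ℝ) * volume.real (matchPolytope q.2)).sum := by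
  rw [Finset.sum, hL, Multiset.map_coe, Multiset.sum_coe, List.map_flatMap]
  clear hL
  induction L with
  | nil => simp
  | cons q L ih =>
    rw [List.flatMap_cons, List.sum_append, ih, List.map_cons, List.sum_cons, List.map_map]
    congr 1
    rw [List.map_congr_left (f := (fun σ => volume.real (matchPolytope σ)) ∘ fun i =>
      Equiv.Perm.rotateMatching^[i] q.2) (g := fun _ => volume.real (matchPolytope q.2))
      fun i _ => volume_matchPolytope_iterate_rotateMatching q.2 i]
    simp

theorem volume_matchPolytope_one (k : ℕ) :
    volume.real (matchPolytope (1 : Equiv.Perm (Fin (k + 1)))) = 1 := by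
  induction k with
  | zero => exact volume_matchPolytope_fin_one
  | succ k ih => rw [volume_matchPolytope_of_castSucc (τ := 1) rfl fun _ => rfl, ih]

theorem volume_matchPolytope_swap_zero_one_fin_three :
    volume.real (matchPolytope (Equiv.swap 0 1 : Equiv.Perm (Fin 3))) = 1 := by
  rw [volume_matchPolytope_of_castSucc (τ := (Equiv.swap 0 1 : Equiv.Perm (Fin 2)))
    (by decide) (by decide)]
  have h : (Equiv.swap 0 1 : Equiv.Perm (Fin 2)) = Equiv.Perm.rotateMatching 1 := by decide
  rw [h, volume_matchPolytope_rotateMatching, volume_matchPolytope_one]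

theorem hankelMoment_two : hankelMoment 2 = 1 := by
  have h := hankelMoment_even 0
  rw [show 2 * (0 + 1) = 2 from rfl, sum_volume_matchPolytope_of_orbits [(1, 1)] (by decide)] at h
  simp [h, volume_matchPolytope_one]

theorem hankelMoment_four : hankelMoment 4 = 2 := by
  have h := hankelMoment_even 1
  rw [show 2 * (1 + 1) = 4 from rfl, sum_volume_matchPolytope_of_orbits [(2, 1)] (by decide)] at h
  simp [h, volume_matchPolytope_one]

theorem hankelMoment_six : hankelMoment 6 = 11 / 2 := by
  have h := hankelMoment_even 2
  -- Orbit representatives with orbit sizes, `6 = 2 + 3 + 1`. Only the cyclic matching has volume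
  -- different from one, namely `1/2`.
  rw [show 2 * (2 + 1) = 6 from rfl, sum_volume_matchPolytope_of_orbits
    [(2, 1), (3, (Equiv.swap 0 1 : Equiv.Perm (Fin 3))), (1, finRotate 3)] (by decide)] at h
  simp only [List.map_cons, List.map_nil, List.sum_cons, List.sum_nil, volume_matchPolytope_one,
    volume_matchPolytope_swap_zero_one_fin_three, volume_matchPolytope_finRotate_three] at h
  rw [h]
  norm_num

set_option maxRecDepth 10000 in
theorem hankelMoment_eight : hankelMoment 8 = 281 / 15 := by
  have h := hankelMoment_even 3
  have h1 : volume.real (matchPolytope (Equiv.swap 0 1 : Equiv.Perm (Fin 4))) = 1 := by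
    rw [volume_matchPolytope_of_castSucc (τ := (Equiv.swap 0 1 : Equiv.Perm (Fin 3)))
      (by decide) (by decide), volume_matchPolytope_swap_zero_one_fin_three]
  have h2 : volume.real (matchPolytope (Equiv.swap 0 2 : Equiv.Perm (Fin 4))) = 1 := by
    have hr : (Equiv.swap 0 2 : Equiv.Perm (Fin 3)) =
      Equiv.Perm.rotateMatching^[2] (Equiv.swap 0 1) := by decide
    rw [volume_matchPolytope_of_castSucc (τ := (Equiv.swap 0 2 : Equiv.Perm (Fin 3)))
      (by decide) (by decide), hr, volume_matchPolytope_iterate_rotateMatching,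
      volume_matchPolytope_swap_zero_one_fin_three]
  have h3 : volume.real (matchPolytope
      (Equiv.swap 0 1 * Equiv.swap 1 2 : Equiv.Perm (Fin 4))) = 1 / 2 := by
    rw [volume_matchPolytope_of_castSucc (τ := finRotate 3) (by decide) (by decide),
      volume_matchPolytope_finRotate_three]
  -- The `24` permutations split as `2 + 8 + 4 + 8 + 2`, with volumes `1, 1, 1, 1/2, 11/30`.
  rw [show 2 * (3 + 1) = 8 from rfl, sum_volume_matchPolytope_of_orbits
    [(2, 1), (8, Equiv.swap 0 1), (4, Equiv.swap 0 2), (8, Equiv.swap 0 1 * Equiv.swap 1 2),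
      (2, finRotate 4)] (by decide)] at h
  simp only [List.map_cons, List.map_nil, List.sum_cons, List.sum_nil, volume_matchPolytope_one,
    h1, h2, h3, volume_matchPolytope_finRotate_four] at h
  rw [h]
  norm_num

/-! ### Failure of unimodality, and the theorem -/

theorem not_isUnimodalSymmetric_of_hankelMoment {γ : ProbabilityMeasure ℝ}
    (hγ : ∀ k : ℕ, Integrable (fun x : ℝ => x ^ k) (γ : Measure ℝ))
    (hγm : ∀ k : ℕ, ∫ x, x ^ k ∂(γ : Measure ℝ) = hankelMoment k) :
    ¬ IsUnimodalSymmetric (γ : Measure ℝ) := by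
  intro h
  have h1 := h.integral_octic_nonneg hγ
  have i8 : Integrable (fun y : ℝ => 9 * y ^ 8) (γ : Measure ℝ) := (hγ 8).const_mul _
  have i6 : Integrable (fun y : ℝ => 112 * y ^ 6) (γ : Measure ℝ) := (hγ 6).const_mul _
  have i4 : Integrable (fun y : ℝ => 460 * y ^ 4) (γ : Measure ℝ) := (hγ 4).const_mul _
  have i2 : Integrable (fun y : ℝ => 672 * y ^ 2) (γ : Measure ℝ) := (hγ 2).const_mul _
  have j1 : Integrable (fun y : ℝ => 9 * y ^ 8 - 112 * y ^ 6) (γ : Measure ℝ) := i8.sub i6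
  have j2 : Integrable (fun y : ℝ => 9 * y ^ 8 - 112 * y ^ 6 + 460 * y ^ 4) (γ : Measure ℝ) :=
    j1.add i4
  have j3 : Integrable (fun y : ℝ => 9 * y ^ 8 - 112 * y ^ 6 + 460 * y ^ 4 - 672 * y ^ 2)
    (γ : Measure ℝ) := j2.sub i2
  rw [integral_add j3 (integrable_const _), integral_sub j2 i2, integral_add j1 i4,
    integral_sub i8 i6] at h1
  simp only [integral_const_mul, hγm, hankelMoment_two, hankelMoment_four, hankelMoment_six,
    hankelMoment_eight, integral_const, probReal_univ, one_smul] at h1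
  -- With moments `1, 2, 11/2, 281/15` the integral of the octic is `-17/5`.
  norm_num at h1

theorem theorem1p2 :
    ∃ γ : ProbabilityMeasure ℝ,
      (∀ (Ω : Type*) [MeasurableSpace Ω] (P : Measure Ω) [IsProbabilityMeasure P]
          (X : ℕ → Ω → ℝ),
        (∀ k, Measurable (X k)) →
        iIndepFun X P →
        (∀ k, IdentDistrib (X k) (X 1) P P) →
        variance (X 1) P = 1 →
        ∀ᵐ ω ∂P, Tendsto (fun m : ℕ => hankelSpectralMeasure (fun k => X k ω) (m + 1))
          atTop (𝓝 γ)) ∧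
      IsSymmetricMeasure (γ : Measure ℝ) ∧
      ¬ Bornology.IsBounded (γ : Measure ℝ).support ∧
      ¬ IsUnimodalSymmetric (γ : Measure ℝ) ∧
      (∀ k : ℕ, Integrable (fun x : ℝ => x ^ k) (γ : Measure ℝ)) ∧
      ∫ x, x ^ 4 ∂(γ : Measure ℝ) = 2 ∧
      ∫ x, x ^ 6 ∂(γ : Measure ℝ) = 11 / 2 ∧
      ∫ x, x ^ 8 ∂(γ : Measure ℝ) = 281 / 15 := by
  obtain ⟨γ, hγ, hγm⟩ := exists_hankelLimit
  refine ⟨γ, fun Ω _ P _ X hm hind hid hvar =>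
      ae_tendsto_hankelSpectralMeasure hγ hγm hm hind hid hvar,
    isSymmetricMeasure_of_hankelMoment hγ hγm, not_isBounded_support_of_hankelMoment hγ hγm,
    not_isUnimodalSymmetric_of_hankelMoment hγ hγm, hγ, ?_, ?_, ?_⟩
  · rw [hγm, hankelMoment_four]
  · rw [hγm, hankelMoment_six]
  · rw [hγm, hankelMoment_eight]
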